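/- Signed graphs $(G,\Sigma)$ are finite; $G$ may have loops and parallel edges, and $\Sigma\subseteq E(G)$ is the set of negative edges. A circuit is negative if it has an odd number of negative edges, and $(G,\Sigma)$ is balanced if it has no negative circuit. Switching at $U\subseteq V(G)$ replaces $\Sigma$ by $\Sigma\,\Delta\,\partial(U)$; signed graphs are considered up to isomorphism and switching. The graph $G$ with all edges negative is denoted by $-G$. Here $C_1$ is one vertex with a loop, and $W_{2t+1}$ is the circuit of length $2t+1$ together with a further vertex joined by one edge to each of its vertices. The frustration index $l(G,\Sigma)$ is the minimum size of an edge set $F$ such that $(G-F,\Sigma-F)$ is balanced. For $k\ge 1$, $(G,\Sigma)$ is $k$-critical if $l(G,\Sigma)=k$ and $l(G-e,\Sigma-e)<k$ for every $e\in E(G)$. A $k$-critical signed graph is decomposable if for some $n\ge 2$ it contains pairwise edge-disjoint $k_i$-critical subgraphs $(H_i,\Sigma\cap E(H_i))$, $1\le i\le n$, with $k=k_1+\dots+k_n$. Subdividing a set $F$ of $t\ge1$ edges of the same sign between vertices $x$ and $y$ ($x=y$ allowed) means deleting $F$ and adding a new vertex $v$, $t$ positive edges between $v$ and $x$, and $t$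 edges of the sign of $F$ between $v$ and $y$; a subdivision of $(H,\Gamma)$ is a signed graph that is obtained from $(H,\Gamma)$ by finitely many (possibly zero) such operations, up to isomorphism and switching at any stage. For $k\ge1$ let $S(k)$ be the set of $k$-critical signed graphs that contain a non-decomposable $m$-critical subgraph for every $m\in\{1,\dots,k\}$, and let $S^*(k)$ be the set of $k$-critical signed graphs all of whose $m$-critical subgraphs, for every $m\in\{1,\dots,k\}$, are non-decomposable. Let $S=\bigcup_{k\ge1}S(k)$ and $S^*=\bigcup_{k\ge1}S^*(k)$. Then: 1. $S(1)=S^*(1)$, and the members of this set without isolated vertices are exactly the subdivisions of $-C_1$. 2. $S(2)=S^*(2)$, and the members of this set without isolated vertices are exactly the subdivisions of $-K_4$. 3. For every $k\ge3$, $\emptyset\neq S^*(k)\subsetneq S(k)$. 4. For every $t\ge2$, $-W_{2t+1}\in S(t+1)\setminus S^*(t+1)$. 5. $S^*\subsetneq S$. -/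

import Mathlib

/-- A finite signed graph `(G, Σ)`: a finite multigraph (loops and parallel edges allowed), with
vertices named by elements of `α` and edges by elements of `β`, and a set `neg` of negative edges. -/
structure SignedGraph (α β : Type*) extends Graph α β where
  neg : Set β
  neg_subset : neg ⊆ edgeSet
  finite_vertexSet : vertexSet.Finite
  finite_edgeSet : edgeSet.Finite

namespace SignedGraph

variable {α β α' β' : Type*}

/-! ### Subgraphs, edge deletion, switching, isomorphism -/

/-- `(H, Γ)` is a subgraph of `(G, Σ)`: `H` is a subgraph of `G` and `Γ = Σ ∩ E(H)`. -/
def IsSubgraph (H G : SignedGraph α β) : Prop :=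
  H.toGraph ≤ G.toGraph ∧ H.neg = G.neg ∩ H.edgeSet

/-- `(G - F, Σ - F)`: delete the edges in `F` and keep all vertices. -/
def deleteEdges (G : SignedGraph α β) (F : Set β) : SignedGraph α β where
  toGraph := G.toGraph.deleteEdges F
  neg := G.neg \ F
  neg_subset := Set.sdiff_subset_sdiff_left G.neg_subset
  finite_vertexSet := G.finite_vertexSet
  finite_edgeSet := G.finite_edgeSet.subset Set.sdiff_subset

/-- The edge-cut `∂(U)`. -/
def edgeCut (G : SignedGraph α β) (U : Set α) : Set β :=
  {e | ∃ x y, G.IsLink e x y ∧ x ∈ U ∧ y ∉ U}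

/-- Switching at `U`: replace the signature `Σ` by `Σ Δ ∂(U)`. -/
def switch (G : SignedGraph α β) (U : Set α) : SignedGraph α β where
  toGraph := G.toGraph
  neg := symmDiff G.neg (G.edgeCut U)
  neg_subset := by
    rintro e (⟨h, -⟩ | ⟨⟨x, y, h, -⟩, -⟩)
    · exact G.neg_subset h
    · exact h.edge_mem
  finite_vertexSet := G.finite_vertexSet
  finite_edgeSet := G.finite_edgeSet

/-- Isomorphism of graphs with given signatures: bijections between the vertex sets and between the
edge sets that preserve incidence and signs. -/
structure Iso (G : SignedGraph α β) (H : SignedGraph α' β') where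
  vertexEquiv : G.vertexSet ≃ H.vertexSet
  edgeEquiv : G.edgeSet ≃ H.edgeSet
  isLink_iff : ∀ e x y,
    H.IsLink (edgeEquiv e) (vertexEquiv x) (vertexEquiv y) ↔ G.IsLink e x y
  mem_neg_iff : ∀ e, (edgeEquiv e : β') ∈ H.neg ↔ (e : β) ∈ G.neg

/-- `G` and `H` are the same signed graph up to renaming and equivalence of signatures. -/
def SwitchIso (G : SignedGraph α β) (H : SignedGraph α' β') : Prop :=
  ∃ U : Set α, Nonempty (Iso (G.switch U) H)

/-- No vertex is isolated. -/
def NoIsolatedVertex (G : SignedGraph α β) : Prop :=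
  ∀ x ∈ G.vertexSet, ∃ e, G.Inc e x

/-! ### Balance, frustration index, criticality -/

/-- `C` is the edge set of a circuit of `G`, of length `n + 1`, with distinct vertices
`v 0, …, v n` and distinct edges `e i` joining `v i` to `v (i + 1)`, indices modulo `n + 1`
(length 1: a loop; length 2: a pair of parallel edges). -/
def IsCircuit (G : SignedGraph α β) (C : Set β) : Prop :=
  ∃ (n : ℕ) (v : Fin (n + 1) → α) (e : Fin (n + 1) → β),
    Function.Injective v ∧ Function.Injective e ∧
      (∀ i, G.IsLink (e i) (v i) (v (i + 1))) ∧ C = Set.range e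

/-- A circuit with an odd number of negative edges. -/
def IsNegativeCircuit (G : SignedGraph α β) (C : Set β) : Prop :=
  G.IsCircuit C ∧ Odd (C ∩ G.neg).ncard

/-- There is no negative circuit. -/
def IsBalanced (G : SignedGraph α β) : Prop :=
  ∀ C, ¬ G.IsNegativeCircuit C

/-- The frustration index `l(G, Σ)` (the set below contains `|E(G)|`, so it is never empty). -/
noncomputable def frustrationIndex (G : SignedGraph α β) : ℕ :=
  sInf {n | ∃ F ⊆ G.edgeSet, F.ncard = n ∧ (G.deleteEdges F).IsBalanced}

/-- `G` is `k`-critical, `k ≥ 1`. -/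
def IsCritical (G : SignedGraph α β) (k : ℕ) : Prop :=
  1 ≤ k ∧ G.frustrationIndex = k ∧
    ∀ e ∈ G.edgeSet, (G.deleteEdges {e}).frustrationIndex < k

/-- `G` is a critical signed graph that is `(k₁, …, kₙ)`-decomposable for some `n ≥ 2` and some
`k₁, …, kₙ`. -/
def IsDecomposable (G : SignedGraph α β) : Prop :=
  ∃ (k n : ℕ) (d : Fin n → ℕ) (H : Fin n → SignedGraph α β),
    G.IsCritical k ∧ 2 ≤ n ∧
    (∀ i, (H i).IsSubgraph G ∧ (H i).IsCritical (d i)) ∧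
    (∀ i j, i ≠ j → Disjoint (H i).edgeSet (H j).edgeSet) ∧
    k = ∑ i, d i

/-! ### Subdivision -/

/-- `G'` is obtained from `G` by subdividing a multiedge: `F` is a nonempty set of edges between `x`
and `y` (a set of loops if `x = y`), all of the same sign. It is deleted, and a new vertex `v` is
joined to `x` by a set `A` of `|F|` positive edges and to `y` by a set `B` of `|F|` edges of the
sign of `F`. -/
def IsMultiedgeSubdivision (G G' : SignedGraph α β) : Prop :=
  ∃ (x y v : α) (F A B : Set β),
    F ⊆ G.edgeSet ∧ F.Nonempty ∧ (∀ e ∈ F, G.IsLink e x y) ∧ v ∉ G.vertexSet ∧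
    A.Finite ∧ B.Finite ∧ A.ncard = F.ncard ∧ B.ncard = F.ncard ∧
    Disjoint A B ∧ Disjoint (A ∪ B) (G.edgeSet \ F) ∧
    G'.vertexSet = insert v G.vertexSet ∧
    (∀ e a b, G'.IsLink e a b ↔
      (G.IsLink e a b ∧ e ∉ F) ∨ (e ∈ A ∧ s(a, b) = s(v, x)) ∨ (e ∈ B ∧ s(a, b) = s(v, y))) ∧
    ((F ⊆ G.neg ∧ G'.neg = (G.neg \ F) ∪ B) ∨ (Disjoint F G.neg ∧ G'.neg = G.neg))

/-- `G` is a subdivision of `H`: up to renaming and equivalence of signatures, it arises from `H`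
by finitely many multiedge subdivisions. -/
def IsSubdivisionOf (G : SignedGraph α β) (H : SignedGraph α' β') : Prop :=
  ∃ H₀ : SignedGraph α β, SwitchIso H H₀ ∧
    Relation.ReflTransGen (fun K K' => IsMultiedgeSubdivision K K' ∨ SwitchIso K K') H₀ G

/-! ### Some antibalanced signed graphs -/

/-- `-G`: every edge is negative. -/
def allNegative (G : Graph α β) (hV : G.vertexSet.Finite) (hE : G.edgeSet.Finite) :
    SignedGraph α β where
  toGraph := G
  neg := G.edgeSet
  neg_subset := subset_rfl
  finite_vertexSet := hV
  finite_edgeSet := hE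

/-- `-C₁`: one vertex with one negative loop. -/
def negC1 : SignedGraph Unit Unit :=
  allNegative (Graph.bouquet () Set.univ) (Set.toFinite _) (Set.toFinite _)

/-- `-K₄`. -/
def negK4 : SignedGraph (Fin 4) (Sym2 (Fin 4)) :=
  allNegative (Graph.ofSimpleGraph ⊤) (Set.toFinite _) (Set.toFinite _)

/-- The wheel with rim `C_n` and hub `none`. -/
def wheelGraph (n : ℕ) : SimpleGraph (Option (Fin n)) where
  Adj
    | none, none => False
    | none, some _ => True
    | some _, none => True
    | some i, some j => (SimpleGraph.cycleGraph n).Adj i j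
  symm := ⟨by rintro (_ | i) (_ | j) h <;> first | exact h | exact h.symm⟩
  loopless := ⟨by rintro (_ | i) h <;> first | exact h | exact h.ne rfl⟩

/-- `-W_{2t+1}`: the antibalanced odd wheel. -/
def negOddWheel (t : ℕ) :
    SignedGraph (Option (Fin (2 * t + 1))) (Sym2 (Option (Fin (2 * t + 1)))) :=
  allNegative (Graph.ofSimpleGraph (wheelGraph (2 * t + 1))) (Set.toFinite _) (Set.toFinite _)

/-! ### The classes `S(k)` and `S*(k)` -/

/-- `S(k)`: the `k`-critical signed graphs that contain a non-decomposable `m`-critical subgraph for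
every `m ∈ {1, …, k}`. -/
def classS (α β : Type*) (k : ℕ) : Set (SignedGraph α β) :=
  {G | G.IsCritical k ∧ ∀ m, 1 ≤ m → m ≤ k →
    ∃ H : SignedGraph α β, H.IsSubgraph G ∧ H.IsCritical m ∧ ¬ H.IsDecomposable}

/-- `S*(k)`: the `k`-critical signed graphs all of whose `m`-critical subgraphs, for every
`m ∈ {1, …, k}`, are non-decomposable. -/
def classSStar (α β : Type*) (k : ℕ) : Set (SignedGraph α β) :=
  {G | G.IsCritical k ∧ ∀ m, 1 ≤ m → m ≤ k →
    ∀ H : SignedGraph α β, H.IsSubgraph G → H.IsCritical m → ¬ H.IsDecomposable}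

end SignedGraph

namespace SignedGraph

variable {α β α' β' : Type*}

/-! ### Signatures -/

/-- The signature obtained by switching at `U`. -/
def sig (G : SignedGraph α β) (U : Set α) : Set β := (G.switch U).neg

lemma mem_edgeCut {G : SignedGraph α β} {e : β} {x y : α} (h : G.IsLink e x y) (U : Set α) :
    e ∈ G.edgeCut U ↔ ¬ (x ∈ U ↔ y ∈ U) := by
  constructor
  · rintro ⟨a, b, hab, ha, hb⟩
    rcases h.eq_and_eq_or_eq_and_eq hab with ⟨rfl, rfl⟩ | ⟨rfl, rfl⟩ <;> tauto
  · intro hn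
    by_cases hx : x ∈ U
    · exact ⟨x, y, h, hx, by tauto⟩
    · exact ⟨y, x, h.symm, by tauto, hx⟩

lemma edgeCut_subset (G : SignedGraph α β) (U : Set α) : G.edgeCut U ⊆ G.edgeSet := by
  rintro e ⟨x, y, h, -⟩
  exact h.edge_mem

lemma sig_subset (G : SignedGraph α β) (U : Set α) : G.sig U ⊆ G.edgeSet :=
  (G.switch U).neg_subset

lemma mem_sig_iff (G : SignedGraph α β) (U : Set α) (e : β) :
    e ∈ G.sig U ↔ ¬ (e ∈ G.neg ↔ e ∈ G.edgeCut U) := by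
  change e ∈ symmDiff _ _ ↔ _
  rw [Set.mem_symmDiff]; tauto

lemma mem_sig {G : SignedGraph α β} {e : β} {x y : α} (h : G.IsLink e x y) (U : Set α) :
    e ∈ G.sig U ↔ (e ∈ G.neg ↔ (x ∈ U ↔ y ∈ U)) := by
  rw [mem_sig_iff, mem_edgeCut h]; tauto

lemma finite_sig (G : SignedGraph α β) (U : Set α) : (G.sig U).Finite :=
  G.finite_edgeSet.subset (G.sig_subset U)

lemma finite_edgeCut (G : SignedGraph α β) (U : Set α) : (G.edgeCut U).Finite :=
  G.finite_edgeSet.subset (G.edgeCut_subset U)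

lemma edgeCut_symmDiff (G : SignedGraph α β) (U W : Set α) :
    G.edgeCut (symmDiff U W) = symmDiff (G.edgeCut U) (G.edgeCut W) := by
  ext e
  by_cases he : e ∈ G.edgeSet
  · obtain ⟨x, y, h⟩ := G.exists_isLink_of_mem_edgeSet he
    rw [Set.mem_symmDiff, mem_edgeCut h, mem_edgeCut h, mem_edgeCut h, Set.mem_symmDiff,
      Set.mem_symmDiff]
    tauto
  · rw [Set.mem_symmDiff]
    have h1 := fun U => mt (fun h => G.edgeCut_subset U h) he
    simp [h1]

lemma sig_symmDiff (G : SignedGraph α β) (U W : Set α) :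
    G.sig (symmDiff U W) = symmDiff (G.sig U) (G.edgeCut W) := by
  change symmDiff _ _ = symmDiff (symmDiff _ _) _
  rw [edgeCut_symmDiff, symmDiff_assoc]

lemma sig_symmDiff_sig (G : SignedGraph α β) (U W : Set α) :
    symmDiff (G.sig U) (G.sig W) = G.edgeCut (symmDiff U W) := by
  change symmDiff (symmDiff _ _) (symmDiff _ _) = _
  rw [edgeCut_symmDiff, symmDiff_symmDiff_symmDiff_comm, symmDiff_self, bot_symmDiff]

lemma sig_switch (G : SignedGraph α β) (U W : Set α) :
    (G.switch U).sig W = G.sig (symmDiff U W) := by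
  rw [sig_symmDiff]; rfl

lemma sig_empty (G : SignedGraph α β) : G.sig ∅ = G.neg := by
  ext e
  rw [mem_sig_iff]
  have : e ∉ G.edgeCut ∅ := by rintro ⟨x, y, -, h, -⟩; exact h
  simp [this]

lemma IsSubgraph.refl (G : SignedGraph α β) : G.IsSubgraph G :=
  ⟨le_rfl, by rw [Set.inter_eq_left.2 G.neg_subset]⟩

lemma IsSubgraph.edgeSet_subset {H G : SignedGraph α β} (h : H.IsSubgraph G) :
    H.edgeSet ⊆ G.edgeSet := h.1.edgeSet_mono

lemma IsSubgraph.sig_eq {H G : SignedGraph α β} (h : H.IsSubgraph G) (U : Set α) :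
    H.sig U = G.sig U ∩ H.edgeSet := by
  ext e
  by_cases he : e ∈ H.edgeSet
  · obtain ⟨x, y, hl⟩ := H.exists_isLink_of_mem_edgeSet he
    have hl' : G.IsLink e x y := h.1.isLink_mono hl
    rw [Set.mem_inter_iff, mem_sig hl, mem_sig hl', h.2, Set.mem_inter_iff]
    tauto
  · have := mt (fun h => H.sig_subset U h) he
    simp [this, he]

lemma edgeSet_deleteEdges (G : SignedGraph α β) (F : Set β) :
    (G.deleteEdges F).edgeSet = G.edgeSet \ F := rfl

lemma isSubgraph_deleteEdges (G : SignedGraph α β) (F : Set β) :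
    (G.deleteEdges F).IsSubgraph G := by
  refine ⟨Graph.deleteEdges_le, ?_⟩
  ext e
  have : e ∈ G.neg → e ∈ G.edgeSet := fun h => G.neg_subset h
  change e ∈ G.neg \ F ↔ e ∈ G.neg ∩ (G.edgeSet \ F)
  simp only [Set.mem_sdiff, Set.mem_inter_iff]
  tauto

lemma sig_deleteEdges (G : SignedGraph α β) (F : Set β) (U : Set α) :
    (G.deleteEdges F).sig U = G.sig U \ F := by
  rw [(G.isSubgraph_deleteEdges F).sig_eq, edgeSet_deleteEdges]
  ext e
  have : e ∈ G.sig U → e ∈ G.edgeSet := fun h => G.sig_subset U h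
  simp only [Set.mem_sdiff, Set.mem_inter_iff]
  tauto

/-! ### Circuits and balance -/

lemma IsCircuit.subset {G : SignedGraph α β} {C : Set β} (hC : G.IsCircuit C) :
    C ⊆ G.edgeSet := by
  obtain ⟨n, v, e, -, -, hl, rfl⟩ := hC
  rintro _ ⟨i, rfl⟩
  exact (hl i).edge_mem

open Classical in
/-- The indicator of a set with values in `ZMod 2`. -/
noncomputable def ind {γ : Type*} (S : Set γ) (x : γ) : ZMod 2 := if x ∈ S then 1 else 0

lemma ncard_range_inter {γ ι : Type*} [Fintype ι] {e : ι → γ} (he : Function.Injective e)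
    (S : Set γ) : (((Set.range e ∩ S).ncard : ℕ) : ZMod 2) = ∑ i, ind S (e i) := by
  classical
  have : Set.range e ∩ S = e '' {i | e i ∈ S} := by
    ext x; constructor
    · rintro ⟨⟨i, rfl⟩, h⟩; exact ⟨i, h, rfl⟩
    · rintro ⟨i, h, rfl⟩; exact ⟨⟨i, rfl⟩, h⟩
  rw [this, Set.ncard_image_of_injective _ he, Set.ncard_eq_toFinset_card', Set.toFinset_ofPred,
    Finset.card_filter]
  push_cast
  rfl

lemma sum_shift {M : Type*} [AddCommMonoid M] (n : ℕ) (f : Fin (n + 1) → M) :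
    ∑ i, f (i + 1) = ∑ i, f i :=
  Fintype.sum_equiv (Equiv.addRight (1 : Fin (n + 1))) _ _ fun _ => rfl

lemma sum_add_shift (n : ℕ) (f : Fin (n + 1) → ZMod 2) :
    ∑ i, (f i + f (i + 1)) = 0 := by
  rw [Finset.sum_add_distrib, sum_shift, CharTwo.add_self_eq_zero]

lemma ind_sig {G : SignedGraph α β} {e : β} {x y : α} (h : G.IsLink e x y) (U : Set α) :
    ind (G.sig U) e = ind G.neg e + (ind U x + ind U y) := by
  have := mem_sig h U
  unfold ind
  by_cases h1 : e ∈ G.neg <;> by_cases h2 : x ∈ U <;> by_cases h3 : y ∈ U <;>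
    simp_all [CharTwo.add_self_eq_zero]

lemma IsCircuit.ncard_inter_sig {G : SignedGraph α β} {C : Set β} (hC : G.IsCircuit C)
    (U : Set α) :
    (((C ∩ G.sig U).ncard : ℕ) : ZMod 2) = ((C ∩ G.neg).ncard : ℕ) := by
  obtain ⟨n, v, e, hv, he, hl, rfl⟩ := hC
  rw [ncard_range_inter he, ncard_range_inter he,
    Finset.sum_congr rfl fun i _ => ind_sig (hl i) U, Finset.sum_add_distrib, sum_add_shift,
    add_zero]

lemma odd_iff_cast (n : ℕ) : Odd n ↔ (n : ZMod 2) = 1 := (ZMod.natCast_eq_one_iff_odd).symm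

lemma IsNegativeCircuit.odd_inter_sig {G : SignedGraph α β} {C : Set β}
    (hC : G.IsNegativeCircuit C) (U : Set α) : Odd (C ∩ G.sig U).ncard := by
  rw [odd_iff_cast, hC.1.ncard_inter_sig, ← odd_iff_cast]; exact hC.2

lemma IsNegativeCircuit.inter_sig_nonempty {G : SignedGraph α β} {C : Set β}
    (hC : G.IsNegativeCircuit C) (U : Set α) : (C ∩ G.sig U).Nonempty := by
  rw [Set.nonempty_iff_ne_empty]
  intro h
  have := hC.odd_inter_sig U
  simp [h] at this

lemma IsSubgraph.isNegativeCircuit {H G : SignedGraph α β} (h : H.IsSubgraph G) {C : Set β}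
    (hC : H.IsNegativeCircuit C) : G.IsNegativeCircuit C := by
  have hs := hC.1.subset
  obtain ⟨⟨n, v, e, hv, he, hl, rfl⟩, ho⟩ := hC
  refine ⟨⟨n, v, e, hv, he, fun i => h.1.isLink_mono (hl i), rfl⟩, ?_⟩
  rwa [h.2, Set.inter_comm G.neg, ← Set.inter_assoc, Set.inter_eq_left.2 hs] at ho

/-- A shortest walk is a path: its vertices are distinct. -/
lemma exists_path {G : SignedGraph α β} {x y : α}
    (h : Relation.ReflTransGen (fun a b => ∃ e, G.IsLink e a b) x y) :
    ∃ (n : ℕ) (v : ℕ → α), v 0 = x ∧ v n = y ∧ (∀ i < n, ∃ e, G.IsLink e (v i) (v (i + 1))) ∧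
      Set.InjOn v (Set.Iic n) := by
  classical
  have hex : ∃ n, ∃ v : ℕ → α, v 0 = x ∧ v n = y ∧
      ∀ i < n, ∃ e, G.IsLink e (v i) (v (i + 1)) := by
    induction h with
    | refl => exact ⟨0, fun _ => x, rfl, rfl, by simp⟩
    | @tail b c _ hbc ih =>
      obtain ⟨n, v, h0, hn, hv⟩ := ih
      refine ⟨n + 1, fun i => if i ≤ n then v i else c, by simp [h0], by simp, fun i hi => ?_⟩
      rcases Nat.lt_succ_iff_lt_or_eq.1 hi with h | rfl
      · simpa [h.le, Nat.succ_le_of_lt h] using hv i h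
      · simpa [hn] using hbc
  obtain ⟨v, h0, hn, hv⟩ := Nat.find_spec hex
  set n := Nat.find hex with hn_def
  refine ⟨n, v, h0, hn, hv, ?_⟩
  have key : ∀ i j, i < j → j ≤ n → v i ≠ v j := by
    intro i j hij hj hvij
    refine Nat.find_min hex (m := n - (j - i)) (by omega)
      ⟨fun k => if k ≤ i then v k else v (k + (j - i)), by simp [h0], ?_, ?_⟩
    · dsimp only
      split_ifs with hk
      · have h1 : n = j := by omega
        have h2 : n - (j - i) = i := by omega
        rw [h2, hvij, ← h1, hn]
      · rw [Nat.sub_add_cancel (by omega), hn]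
    · intro k hk
      dsimp only
      rcases lt_trichotomy k i with h | h | h
      · rw [if_pos h.le, if_pos (by omega)]; exact hv k (by omega)
      · subst h
        rw [if_pos le_rfl, if_neg (by omega), hvij]
        have := hv j (by omega)
        rwa [show k + 1 + (j - k) = j + 1 by omega]
      · rw [if_neg (by omega), if_neg (by omega)]
        have := hv (k + (j - i)) (by omega)
        rwa [show k + 1 + (j - i) = k + (j - i) + 1 by omega]
  intro i hi j hj hvij
  by_contra hne
  rcases lt_or_gt_of_ne hne with h | h
  · exact key i j h hj hvij
  · exact key j i h hi hvij.symm

/-- A path together with an edge joining its ends is a circuit. -/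
lemma isCircuit_of_path {G : SignedGraph α β} {n : ℕ} {v : ℕ → α} {f : ℕ → β} {e : β}
    (hv : Set.InjOn v (Set.Iic n)) (hf : ∀ i < n, G.IsLink (f i) (v i) (v (i + 1)))
    (he : G.IsLink e (v n) (v 0)) (hef : ∀ i < n, f i ≠ e) :
    G.IsCircuit (insert e (f '' Set.Iio n)) := by
  classical
  have hinj : ∀ i j, i < j → j < n → f i ≠ f j := by
    intro i j hij hj h
    have h1 := hf i (by omega)
    rw [h] at h1
    rcases h1.eq_and_eq_or_eq_and_eq (hf j hj) with ⟨h2, -⟩ | ⟨h2, -⟩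
    · exact absurd (hv (Set.mem_Iic.2 (by omega)) (Set.mem_Iic.2 (by omega)) h2) (by omega)
    · exact absurd (hv (Set.mem_Iic.2 (by omega)) (Set.mem_Iic.2 (by omega)) h2) (by omega)
  refine ⟨n, fun i => v i, fun i => if (i : ℕ) < n then f i else e, ?_, ?_, ?_, ?_⟩
  · intro i j h
    exact Fin.ext (hv (Set.mem_Iic.2 (by omega)) (Set.mem_Iic.2 (by omega)) h)
  · intro i j h
    dsimp only at h
    split_ifs at h with h1 h2 h2
    · by_contra hne
      rcases lt_or_gt_of_ne (fun h' => hne (Fin.ext h')) with h' | h'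
      · exact hinj _ _ h' h2 h
      · exact hinj _ _ h' h1 h.symm
    · exact absurd h (hef _ h1)
    · exact absurd h.symm (hef _ h2)
    · exact Fin.ext (by omega)
  · intro i
    dsimp only
    split_ifs with h1
    · have : ((i + 1 : Fin (n + 1)) : ℕ) = i + 1 := by
        rw [Fin.val_add_one_of_lt]
        rw [Fin.lt_def]; simpa using h1
      rw [this]; exact hf _ h1
    · have hi : i = Fin.last n := Fin.ext (by simp; omega)
      subst hi
      simpa using he
  · ext b
    constructor
    · rintro (rfl | ⟨i, hi, rfl⟩)
      · exact ⟨Fin.last n, by simp⟩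
      · have hi' : i < n := hi
        exact ⟨⟨i, by omega⟩, by simp [hi']⟩
    · rintro ⟨i, rfl⟩
      dsimp only
      split_ifs with h1
      · exact Or.inr ⟨i, h1, rfl⟩
      · exact Or.inl rfl

/-- A signed graph is balanced if and only if its signature is a cut. -/
theorem isBalanced_iff (G : SignedGraph α β) : G.IsBalanced ↔ ∃ U, G.sig U = ∅ := by
  constructor
  · induction h : G.edgeSet.ncard generalizing G with
    | zero =>
      intro _
      rw [Set.ncard_eq_zero G.finite_edgeSet] at h
      exact ⟨∅, Set.eq_empty_of_subset_empty (h ▸ G.sig_subset ∅)⟩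
    | succ k ih =>
      intro hb
      obtain ⟨e, he⟩ : G.edgeSet.Nonempty := by
        rw [← Set.ncard_pos G.finite_edgeSet]; omega
      obtain ⟨U, hU⟩ := ih (G.deleteEdges {e})
        (by rw [edgeSet_deleteEdges, Set.ncard_sdiff_singleton_of_mem he]; omega)
        (fun C hC => hb C ((G.isSubgraph_deleteEdges _).isNegativeCircuit hC))
      rw [sig_deleteEdges, Set.sdiff_eq_empty] at hU
      by_cases heU : e ∈ G.sig U
      swap
      · refine ⟨U, Set.eq_empty_of_forall_notMem fun f hf => heU ?_⟩
        rwa [← Set.mem_singleton_iff.1 (hU hf)]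
      obtain ⟨x, y, hl⟩ := G.exists_isLink_of_mem_edgeSet he
      by_cases hr : Relation.ReflTransGen
          (fun a b => ∃ f, (G.deleteEdges {e}).IsLink f a b) y x
      · exfalso
        obtain ⟨n, v, h0, hn, hv, hinj⟩ := exists_path hr
        have : Nonempty β := ⟨e⟩
        choose! f hf using hv
        have hC := isCircuit_of_path (G := G) hinj
          (fun i hi => (G.isSubgraph_deleteEdges {e}).1.isLink_mono (hf i hi))
          (by rw [h0, hn]; exact hl) (fun i hi => ((hf i hi).edge_mem).2)
        refine hb _ ⟨hC, ?_⟩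
        rw [odd_iff_cast, ← hC.ncard_inter_sig U, ← odd_iff_cast]
        have : G.sig U = {e} := Set.Subset.antisymm hU (by simpa using heU)
        rw [this, Set.inter_eq_right.2 (by simp)]
        simp
      · refine ⟨symmDiff U {z | Relation.ReflTransGen
          (fun a b => ∃ f, (G.deleteEdges {e}).IsLink f a b) y z}, ?_⟩
        rw [sig_symmDiff]
        ext f
        simp only [Set.mem_symmDiff, Set.mem_empty_iff_false, iff_false]
        by_cases hfe : f = e
        · subst hfe
          have : f ∈ G.edgeCut {z | Relation.ReflTransGen
              (fun a b => ∃ f', (G.deleteEdges {f}).IsLink f' a b) y z} :=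
            ⟨y, x, hl.symm, Relation.ReflTransGen.refl, hr⟩
          tauto
        · have h1 : f ∉ G.sig U := fun h => hfe (hU h)
          have h2 : f ∉ G.edgeCut {z | Relation.ReflTransGen
              (fun a b => ∃ f', (G.deleteEdges {e}).IsLink f' a b) y z} := by
            rintro ⟨a, b, hab, ha, hb'⟩
            refine hb' (Relation.ReflTransGen.tail ha ⟨f, ?_⟩)
            rw [deleteEdges, Graph.deleteEdges_isLink]; exact ⟨hab, hfe⟩
          tauto
  · rintro ⟨U, hU⟩ C hC
    simpa [hU] using hC.inter_sig_nonempty U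

lemma exists_isNegativeCircuit {G : SignedGraph α β} (h : ∀ U, (G.sig U).Nonempty) :
    ∃ C, G.IsNegativeCircuit C := by
  by_contra! hn
  obtain ⟨U, hU⟩ := G.isBalanced_iff.1 hn
  simpa [hU] using h U

lemma isBalanced_deleteEdges_iff (G : SignedGraph α β) (F : Set β) :
    (G.deleteEdges F).IsBalanced ↔ ∃ U, G.sig U ⊆ F := by
  simp [isBalanced_iff, sig_deleteEdges, Set.sdiff_eq_empty]

/-! ### Frustration index and criticality in terms of signatures -/

lemma frustrationIndex_le (G : SignedGraph α β) (U : Set α) :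
    G.frustrationIndex ≤ (G.sig U).ncard :=
  Nat.sInf_le ⟨G.sig U, G.sig_subset U, rfl, (G.isBalanced_deleteEdges_iff _).2 ⟨U, subset_rfl⟩⟩

lemma exists_sig_ncard (G : SignedGraph α β) : ∃ U, (G.sig U).ncard = G.frustrationIndex := by
  have : G.frustrationIndex ∈
      {n | ∃ F ⊆ G.edgeSet, F.ncard = n ∧ (G.deleteEdges F).IsBalanced} :=
    Nat.sInf_mem ⟨_, G.sig ∅, G.sig_subset ∅, rfl,
      (G.isBalanced_deleteEdges_iff _).2 ⟨∅, subset_rfl⟩⟩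
  obtain ⟨F, hF, hc, hb⟩ := this
  obtain ⟨U, hU⟩ := (G.isBalanced_deleteEdges_iff _).1 hb
  refine ⟨U, le_antisymm ?_ (G.frustrationIndex_le U)⟩
  rw [← hc]
  exact Set.ncard_le_ncard hU (G.finite_edgeSet.subset hF)

lemma le_frustrationIndex_iff (G : SignedGraph α β) (k : ℕ) :
    k ≤ G.frustrationIndex ↔ ∀ U, k ≤ (G.sig U).ncard := by
  refine ⟨fun h U => h.trans (G.frustrationIndex_le U), fun h => ?_⟩
  obtain ⟨U, hU⟩ := G.exists_sig_ncard
  exact hU ▸ h U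

lemma isCritical_iff (G : SignedGraph α β) (k : ℕ) :
    G.IsCritical k ↔ 1 ≤ k ∧ (∀ U, k ≤ (G.sig U).ncard) ∧ (∃ U, (G.sig U).ncard = k) ∧
      ∀ e ∈ G.edgeSet, ∃ U, e ∈ G.sig U ∧ (G.sig U).ncard = k := by
  constructor
  · rintro ⟨h1, h2, h3⟩
    have hle := (G.le_frustrationIndex_iff k).1 h2.ge
    refine ⟨h1, hle, h2 ▸ G.exists_sig_ncard, fun e he => ?_⟩
    obtain ⟨U, hU⟩ := (G.deleteEdges {e}).exists_sig_ncard
    have h4 := h3 e he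
    rw [← hU, sig_deleteEdges] at h4
    have h5 := hle U
    have heU : e ∈ G.sig U := by
      by_contra h
      rw [Set.sdiff_singleton_eq_self h] at h4
      omega
    rw [Set.ncard_sdiff_singleton_of_mem heU] at h4
    exact ⟨U, heU, by omega⟩
  · rintro ⟨h1, h2, ⟨U, hU⟩, h3⟩
    refine ⟨h1, le_antisymm (hU ▸ G.frustrationIndex_le U) ((G.le_frustrationIndex_iff k).2 h2),
      fun e he => ?_⟩
    obtain ⟨W, heW, hW⟩ := h3 e he
    refine ((G.deleteEdges {e}).frustrationIndex_le W).trans_lt ?_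
    rw [sig_deleteEdges, Set.ncard_sdiff_singleton_of_mem heW]
    omega

section

/-! ### Critical subgraphs and decomposability -/

/-- The spanning subgraph with edge set `E(G) ∩ K`. -/
def keep (G : SignedGraph α β) (K : Set β) : SignedGraph α β := G.deleteEdges (G.edgeSet \ K)

lemma isSubgraph_keep (G : SignedGraph α β) (K : Set β) : (G.keep K).IsSubgraph G :=
  G.isSubgraph_deleteEdges _

lemma edgeSet_keep (G : SignedGraph α β) (K : Set β) : (G.keep K).edgeSet = G.edgeSet ∩ K := by
  rw [keep, edgeSet_deleteEdges, Set.sdiff_sdiff_right_self]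

lemma sig_keep (G : SignedGraph α β) (K : Set β) (U : Set α) :
    (G.keep K).sig U = G.sig U ∩ K := by
  rw [(G.isSubgraph_keep K).sig_eq, edgeSet_keep, ← Set.inter_assoc,
    Set.inter_eq_left.2 (G.sig_subset U)]

lemma IsCritical.le_ncard {G : SignedGraph α β} {k : ℕ} (h : G.IsCritical k) (U : Set α) :
    k ≤ (G.sig U).ncard := ((G.isCritical_iff k).1 h).2.1 U

lemma IsCritical.exists_mem_sig {G : SignedGraph α β} {k : ℕ} (h : G.IsCritical k) {e : β}
    (he : e ∈ G.edgeSet) : ∃ U, e ∈ G.sig U ∧ (G.sig U).ncard = k :=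
  ((G.isCritical_iff k).1 h).2.2.2 e he

lemma IsCritical.eq {G : SignedGraph α β} {k l : ℕ} (h : G.IsCritical k) (h' : G.IsCritical l) :
    k = l := h.2.1.symm.trans h'.2.1

lemma exists_isCritical_keep (G : SignedGraph α β) {m : ℕ} (hm : 1 ≤ m) {K : Set β}
    (hK : K ⊆ G.edgeSet) (h : ∀ U, m ≤ (G.sig U ∩ K).ncard) :
    ∃ L ⊆ K, (G.keep L).IsCritical m := by
  have hfin : {L | L ⊆ K ∧ ∀ U, m ≤ (G.sig U ∩ L).ncard}.Finite :=
    (G.finite_edgeSet.subset hK).finite_subsets.subset fun L hL => hL.1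
  obtain ⟨L, hL⟩ := hfin.exists_minimal ⟨K, subset_rfl, h⟩
  refine ⟨L, hL.1.1, (isCritical_iff _ _).2 ⟨hm, by simpa [sig_keep] using hL.1.2, ?_⟩⟩
  have key : ∀ e ∈ L, ∃ U, e ∈ G.sig U ∩ L ∧ (G.sig U ∩ L).ncard = m := by
    intro e he
    by_contra! hcon
    have : L \ {e} ∈ {L | L ⊆ K ∧ ∀ U, m ≤ (G.sig U ∩ L).ncard} := by
      refine ⟨Set.sdiff_subset.trans hL.1.1, fun U => ?_⟩
      have h1 := hL.1.2 U
      have h2 := hcon U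
      rw [← Set.inter_sdiff_assoc]
      by_cases heU : e ∈ G.sig U ∩ L
      · rw [Set.ncard_sdiff_singleton_of_mem heU]
        have := h2 heU
        omega
      · rwa [Set.sdiff_singleton_eq_self heU]
    exact (hL.2 this Set.sdiff_subset he).2 rfl
  obtain ⟨e, he⟩ : L.Nonempty := by
    obtain ⟨e, he⟩ : (G.sig ∅ ∩ L).Nonempty := by
      rw [← Set.ncard_pos ((G.finite_sig _).inter_of_left _)]
      have := hL.1.2 ∅
      omega
    exact ⟨e, he.2⟩
  simp only [sig_keep]
  refine ⟨(key e he).imp fun U h => h.2, fun e he => key e ?_⟩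
  rw [edgeSet_keep] at he
  exact he.2

lemma exists_isCritical_le {G : SignedGraph α β} {k m : ℕ} (h : G.IsCritical k) (hm : 1 ≤ m)
    (hmk : m ≤ k) : ∃ H : SignedGraph α β, H.IsSubgraph G ∧ H.IsCritical m := by
  obtain ⟨L, -, hL⟩ := G.exists_isCritical_keep hm subset_rfl
    (fun U => by rw [Set.inter_eq_left.2 (G.sig_subset U)]; exact hmk.trans (h.le_ncard U))
  exact ⟨_, G.isSubgraph_keep L, hL⟩

/-- The edge set can be split into two parts each of which contains a negative circuit. -/
def Splits (G : SignedGraph α β) : Prop :=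
  ∃ X, ∀ U, (G.sig U ∩ X).Nonempty ∧ (G.sig U \ X).Nonempty

/-- Collecting the parts of a decomposition into two groups. -/
lemma IsDecomposable.exists_bipartition {G : SignedGraph α β} (h : G.IsDecomposable) :
    ∃ (k a b : ℕ) (A : Set β), G.IsCritical k ∧ 1 ≤ a ∧ 1 ≤ b ∧ k = a + b ∧
      ∀ U, a ≤ (G.sig U ∩ A).ncard ∧ b ≤ (G.sig U \ A).ncard := by
  classical
  obtain ⟨k, n, d, H, hk, hn, hH, hdisj, hsum⟩ := h
  obtain ⟨n, rfl⟩ : ∃ n', n = n' + 2 := ⟨n - 2, by omega⟩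
  refine ⟨k, d 0, ∑ i : Fin (n + 1), d i.succ, (H 0).edgeSet, hk, (hH 0).2.1, ?_, ?_,
    fun U => ⟨?_, ?_⟩⟩
  · exact (hH 1).2.1.trans (Finset.single_le_sum (f := fun i : Fin (n + 1) => d i.succ)
      (fun _ _ => Nat.zero_le _) (Finset.mem_univ 0))
  · rw [hsum, Fin.sum_univ_succ]
  · rw [← (hH 0).1.sig_eq]; exact (hH 0).2.le_ncard U
  · calc ∑ i : Fin (n + 1), d i.succ
        ≤ ∑ i : Fin (n + 1), ((H i.succ).sig U).ncard :=
          Finset.sum_le_sum fun i _ => (hH i.succ).2.le_ncard U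
      _ = (⋃ i : Fin (n + 1), (H i.succ).sig U).ncard := by
          rw [Set.ncard_iUnion_of_finite (s := fun i : Fin (n + 1) => (H i.succ).sig U)
            (fun i => (H i.succ).finite_sig U), finsum_eq_sum_of_fintype]
          intro i j hij
          exact (hdisj _ _ (by simpa using hij)).mono ((H _).sig_subset U) ((H _).sig_subset U)
      _ ≤ _ := by
          refine Set.ncard_le_ncard (Set.iUnion_subset fun i e he => ?_)
            ((G.finite_sig U).subset Set.sdiff_subset)
          refine ⟨((hH i.succ).1.sig_eq U ▸ he).1, fun he' => ?_⟩
          exact Set.disjoint_left.1 (hdisj i.succ 0 (Fin.succ_ne_zero i))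
            ((H _).sig_subset U he) he'

lemma IsDecomposable.splits {H G : SignedGraph α β} (h : H.IsDecomposable)
    (hHG : H.IsSubgraph G) : G.Splits := by
  obtain ⟨k, a, b, A, -, ha, hb, -, hAB⟩ := h.exists_bipartition
  refine ⟨A, fun U => ?_⟩
  have h1 := hAB U
  have h2 : (H.sig U ∩ A).Nonempty := by
    rw [← Set.ncard_pos ((H.finite_sig U).inter_of_left _)]; omega
  have h3 : (H.sig U \ A).Nonempty := by
    rw [← Set.ncard_pos ((H.finite_sig U).subset Set.sdiff_subset)]; omega
  have h4 : H.sig U ⊆ G.sig U := by rw [hHG.sig_eq]; exact Set.inter_subset_left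
  exact ⟨h2.mono (Set.inter_subset_inter_left _ h4), h3.mono (Set.sdiff_subset_sdiff_left h4)⟩

lemma IsCritical.not_isDecomposable {G : SignedGraph α β} (h : G.IsCritical 1) :
    ¬ G.IsDecomposable := by
  intro hd
  obtain ⟨k, a, b, A, hk, ha, hb, hab, -⟩ := hd.exists_bipartition
  have := h.eq hk
  omega

lemma isDecomposable_of_isSubgraph {G H K : SignedGraph α β} {k a b : ℕ} (hG : G.IsCritical k)
    (hH : H.IsSubgraph G) (hHa : H.IsCritical a) (hK : K.IsSubgraph G) (hKb : K.IsCritical b)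
    (hHK : Disjoint H.edgeSet K.edgeSet) (hk : k = a + b) : G.IsDecomposable := by
  refine ⟨k, 2, ![a, b], ![H, K], hG, le_rfl, ?_, ?_, by simpa using hk⟩
  · intro i
    fin_cases i
    · exact ⟨hH, hHa⟩
    · exact ⟨hK, hKb⟩
  · intro i j hij
    fin_cases i <;> fin_cases j
    · exact absurd rfl hij
    · exact hHK
    · exact hHK.symm
    · exact absurd rfl hij

lemma IsCritical.isDecomposable_iff {G : SignedGraph α β} (h : G.IsCritical 2) :
    G.IsDecomposable ↔ G.Splits := by
  refine ⟨fun hd => hd.splits (.refl G), ?_⟩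
  rintro ⟨X, hX⟩
  obtain ⟨A, hA, hA'⟩ := G.exists_isCritical_keep (m := 1) le_rfl
    (K := G.edgeSet ∩ X) Set.inter_subset_left (fun U => by
      rw [← Set.inter_assoc, Set.inter_eq_left.2 (G.sig_subset U), Nat.one_le_iff_ne_zero,
        ← Nat.pos_iff_ne_zero, Set.ncard_pos ((G.finite_sig U).inter_of_left _)]
      exact (hX U).1)
  obtain ⟨B, hB, hB'⟩ := G.exists_isCritical_keep (m := 1) le_rfl
    (K := G.edgeSet \ X) Set.sdiff_subset (fun U => by
      rw [← Set.inter_sdiff_assoc, Set.inter_eq_left.2 (G.sig_subset U), Nat.one_le_iff_ne_zero,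
        ← Nat.pos_iff_ne_zero, Set.ncard_pos ((G.finite_sig U).subset Set.sdiff_subset)]
      exact (hX U).2)
  refine isDecomposable_of_isSubgraph h (G.isSubgraph_keep A) hA' (G.isSubgraph_keep B) hB' ?_ rfl
  rw [edgeSet_keep, edgeSet_keep]
  exact Set.disjoint_left.2 fun e h1 h2 => (hB h2.2).2 (hA h1.2).2

lemma IsSubgraph.edgeSet_eq {H G : SignedGraph α β} (h : H.IsSubgraph G) {k : ℕ}
    (hH : H.IsCritical k) (hG : G.IsCritical k) : H.edgeSet = G.edgeSet := by
  refine h.edgeSet_subset.antisymm fun e he => ?_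
  by_contra hn
  obtain ⟨U, heU, hU⟩ := hG.exists_mem_sig he
  have h1 := hH.le_ncard U
  have h2 : (H.sig U).ncard < (G.sig U).ncard := by
    refine Set.ncard_lt_ncard ⟨?_, fun h3 => hn (H.sig_subset U (h3 heU))⟩ (G.finite_sig U)
    rw [h.sig_eq]; exact Set.inter_subset_left
  omega

lemma mem_classS_one {G : SignedGraph α β} : G ∈ classS α β 1 ↔ G.IsCritical 1 := by
  refine ⟨fun h => h.1, fun h => ⟨h, fun m h1 h2 => ?_⟩⟩
  obtain rfl : m = 1 := by omega
  exact ⟨G, .refl G, h, h.not_isDecomposable⟩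

lemma mem_classSStar_one {G : SignedGraph α β} : G ∈ classSStar α β 1 ↔ G.IsCritical 1 := by
  refine ⟨fun h => h.1, fun h => ⟨h, fun m h1 h2 H _ hH => ?_⟩⟩
  obtain rfl : m = 1 := by omega
  exact hH.not_isDecomposable

lemma mem_classS_of_not_splits {G : SignedGraph α β} {k : ℕ} (h : G.IsCritical k)
    (hs : ¬ G.Splits) : G ∈ classSStar α β k :=
  ⟨h, fun _ _ _ _ hHG _ hd => hs (hd.splits hHG)⟩

lemma classSStar_subset_classS (k : ℕ) : classSStar α β k ⊆ classS α β k := by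
  rintro G ⟨hG, h⟩
  refine ⟨hG, fun m h1 h2 => ?_⟩
  obtain ⟨H, hHG, hH⟩ := exists_isCritical_le hG h1 h2
  exact ⟨H, hHG, hH, h m h1 h2 H hHG hH⟩

lemma mem_classS_two {G : SignedGraph α β} :
    G ∈ classS α β 2 ↔ G.IsCritical 2 ∧ ¬ G.Splits := by
  constructor
  · rintro ⟨hG, h⟩
    obtain ⟨H, hHG, hH, hd⟩ := h 2 (by norm_num) le_rfl
    refine ⟨hG, fun hs => hd (hH.isDecomposable_iff.2 ?_)⟩
    obtain ⟨X, hX⟩ := hs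
    refine ⟨X, fun U => ?_⟩
    rw [hHG.sig_eq, hHG.edgeSet_eq hH hG, Set.inter_eq_left.2 (G.sig_subset U)]
    exact hX U
  · rintro ⟨hG, hs⟩
    exact classSStar_subset_classS 2 (mem_classS_of_not_splits hG hs)

lemma classS_two_eq : classS α β 2 = classSStar α β 2 := by
  refine Set.Subset.antisymm (fun G hG => ?_) (classSStar_subset_classS 2)
  obtain ⟨h1, h2⟩ := mem_classS_two.1 hG
  exact mem_classS_of_not_splits h1 h2

/-! ### Presentations of the signatures of a signed graph -/

/-- The edges of `G` are parametrized by `E` via `κ`, and the signatures equivalent to that of `G`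
by the sets `fr c`. -/
structure Presents {E γ : Type*} (G : SignedGraph α β) (κ : E → β) (fr : γ → Set E) : Prop where
  injective : Function.Injective κ
  range_eq : Set.range κ = G.edgeSet
  exists_fr : ∀ U, ∃ c, G.sig U = κ '' fr c
  exists_sig : ∀ c, ∃ U, G.sig U = κ '' fr c

variable {E γ : Type*} {G : SignedGraph α β} {κ : E → β} {fr : γ → Set E}

lemma Presents.le_ncard_iff (h : G.Presents κ fr) (K : Set E) (m : ℕ) :
    (∀ U, m ≤ (G.sig U ∩ κ '' K).ncard) ↔ ∀ c, m ≤ (fr c ∩ K).ncard := by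
  constructor
  · intro hU c
    obtain ⟨U, hc⟩ := h.exists_sig c
    have := hU U
    rwa [hc, ← Set.image_inter h.injective, Set.ncard_image_of_injective _ h.injective] at this
  · intro hc U
    obtain ⟨c, hU⟩ := h.exists_fr U
    rw [hU, ← Set.image_inter h.injective, Set.ncard_image_of_injective _ h.injective]
    exact hc c

lemma Presents.isCritical_keep_iff (h : G.Presents κ fr) (K : Set E) (k : ℕ) :
    (G.keep (κ '' K)).IsCritical k ↔ 1 ≤ k ∧ (∀ c, k ≤ (fr c ∩ K).ncard) ∧
      (∃ c, (fr c ∩ K).ncard = k) ∧ ∀ e ∈ K, ∃ c, e ∈ fr c ∧ (fr c ∩ K).ncard = k := by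
  rw [isCritical_iff]
  simp only [sig_keep, h.le_ncard_iff]
  have key : ∀ U c, G.sig U = κ '' fr c → (G.sig U ∩ κ '' K).ncard = (fr c ∩ K).ncard := by
    intro U c hc
    rw [hc, ← Set.image_inter h.injective, Set.ncard_image_of_injective _ h.injective]
  refine and_congr_right fun _ => and_congr_right fun _ => and_congr ⟨?_, ?_⟩ ?_
  · rintro ⟨U, hU⟩
    obtain ⟨c, hc⟩ := h.exists_fr U
    exact ⟨c, (key U c hc).symm.trans hU⟩
  · rintro ⟨c, hc⟩
    obtain ⟨U, hU⟩ := h.exists_sig c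
    exact ⟨U, (key U c hU).trans hc⟩
  · rw [edgeSet_keep, ← h.range_eq, Set.inter_eq_right.2 (Set.image_subset_range κ K),
      Set.forall_mem_image]
    refine forall₂_congr fun e he => ⟨?_, ?_⟩
    · rintro ⟨U, hU⟩
      obtain ⟨c, hc⟩ := h.exists_fr U
      rw [key U c hc, hc, ← Set.image_inter h.injective, h.injective.mem_set_image] at hU
      exact ⟨c, hU.1.1, hU.2⟩
    · rintro ⟨c, hc⟩
      obtain ⟨U, hU⟩ := h.exists_sig c
      refine ⟨U, ?_⟩
      rw [key U c hU, hU, ← Set.image_inter h.injective, h.injective.mem_set_image]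
      exact ⟨⟨hc.1, he⟩, hc.2⟩

lemma keep_univ (G : SignedGraph α β) {K : Set β} (h : G.edgeSet ⊆ K) (k : ℕ) :
    (G.keep K).IsCritical k ↔ G.IsCritical k := by
  have : ∀ U, (G.keep K).sig U = G.sig U := fun U => by
    rw [sig_keep, Set.inter_eq_left.2 ((G.sig_subset U).trans h)]
  simp only [isCritical_iff, this, edgeSet_keep, Set.inter_eq_left.2 h]

lemma Presents.isCritical_iff (h : G.Presents κ fr) (k : ℕ) :
    G.IsCritical k ↔ 1 ≤ k ∧ (∀ c, k ≤ (fr c).ncard) ∧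
      (∃ c, (fr c).ncard = k) ∧ ∀ e, ∃ c, e ∈ fr c ∧ (fr c).ncard = k := by
  have := h.isCritical_keep_iff Set.univ k
  rw [keep_univ _ (by rw [Set.image_univ, h.range_eq])] at this
  simpa using this

lemma Presents.splits_iff (h : G.Presents κ fr) :
    G.Splits ↔ ∃ X, ∀ c, (fr c ∩ X).Nonempty ∧ (fr c \ X).Nonempty := by
  constructor
  · rintro ⟨X, hX⟩
    refine ⟨κ ⁻¹' X, fun c => ?_⟩
    obtain ⟨U, hU⟩ := h.exists_sig c
    have := hX U
    rw [hU] at this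
    obtain ⟨⟨_, ⟨e, he, rfl⟩, h1⟩, ⟨_, ⟨f, hf, rfl⟩, h2⟩⟩ := this
    exact ⟨⟨e, he, h1⟩, ⟨f, hf, h2⟩⟩
  · rintro ⟨X, hX⟩
    refine ⟨κ '' X, fun U => ?_⟩
    obtain ⟨c, hc⟩ := h.exists_fr U
    obtain ⟨⟨e, he, h1⟩, ⟨f, hf, h2⟩⟩ := hX c
    rw [hc]
    exact ⟨⟨κ e, ⟨e, he, rfl⟩, ⟨e, h1, rfl⟩⟩, ⟨κ f, ⟨f, hf, rfl⟩,
      fun h3 => h2 ((h.injective.mem_set_image).1 h3)⟩⟩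

lemma Presents.switch (h : G.Presents κ fr) (W : Set α) : (G.switch W).Presents κ fr where
  injective := h.injective
  range_eq := h.range_eq
  exists_fr U := by rw [sig_switch]; exact h.exists_fr _
  exists_sig c := by
    obtain ⟨U, hU⟩ := h.exists_sig c
    exact ⟨symmDiff W U, by rw [sig_switch, symmDiff_symmDiff_cancel_left, hU]⟩

lemma Presents.iso {H : SignedGraph α' β'} (h : G.Presents κ fr) (φ : Iso G H) :
    ∃ κ' : E → β', H.Presents κ' fr := by
  have hmem : ∀ e, κ e ∈ G.edgeSet := fun e => h.range_eq ▸ Set.mem_range_self e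
  have key : ∀ (U : Set α) (U' : Set α'), (∀ x : G.vertexSet, (x : α) ∈ U ↔
      (φ.vertexEquiv x : α') ∈ U') → ∀ c, G.sig U = κ '' fr c →
      H.sig U' = (fun e => (φ.edgeEquiv ⟨κ e, hmem e⟩ : β')) '' fr c := by
    intro U U' hUU' c hc
    have h1 : ∀ e (he : e ∈ G.edgeSet), (φ.edgeEquiv ⟨e, he⟩ : β') ∈ H.sig U' ↔ e ∈ G.sig U := by
      intro e he
      obtain ⟨x, y, hl⟩ := G.exists_isLink_of_mem_edgeSet he
      have hl' := (φ.isLink_iff ⟨e, he⟩ ⟨x, hl.left_mem⟩ ⟨y, hl.right_mem⟩).2 hl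
      rw [mem_sig hl', mem_sig hl, ← hUU' ⟨x, hl.left_mem⟩, ← hUU' ⟨y, hl.right_mem⟩,
        φ.mem_neg_iff ⟨e, he⟩]
    ext f
    constructor
    · intro hf
      obtain ⟨⟨e, he⟩, hef⟩ := φ.edgeEquiv.surjective ⟨f, H.sig_subset U' hf⟩
      have hef' : (φ.edgeEquiv ⟨e, he⟩ : β') = f := congrArg Subtype.val hef
      rw [← hef', h1, hc] at hf
      obtain ⟨e', he', rfl⟩ := hf
      exact ⟨e', he', hef'⟩
    · rintro ⟨e, he, rfl⟩
      rw [h1, hc]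
      exact ⟨e, he, rfl⟩
  refine ⟨fun e => (φ.edgeEquiv ⟨κ e, hmem e⟩ : β'), ⟨?_, ?_, ?_, ?_⟩⟩
  · intro e f hef
    have := φ.edgeEquiv.injective (Subtype.ext hef)
    exact h.injective (congrArg Subtype.val this)
  · ext f
    constructor
    · rintro ⟨e, rfl⟩; exact Subtype.property _
    · intro hf
      obtain ⟨⟨e, he⟩, hef⟩ := φ.edgeEquiv.surjective ⟨f, hf⟩
      obtain ⟨e', rfl⟩ : e ∈ Set.range κ := h.range_eq ▸ he
      exact ⟨e', congrArg Subtype.val hef⟩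
  · intro U'
    obtain ⟨c, hc⟩ := h.exists_fr
      {x | ∃ hx : x ∈ G.vertexSet, (φ.vertexEquiv ⟨x, hx⟩ : α') ∈ U'}
    refine ⟨c, key _ _ ?_ c hc⟩
    rintro ⟨x, hx⟩
    exact ⟨fun ⟨_, h⟩ => h, fun h => ⟨hx, h⟩⟩
  · intro c
    obtain ⟨U, hU⟩ := h.exists_sig c
    refine ⟨{x' | ∃ x : G.vertexSet, (x : α) ∈ U ∧ (φ.vertexEquiv x : α') = x'},
      key U _ ?_ c hU⟩
    intro x
    constructor
    · intro hx; exact ⟨x, hx, rfl⟩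
    · rintro ⟨y, hy, hyx⟩
      rwa [← φ.vertexEquiv.injective (Subtype.ext hyx)]

lemma Presents.switchIso {H : SignedGraph α' β'} (h : G.Presents κ fr) (hGH : SwitchIso G H) :
    ∃ κ' : E → β', H.Presents κ' fr := by
  obtain ⟨W, ⟨φ⟩⟩ := hGH
  exact (h.switch W).iso φ

lemma presents_self (G : SignedGraph α β) :
    G.Presents (Subtype.val : G.edgeSet → β) (fun U : Set α => Subtype.val ⁻¹' G.sig U) := by
  have : ∀ U, G.sig U = Subtype.val '' (Subtype.val ⁻¹' G.sig U : Set G.edgeSet) := fun U => by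
    rw [Subtype.image_preimage_coe, Set.inter_eq_right.2 (G.sig_subset U)]
  exact ⟨Subtype.val_injective, Subtype.range_coe, fun U => ⟨U, this U⟩, fun U => ⟨U, this U⟩⟩

lemma SwitchIso.isCritical_iff {G : SignedGraph α β} {H : SignedGraph α' β'} (h : SwitchIso G H)
    (k : ℕ) : H.IsCritical k ↔ G.IsCritical k := by
  obtain ⟨κ, hκ⟩ := G.presents_self.switchIso h
  rw [hκ.isCritical_iff, G.presents_self.isCritical_iff]

lemma SwitchIso.splits_iff {G : SignedGraph α β} {H : SignedGraph α' β'} (h : SwitchIso G H) :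
    H.Splits ↔ G.Splits := by
  obtain ⟨κ, hκ⟩ := G.presents_self.switchIso h
  rw [hκ.splits_iff, G.presents_self.splits_iff]

lemma SwitchIso.noIsolatedVertex {G : SignedGraph α β} {H : SignedGraph α' β'}
    (h : SwitchIso G H) (hG : G.NoIsolatedVertex) : H.NoIsolatedVertex := by
  obtain ⟨W, ⟨φ⟩⟩ := h
  intro x hx
  obtain ⟨⟨x', hx'⟩, hxx⟩ := φ.vertexEquiv.surjective ⟨x, hx⟩
  obtain ⟨e, y, hl⟩ := hG x' hx'
  have := (φ.isLink_iff ⟨e, hl.edge_mem⟩ ⟨x', hx'⟩ ⟨y, hl.right_mem⟩).2 hl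
  rw [hxx] at this
  exact ⟨_, _, this⟩

end

/-! ### Invariance under subdivision -/

/-- The effect on edges and signatures of replacing the edges in `F` by twice as many edges,
`A` and `B`. -/
structure EdgeDoubling (K K' : SignedGraph α β) (F A B : Set β) : Prop where
  subset : F ⊆ K.edgeSet
  nonempty : F.Nonempty
  finite_left : A.Finite
  finite_right : B.Finite
  ncard_left : A.ncard = F.ncard
  ncard_right : B.ncard = F.ncard
  disjoint : Disjoint A B
  disjoint_union : Disjoint (A ∪ B) (K.edgeSet \ F)
  edgeSet_eq : K'.edgeSet = (K.edgeSet \ F) ∪ (A ∪ B)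
  sdiff_eq : ∀ U, K'.sig U \ (A ∪ B) = K.sig U \ F
  cases : ∀ U, (K.sig U ∩ F = F ∧ (K'.sig U ∩ (A ∪ B) = A ∨ K'.sig U ∩ (A ∪ B) = B)) ∨
    (K.sig U ∩ F = ∅ ∧ (K'.sig U ∩ (A ∪ B) = ∅ ∨ K'.sig U ∩ (A ∪ B) = A ∪ B))
  avoid_left : ∀ U, ∃ U', K.sig U' = K.sig U ∧ Disjoint (K'.sig U') A
  avoid_right : ∀ U, ∃ U', K.sig U' = K.sig U ∧ Disjoint (K'.sig U') B

lemma IsMultiedgeSubdivision.exists_edgeDoubling {K K' : SignedGraph α β}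
    (h : IsMultiedgeSubdivision K K') : ∃ F A B, EdgeDoubling K K' F A B := by
  obtain ⟨x, y, v, F, A, B, hFE, hFne, hF, hv, hA, hB, hAF, hBF, hAB, hABE, hV, hl, hneg⟩ := h
  have hFA : F.Finite := K.finite_edgeSet.subset hFE
  have lA : ∀ e ∈ A, K'.IsLink e v x := fun e he => (hl e v x).2 (Or.inr (Or.inl ⟨he, rfl⟩))
  have lB : ∀ e ∈ B, K'.IsLink e v y := fun e he => (hl e v y).2 (Or.inr (Or.inr ⟨he, rfl⟩))
  have hnotA : ∀ e ∈ A, e ∉ K.edgeSet \ F := fun e he h' =>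
    Set.disjoint_left.1 hABE (Or.inl he) h'
  have hnotB : ∀ e ∈ B, e ∉ K.edgeSet \ F := fun e he h' =>
    Set.disjoint_left.1 hABE (Or.inr he) h'
  have hN : ∀ e, e ∈ K.neg → e ∈ K.edgeSet := fun e he => K.neg_subset he
  obtain ⟨σ, s1, s2, s3, s4⟩ : ∃ σ : Prop, (∀ e ∈ F, (e ∈ K.neg ↔ σ)) ∧
      (∀ e ∈ A, e ∉ K'.neg) ∧ (∀ e ∈ B, (e ∈ K'.neg ↔ σ)) ∧
      ∀ e ∈ K.edgeSet \ F, (e ∈ K'.neg ↔ e ∈ K.neg) := by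
    rcases hneg with ⟨h1, h2⟩ | ⟨h1, h2⟩
    · refine ⟨True, fun e he => by simpa using h1 he, fun e he h3 => ?_, fun e he => ?_,
        fun e he => ?_⟩
      · rw [h2] at h3
        rcases h3 with h3 | h3
        · exact hnotA e he ⟨hN e h3.1, h3.2⟩
        · exact Set.disjoint_left.1 hAB he h3
      · rw [h2]; simp [he]
      · rw [h2]
        have : e ∉ B := fun h4 => hnotB e h4 he
        simp [this, he.2]
    · rw [Set.disjoint_left] at h1
      refine ⟨False, fun e he => by simpa using h1 he, fun e he h3 => ?_, fun e he => ?_,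
        fun e he => by rw [h2]⟩
      · rw [h2] at h3
        exact hnotA e he ⟨hN e h3, fun h4 => h1 h4 h3⟩
      · rw [h2, iff_false]
        exact fun h3 => hnotB e he ⟨hN e h3, fun h4 => h1 h4 h3⟩
  have mF : ∀ U, ∀ e ∈ F, (e ∈ K.sig U ↔ (σ ↔ (x ∈ U ↔ y ∈ U))) := fun U e he => by
    rw [mem_sig (hF e he), s1 e he]
  have mA : ∀ U, ∀ e ∈ A, (e ∈ K'.sig U ↔ ¬ (v ∈ U ↔ x ∈ U)) := fun U e he => by
    rw [mem_sig (lA e he), iff_false_left (s2 e he)]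
  have mB : ∀ U, ∀ e ∈ B, (e ∈ K'.sig U ↔ (σ ↔ (v ∈ U ↔ y ∈ U))) := fun U e he => by
    rw [mem_sig (lB e he), s3 e he]
  have hedge : K'.edgeSet = (K.edgeSet \ F) ∪ (A ∪ B) := by
    ext e
    rw [Graph.edge_mem_iff_exists_isLink]
    constructor
    · rintro ⟨a, b, hab⟩
      rcases (hl e a b).1 hab with ⟨h1, h2⟩ | ⟨h1, -⟩ | ⟨h1, -⟩
      · exact Or.inl ⟨h1.edge_mem, h2⟩
      · exact Or.inr (Or.inl h1)
      · exact Or.inr (Or.inr h1)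
    · rintro (⟨h1, h2⟩ | h1 | h1)
      · obtain ⟨a, b, hab⟩ := K.exists_isLink_of_mem_edgeSet h1
        exact ⟨a, b, (hl e a b).2 (Or.inl ⟨hab, h2⟩)⟩
      · exact ⟨_, _, lA e h1⟩
      · exact ⟨_, _, lB e h1⟩
  obtain ⟨f, hf⟩ := hFne
  have hx : x ≠ v := fun h => hv (h ▸ (hF f hf).left_mem)
  have hy : y ≠ v := fun h => hv (h ▸ (hF f hf).right_mem)
  have sig_congr : ∀ U W : Set α, (∀ z, z ≠ v → (z ∈ U ↔ z ∈ W)) → K.sig U = K.sig W := by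
    intro U W h
    ext e
    by_cases he : e ∈ K.edgeSet
    · obtain ⟨a, b, hab⟩ := K.exists_isLink_of_mem_edgeSet he
      rw [mem_sig hab, mem_sig hab, h a (fun h' => hv (h' ▸ hab.left_mem)),
        h b (fun h' => hv (h' ▸ hab.right_mem))]
    · exact iff_of_false (fun h => he (K.sig_subset _ h)) (fun h => he (K.sig_subset _ h))
  refine ⟨F, A, B, hFE, ⟨f, hf⟩, hA, hB, hAF, hBF, hAB, hABE, hedge, ?_, ?_, ?_, ?_⟩
  · intro U
    ext e
    constructor
    · rintro ⟨h1, h2⟩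
      have h3 := K'.sig_subset U h1
      rw [hedge] at h3
      have h4 := h3.resolve_right h2
      obtain ⟨a, b, hab⟩ := K.exists_isLink_of_mem_edgeSet h4.1
      have hab' := (hl e a b).2 (Or.inl ⟨hab, h4.2⟩)
      rw [mem_sig hab', s4 e h4, ← mem_sig hab] at h1
      exact ⟨h1, h4.2⟩
    · rintro ⟨h1, h2⟩
      have h4 : e ∈ K.edgeSet \ F := ⟨K.sig_subset U h1, h2⟩
      obtain ⟨a, b, hab⟩ := K.exists_isLink_of_mem_edgeSet h4.1
      have hab' := (hl e a b).2 (Or.inl ⟨hab, h4.2⟩)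
      rw [mem_sig hab, ← s4 e h4, ← mem_sig hab'] at h1
      exact ⟨h1, fun h5 => Set.disjoint_left.1 hABE h5 h4⟩
  · intro U
    have hA' : ∀ e ∈ A, e ∉ B := fun e h1 h2 => Set.disjoint_left.1 hAB h1 h2
    have e1 : K.sig U ∩ F = {e ∈ F | σ ↔ (x ∈ U ↔ y ∈ U)} := by
      ext e
      have := mF U e
      simp only [Set.mem_inter_iff, Set.mem_ofPred_eq]; tauto
    have e2 : K'.sig U ∩ (A ∪ B) = {e ∈ A | ¬ (v ∈ U ↔ x ∈ U)} ∪
        {e ∈ B | σ ↔ (v ∈ U ↔ y ∈ U)} := by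
      ext e
      simp only [Set.mem_inter_iff, Set.mem_union, Set.mem_ofPred_eq]
      by_cases h1 : e ∈ A
      · simp only [h1, hA' e h1, mA U e h1, and_true, true_and, false_and, or_false]
      · by_cases h2 : e ∈ B
        · simp only [h1, h2, mB U e h2, or_true, and_true, true_and, false_and, false_or]
        · simp only [h1, h2, or_false, and_false, false_and]
    rw [e1, e2]
    by_cases hσ : σ <;> by_cases h1 : x ∈ U <;> by_cases h2 : y ∈ U <;> by_cases h3 : v ∈ U <;>
      simp [hσ, h1, h2, h3]
  · intro U
    by_cases h1 : x ∈ U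
    · refine ⟨insert v U, sig_congr _ _ fun z hz => by simp [hz], ?_⟩
      rw [Set.disjoint_right]
      intro e he
      rw [mA _ e he]
      simp [h1]
    · refine ⟨U \ {v}, sig_congr _ _ fun z hz => by simp [hz], ?_⟩
      rw [Set.disjoint_right]
      intro e he
      rw [mA _ e he]
      simp [h1]
  · intro U
    by_cases h1 : σ ↔ y ∈ U
    · refine ⟨U \ {v}, sig_congr _ _ fun z hz => by simp [hz], ?_⟩
      rw [Set.disjoint_right]
      intro e he
      rw [mB _ e he]
      have : y ∈ U \ {v} ↔ y ∈ U := by simp [hy]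
      have h3 : v ∉ U \ {v} := by simp
      tauto
    · refine ⟨insert v U, sig_congr _ _ fun z hz => by simp [hz], ?_⟩
      rw [Set.disjoint_right]
      intro e he
      rw [mB _ e he]
      have : y ∈ insert v U ↔ y ∈ U := by simp [hy]
      have h3 : v ∈ insert v U := by simp
      tauto

lemma IsMultiedgeSubdivision.noIsolatedVertex {K K' : SignedGraph α β}
    (h : IsMultiedgeSubdivision K K') (hK : K.NoIsolatedVertex) : K'.NoIsolatedVertex := by
  obtain ⟨x, y, v, F, A, B, hFE, ⟨f, hf⟩, hF, hv, hA, hB, hAF, hBF, hAB, hABE, hV, hl, hneg⟩ := h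
  have hFpos : 0 < F.ncard := (Set.ncard_pos (K.finite_edgeSet.subset hFE)).2 ⟨f, hf⟩
  obtain ⟨a, ha⟩ : A.Nonempty := by rw [← Set.ncard_pos hA]; omega
  obtain ⟨b, hb⟩ : B.Nonempty := by rw [← Set.ncard_pos hB]; omega
  have lA : K'.IsLink a v x := (hl a v x).2 (Or.inr (Or.inl ⟨ha, rfl⟩))
  have lB : K'.IsLink b v y := (hl b v y).2 (Or.inr (Or.inr ⟨hb, rfl⟩))
  intro z hz
  rw [hV] at hz
  rcases hz with rfl | hz
  · exact ⟨a, x, lA⟩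
  obtain ⟨e, w, hew⟩ := hK z hz
  by_cases heF : e ∈ F
  · rcases (Graph.IsLink.left_eq_or_eq hew (hF e heF)) with rfl | rfl
    · exact ⟨a, v, lA.symm⟩
    · exact ⟨b, v, lB.symm⟩
  · exact ⟨e, w, (hl e z w).2 (Or.inl ⟨hew, heF⟩)⟩

lemma ncard_sig_eq_add (K : SignedGraph α β) (F : Set β) (U : Set α) :
    (K.sig U).ncard = (K.sig U \ F).ncard + (K.sig U ∩ F).ncard := by
  rw [add_comm, Set.ncard_inter_add_ncard_sdiff_eq_ncard _ _ (K.finite_sig U)]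

lemma exists_subset_of_ncard_eq {A F : Set β} (hA : A.Finite) (hF : F.Finite)
    (h : A.ncard = F.ncard) (X : Set β) : ∃ A' ⊆ A, ((F ∩ X).Nonempty → A'.Nonempty) ∧
      ((F \ X).Nonempty → (A \ A').Nonempty) := by
  by_cases h1 : (F ∩ X).Nonempty
  · obtain ⟨f, hf, hfX⟩ := h1
    obtain ⟨a, ha⟩ : A.Nonempty := by
      rw [← Set.ncard_pos hA, h, Set.ncard_pos hF]; exact ⟨f, hf⟩
    by_cases h2 : (F \ X).Nonempty
    · obtain ⟨g, hg, hgX⟩ := h2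
      have : 1 < A.ncard := by
        rw [h, Set.one_lt_ncard_iff hF]
        exact ⟨f, g, hf, hg, fun h3 => hgX (h3 ▸ hfX)⟩
      obtain ⟨b, hb, hba⟩ := Set.exists_ne_of_one_lt_ncard this a
      exact ⟨{a}, by simpa using ha, fun _ => ⟨a, rfl⟩, fun _ => ⟨b, hb, hba⟩⟩
    · exact ⟨A, subset_rfl, fun _ => ⟨a, ha⟩, fun h3 => absurd h3 h2⟩
  · refine ⟨∅, Set.empty_subset A, fun h3 => absurd h3 h1, ?_⟩
    rintro ⟨f, hf, -⟩
    rw [Set.sdiff_empty, ← Set.ncard_pos hA, h, Set.ncard_pos hF]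
    exact ⟨f, hf⟩

namespace EdgeDoubling

variable {K K' : SignedGraph α β} {F A B : Set β} (h : EdgeDoubling K K' F A B)
include h

lemma ncard_pos : 0 < F.ncard := (Set.ncard_pos (K.finite_edgeSet.subset h.subset)).2 h.nonempty

lemma nonempty_left : A.Nonempty := by
  rw [← Set.ncard_pos h.finite_left, h.ncard_left]; exact h.ncard_pos

lemma ncard_sig' (U : Set α) :
    (K'.sig U).ncard = (K.sig U \ F).ncard + (K'.sig U ∩ (A ∪ B)).ncard := by
  rw [← h.sdiff_eq, add_comm, Set.ncard_inter_add_ncard_sdiff_eq_ncard _ _ (K'.finite_sig U)]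

lemma ncard_cases (U : Set α) :
    ((K'.sig U).ncard = (K.sig U).ncard) ∨
      (K.sig U ∩ F = ∅ ∧ (K.sig U).ncard < (K'.sig U).ncard) := by
  rw [K.ncard_sig_eq_add F U, h.ncard_sig' U]
  rcases h.cases U with ⟨h1, h2 | h2⟩ | ⟨h1, h2 | h2⟩
  · rw [h1, h2, h.ncard_left]; exact Or.inl rfl
  · rw [h1, h2, h.ncard_right]; exact Or.inl rfl
  · rw [h1, h2]; exact Or.inl (by simp)
  · rw [h1, h2]
    refine Or.inr ⟨rfl, ?_⟩
    have := h.ncard_pos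
    rw [Set.ncard_union_eq h.disjoint h.finite_left h.finite_right, h.ncard_left]
    simp; omega

lemma ncard_le (U : Set α) : (K.sig U).ncard ≤ (K'.sig U).ncard := by
  rcases h.ncard_cases U with h1 | h1 <;> omega

lemma avoid_left' (U : Set α) : ∃ U', K.sig U' = K.sig U ∧ Disjoint (K'.sig U') A ∧
    (K'.sig U').ncard = (K.sig U).ncard ∧ (K.sig U ∩ F = F → B ⊆ K'.sig U') ∧
    (K.sig U ∩ F = ∅ → Disjoint (K'.sig U') (A ∪ B)) := by
  obtain ⟨U', h1, h2⟩ := h.avoid_left U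
  obtain ⟨a, ha⟩ := h.nonempty_left
  have hF := h.nonempty.ne_empty
  have ha' : a ∉ K'.sig U' := Set.disjoint_right.1 h2 ha
  have n1 : K'.sig U' ∩ (A ∪ B) ≠ A := fun h3 => ha' (h3.symm ▸ ha : a ∈ K'.sig U' ∩ (A ∪ B)).1
  have n2 : K'.sig U' ∩ (A ∪ B) ≠ A ∪ B := fun h3 =>
    ha' (h3.symm ▸ Or.inl ha : a ∈ K'.sig U' ∩ (A ∪ B)).1
  rw [← h1]
  refine ⟨U', rfl, h2, ?_, fun h3 => ?_, fun h3 => ?_⟩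
  · rw [K.ncard_sig_eq_add F U', h.ncard_sig' U']
    rcases h.cases U' with ⟨h3, h4 | h4⟩ | ⟨h3, h4 | h4⟩
    · exact absurd h4 n1
    · rw [h3, h4, h.ncard_right]
    · rw [h3, h4]
    · exact absurd h4 n2
  · rcases h.cases U' with ⟨-, h4 | h4⟩ | ⟨h4, -⟩
    · exact absurd h4 n1
    · exact h4.ge.trans Set.inter_subset_left
    · exact absurd (h3.symm.trans h4) hF
  · rcases h.cases U' with ⟨h4, -⟩ | ⟨-, h4 | h4⟩
    · exact absurd (h4.symm.trans h3) hF
    · exact Set.disjoint_iff_inter_eq_empty.2 h4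
    · exact absurd h4 n2

/-- Interchanging the roles of the two bundles of new edges. -/
lemma symm : EdgeDoubling K K' F B A where
  subset := h.subset
  nonempty := h.nonempty
  finite_left := h.finite_right
  finite_right := h.finite_left
  ncard_left := h.ncard_right
  ncard_right := h.ncard_left
  disjoint := h.disjoint.symm
  disjoint_union := Set.union_comm A B ▸ h.disjoint_union
  edgeSet_eq := Set.union_comm A B ▸ h.edgeSet_eq
  sdiff_eq := Set.union_comm A B ▸ h.sdiff_eq
  cases U := by
    have := h.cases U
    rw [Set.union_comm B A]
    tauto
  avoid_left := h.avoid_right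
  avoid_right := h.avoid_left

lemma exists_mem_right {k : ℕ} (hK : K.IsCritical k) {e : β} (he : e ∈ B) :
    ∃ U, e ∈ K'.sig U ∧ (K'.sig U).ncard = k := by
  obtain ⟨f, hf⟩ := h.nonempty
  obtain ⟨U, hfU, hU⟩ := hK.exists_mem_sig (h.subset hf)
  obtain ⟨U', h1, h2, h3, h4, h5⟩ := h.avoid_left' U
  refine ⟨U', h4 ?_ he, h3.trans hU⟩
  rcases h.cases U with ⟨h6, -⟩ | ⟨h6, -⟩
  · exact h6
  · exact absurd (h6 ▸ ⟨hfU, hf⟩ : f ∈ (∅ : Set β)) (Set.notMem_empty f)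

lemma isCritical {k : ℕ} (hK : K.IsCritical k) : K'.IsCritical k := by
  obtain ⟨hk, h1, ⟨U, hU⟩, h2⟩ := (K.isCritical_iff k).1 hK
  refine (isCritical_iff _ _).2 ⟨hk, fun U => (h1 U).trans (h.ncard_le U), ?_, ?_⟩
  · obtain ⟨U', -, -, h3, -⟩ := h.avoid_left' U
    exact ⟨U', h3.trans hU⟩
  · intro e he
    rw [h.edgeSet_eq] at he
    rcases he with he | he | he
    · obtain ⟨U, heU, hU⟩ := h2 e he.1
      obtain ⟨U', h3, -, h4, -⟩ := h.avoid_left' U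
      refine ⟨U', ?_, h4.trans hU⟩
      have : e ∈ K.sig U' \ F := ⟨h3 ▸ heU, he.2⟩
      rw [← h.sdiff_eq] at this
      exact this.1
    · exact h.symm.exists_mem_right hK he
    · exact h.exists_mem_right hK he

lemma isCritical_of {k : ℕ} (hK : K'.IsCritical k) : K.IsCritical k := by
  obtain ⟨hk, h1, ⟨U, hU⟩, h2⟩ := (K'.isCritical_iff k).1 hK
  have h3 : ∀ U, k ≤ (K.sig U).ncard := fun U => by
    obtain ⟨U', -, -, h4, -⟩ := h.avoid_left' U
    exact h4 ▸ h1 U'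
  have h4 : ∀ U, (K'.sig U).ncard = k → (K.sig U).ncard = k := fun U hU =>
    le_antisymm (hU ▸ h.ncard_le U) (h3 U)
  refine (isCritical_iff _ _).2 ⟨hk, h3, ⟨U, h4 U hU⟩, fun e he => ?_⟩
  by_cases heF : e ∈ F
  · obtain ⟨a, ha⟩ := h.nonempty_left
    obtain ⟨U, haU, hU⟩ := h2 a (by rw [h.edgeSet_eq]; exact Or.inr (Or.inl ha))
    refine ⟨U, ?_, h4 U hU⟩
    rcases h.cases U with ⟨h5, -⟩ | ⟨h5, h6⟩
    · exact (h5.symm ▸ heF : e ∈ K.sig U ∩ F).1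
    · exfalso
      rcases h6 with h6 | h6
      · exact absurd (h6 ▸ ⟨haU, Or.inl ha⟩ : a ∈ (∅ : Set β)) (Set.notMem_empty a)
      · have h7 := K.ncard_sig_eq_add F U
        have h8 := h.ncard_sig' U
        have h9 := h4 U hU
        rw [h5, Set.ncard_empty] at h7
        rw [h6, Set.ncard_union_eq h.disjoint h.finite_left h.finite_right, h.ncard_left] at h8
        have := h.ncard_pos
        omega
  · have he' : e ∈ K.edgeSet \ F := ⟨he, heF⟩
    obtain ⟨U, heU, hU⟩ := h2 e (by rw [h.edgeSet_eq]; exact Or.inl he')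
    refine ⟨U, ?_, h4 U hU⟩
    have : e ∈ K'.sig U \ (A ∪ B) :=
      ⟨heU, fun h5 => Set.disjoint_left.1 h.disjoint_union h5 he'⟩
    rw [h.sdiff_eq] at this
    exact this.1

/-- A set of edges that misses some signature of `K` also does so in `K'`, if `F` is suitably
distributed. -/
lemma exists_disjoint {X X' : Set β} (hX : X' \ (A ∪ B) ⊆ X)
    (hY : (X' ∩ A).Nonempty → (X' ∩ B).Nonempty → (X ∩ F).Nonempty)
    (hU : ∃ U, Disjoint (K.sig U) X) : ∃ U, Disjoint (K'.sig U) X' := by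
  obtain ⟨U, hU⟩ := hU
  rw [Set.disjoint_left] at hU
  have main : ∀ U', K.sig U' = K.sig U → (∀ e ∈ A ∪ B, e ∈ X' → e ∉ K'.sig U') →
      Disjoint (K'.sig U') X' := by
    intro U' h1 h2
    rw [Set.disjoint_left]
    intro e he heX
    by_cases heAB : e ∈ A ∪ B
    · exact h2 e heAB heX he
    · have : e ∈ K.sig U' \ F := by rw [← h.sdiff_eq]; exact ⟨he, heAB⟩
      exact hU (h1 ▸ this.1) (hX ⟨heX, heAB⟩)
  by_cases hA : (X' ∩ A).Nonempty
  · by_cases hB : (X' ∩ B).Nonempty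
    · obtain ⟨f, hfX, hfF⟩ := hY hA hB
      obtain ⟨U', h1, h2, h3, h4, h5⟩ := h.avoid_left' U
      refine ⟨U', main U' h1 fun e he _ => Set.disjoint_right.1 (h5 ?_) he⟩
      rcases h.cases U with ⟨h6, -⟩ | ⟨h6, -⟩
      · exact absurd hfX (hU (h6.symm ▸ hfF : f ∈ K.sig U ∩ F).1)
      · exact h6
    · obtain ⟨U', h1, h2, -⟩ := h.avoid_left' U
      refine ⟨U', main U' h1 fun e he heX => ?_⟩
      rcases he with he | he
      · exact Set.disjoint_right.1 h2 he
      · exact absurd ⟨e, heX, he⟩ hB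
  · obtain ⟨U', h1, h2, -⟩ := h.symm.avoid_left' U
    refine ⟨U', main U' h1 fun e he heX => ?_⟩
    rcases he with he | he
    · exact absurd ⟨e, heX, he⟩ hA
    · exact Set.disjoint_right.1 h2 he

lemma not_splits (hK : ¬ K.Splits) : ¬ K'.Splits := by
  rintro ⟨X', hX'⟩
  have hK' : ∀ X, (∃ U, Disjoint (K.sig U) X) ∨ ∃ U, Disjoint (K.sig U) Xᶜ := by
    intro X
    by_contra! hcon
    refine hK ⟨X, fun U => ⟨Set.not_disjoint_iff_nonempty_inter.1 (hcon.1 U), ?_⟩⟩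
    have := Set.not_disjoint_iff_nonempty_inter.1 (hcon.2 U)
    rwa [← Set.sdiff_eq] at this
  have hFfin := K.finite_edgeSet.subset h.subset
  obtain ⟨Y, hYF, h1, h2⟩ := exists_subset_of_ncard_eq hFfin h.finite_left h.ncard_left.symm X'
  rcases hK' ((X' \ (A ∪ B)) \ F ∪ Y) with hU | hU
  · have hsub : ∃ U, Disjoint (K'.sig U) ((X' ∩ K'.edgeSet)) := by
      refine h.exists_disjoint ?_ ?_ hU
      · rintro e ⟨⟨he, heE⟩, heAB⟩
        rw [h.edgeSet_eq] at heE
        exact Or.inl ⟨⟨he, heAB⟩, (heE.resolve_right heAB).2⟩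
      · rintro ⟨a, ha, haA⟩ ⟨b, hb, hbB⟩
        obtain ⟨f, hf⟩ := h1 ⟨a, haA, ha.1⟩
        exact ⟨f, Or.inr hf, hYF hf⟩
    obtain ⟨U, hU⟩ := hsub
    obtain ⟨e, he, heX⟩ := (hX' U).1
    exact Set.disjoint_left.1 hU he ⟨heX, K'.sig_subset U he⟩
  · have hsub : ∃ U, Disjoint (K'.sig U) ((X'ᶜ ∩ K'.edgeSet)) := by
      refine h.exists_disjoint ?_ ?_ hU
      · rintro e ⟨⟨he, heE⟩, heAB⟩
        rw [h.edgeSet_eq] at heE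
        have heF := (heE.resolve_right heAB).2
        rintro (h3 | h3)
        · exact he h3.1.1
        · exact heF (hYF h3)
      · rintro ⟨a, ha, haA⟩ ⟨b, hb, hbB⟩
        obtain ⟨f, hf, hfY⟩ := h2 ⟨a, haA, ha.1⟩
        refine ⟨f, ?_, hf⟩
        rintro (h3 | h3)
        · exact h3.2 hf
        · exact hfY h3
    obtain ⟨U, hU⟩ := hsub
    obtain ⟨e, he, heX⟩ := (hX' U).2
    exact Set.disjoint_left.1 hU he ⟨heX, K'.sig_subset U he⟩

end EdgeDoubling

lemma EdgeDoubling.not_splits_of {K K' : SignedGraph α β} {F A B : Set β}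
    (h : EdgeDoubling K K' F A B) (hK : ¬ K'.Splits) : ¬ K.Splits := by
  rintro ⟨X, hX⟩
  have hFfin := K.finite_edgeSet.subset h.subset
  obtain ⟨A', hA', hA1, hA2⟩ := exists_subset_of_ncard_eq h.finite_left hFfin h.ncard_left X
  obtain ⟨B', hB', hB1, hB2⟩ := exists_subset_of_ncard_eq h.finite_right hFfin h.ncard_right X
  have main : ∀ U e, e ∈ K.sig U → e ∉ F → e ∈ K'.sig U ∧ e ∉ A ∪ B := by
    intro U e he hef
    have : e ∈ K.sig U \ F := ⟨he, hef⟩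
    rw [← h.sdiff_eq] at this
    exact this
  have hf : ∀ U, ∀ f ∈ K.sig U, f ∈ F → A ⊆ K'.sig U ∨ B ⊆ K'.sig U := by
    intro U f hfU hfF
    rcases h.cases U with ⟨-, h2 | h2⟩ | ⟨h1, -⟩
    · exact Or.inl (h2.ge.trans Set.inter_subset_left)
    · exact Or.inr (h2.ge.trans Set.inter_subset_left)
    · exact absurd (h1 ▸ ⟨hfU, hfF⟩ : f ∈ (∅ : Set β)) (Set.notMem_empty f)
  have hAB := Set.disjoint_left.1 h.disjoint
  refine hK ⟨(X \ (A ∪ B)) ∪ (A' ∪ B'), fun U => ⟨?_, ?_⟩⟩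
  · obtain ⟨e, he, heX⟩ := (hX U).1
    by_cases heF : e ∈ F
    · rcases hf U e he heF with h1 | h1
      · obtain ⟨a, ha⟩ := hA1 ⟨e, heF, heX⟩
        exact ⟨a, h1 (hA' ha), Or.inr (Or.inl ha)⟩
      · obtain ⟨b, hb⟩ := hB1 ⟨e, heF, heX⟩
        exact ⟨b, h1 (hB' hb), Or.inr (Or.inr hb)⟩
    · obtain ⟨h1, h2⟩ := main U e he heF
      exact ⟨e, h1, Or.inl ⟨heX, h2⟩⟩
  · obtain ⟨e, he, heX⟩ := (hX U).2
    by_cases heF : e ∈ F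
    · rcases hf U e he heF with h1 | h1
      · obtain ⟨a, ha, haA⟩ := hA2 ⟨e, heF, heX⟩
        refine ⟨a, h1 ha, ?_⟩
        rintro (h2 | h2 | h2)
        · exact h2.2 (Or.inl ha)
        · exact haA h2
        · exact hAB ha (hB' h2)
      · obtain ⟨b, hb, hbB⟩ := hB2 ⟨e, heF, heX⟩
        refine ⟨b, h1 hb, ?_⟩
        rintro (h2 | h2 | h2)
        · exact h2.2 (Or.inr hb)
        · exact hAB (hA' h2) hb
        · exact hbB h2
    · obtain ⟨h1, h2⟩ := main U e he heF
      refine ⟨e, h1, ?_⟩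
      rintro (h3 | h3 | h3)
      · exact heX h3.1
      · exact h2 (Or.inl (hA' h3))
      · exact h2 (Or.inr (hB' h3))

/-- What is preserved by subdivision, and determines the members of `S(1)` and `S(2)`. -/
def IsReducedCritical (G : SignedGraph α β) (k : ℕ) : Prop :=
  G.IsCritical k ∧ ¬ G.Splits ∧ G.NoIsolatedVertex

lemma SwitchIso.isReducedCritical {G : SignedGraph α β} {H : SignedGraph α' β'}
    (h : SwitchIso G H) {k : ℕ} (hG : G.IsReducedCritical k) : H.IsReducedCritical k :=
  ⟨(h.isCritical_iff k).2 hG.1, fun hs => hG.2.1 (h.splits_iff.1 hs), h.noIsolatedVertex hG.2.2⟩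

lemma IsSubdivisionOf.isReducedCritical {G : SignedGraph α β} {H : SignedGraph α' β'}
    (h : G.IsSubdivisionOf H) {k : ℕ} (hH : H.IsReducedCritical k) : G.IsReducedCritical k := by
  obtain ⟨H₀, h0, hr⟩ := h
  induction hr with
  | refl => exact h0.isReducedCritical hH
  | tail _ h1 ih =>
    rcases h1 with h1 | h1
    · obtain ⟨F, A, B, hd⟩ := h1.exists_edgeDoubling
      exact ⟨hd.isCritical ih.1, hd.not_splits ih.2.1, h1.noIsolatedVertex ih.2.2⟩
    · exact h1.isReducedCritical ih

/-! ### Suppressing a vertex of degree two -/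

lemma SwitchIso.switch_self (G : SignedGraph α β) (U : Set α) : SwitchIso (G.switch U) G := by
  refine ⟨U, ⟨⟨Equiv.refl _, Equiv.refl _, fun _ _ _ => Iff.rfl, fun e => ?_⟩⟩⟩
  have : (((G.switch U).switch U)).neg = G.neg := by
    change (G.switch U).sig U = _
    rw [sig_switch, symmDiff_self]; exact G.sig_empty
  rw [this]
  rfl

lemma SwitchIso.to_switch (G : SignedGraph α β) (U : Set α) : SwitchIso G (G.switch U) :=
  ⟨U, ⟨⟨Equiv.refl _, Equiv.refl _, fun _ _ _ => Iff.rfl, fun _ => Iff.rfl⟩⟩⟩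

/-- The graph obtained by deleting a vertex `v` all of whose edges are `a` (with other end `x`) and
`b` (with other end `y`), and letting `a` join `x` and `y`, with the sign of `b`. -/
def suppress (G : SignedGraph α β) (v x y : α) (a b : β) (hab : a ≠ b) (hx : x ≠ v) (hy : y ≠ v)
    (ha : G.IsLink a v x) (hb : G.IsLink b v y) (hv : ∀ e, G.Inc e v → e = a ∨ e = b) :
    SignedGraph α β where
  vertexSet := G.vertexSet \ {v}
  IsLink e z w := (G.IsLink e z w ∧ e ≠ a ∧ e ≠ b) ∨ (e = a ∧ s(z, w) = s(x, y))
  isLink_symm := by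
    refine fun e _ => ⟨?_⟩
    rintro z w (h | h)
    · exact Or.inl ⟨h.1.symm, h.2⟩
    · exact Or.inr ⟨h.1, Sym2.eq_swap.trans h.2⟩
  eq_or_eq_of_isLink_of_isLink := by
    rintro e z w z' w' (h | h) (h' | h')
    · exact h.1.left_eq_or_eq h'.1
    · exact absurd h'.1 h.2.1
    · exact absurd h.1 h'.2.1
    · have := h.2.trans h'.2.symm
      rw [Sym2.eq_iff] at this
      tauto
  edgeSet := G.edgeSet \ {b}
  edge_mem_iff_exists_isLink := by
    intro e
    constructor
    · rintro ⟨he, heb⟩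
      by_cases hea : e = a
      · exact ⟨x, y, Or.inr ⟨hea, rfl⟩⟩
      · obtain ⟨z, w, h⟩ := G.exists_isLink_of_mem_edgeSet he
        exact ⟨z, w, Or.inl ⟨h, hea, heb⟩⟩
    · rintro ⟨z, w, h | h⟩
      · exact ⟨h.1.edge_mem, h.2.2⟩
      · rw [h.1]; exact ⟨ha.edge_mem, hab⟩
  left_mem_of_isLink := by
    rintro e z w (h | h)
    · exact ⟨h.1.left_mem, fun hz => by
        have := hv e ⟨w, (Set.mem_singleton_iff.1 hz) ▸ h.1⟩
        tauto⟩
    · rcases Sym2.eq_iff.1 h.2 with ⟨rfl, -⟩ | ⟨rfl, -⟩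
      · exact ⟨ha.right_mem, hx⟩
      · exact ⟨hb.right_mem, hy⟩
  neg := {e | (e ∈ G.neg ∧ e ≠ a ∧ e ≠ b) ∨ (e = a ∧ b ∈ G.neg)}
  neg_subset := by
    rintro e (h | h)
    · exact ⟨G.neg_subset h.1, h.2.2⟩
    · rw [h.1]; exact ⟨ha.edge_mem, hab⟩
  finite_vertexSet := G.finite_vertexSet.subset Set.sdiff_subset
  finite_edgeSet := G.finite_edgeSet.subset Set.sdiff_subset

lemma isMultiedgeSubdivision_suppress {G : SignedGraph α β} {v x y : α} {a b : β} (hab : a ≠ b)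
    (hx : x ≠ v) (hy : y ≠ v) (ha : G.IsLink a v x) (hb : G.IsLink b v y)
    (hv : ∀ e, G.Inc e v → e = a ∨ e = b) (hneg : a ∉ G.neg) :
    IsMultiedgeSubdivision (G.suppress v x y a b hab hx hy ha hb hv) G := by
  refine ⟨x, y, v, {a}, {a}, {b}, ?_, Set.singleton_nonempty a, ?_, ?_, Set.finite_singleton a,
    Set.finite_singleton b, rfl, by simp, by simpa using hab, ?_, ?_, ?_, ?_⟩
  · rintro _ rfl
    exact ⟨ha.edge_mem, hab⟩
  · rintro _ rfl
    exact Or.inr ⟨rfl, rfl⟩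
  · exact fun h => h.2 rfl
  · rw [Set.disjoint_left]
    rintro e (h | h) ⟨⟨-, h2⟩, h3⟩
    · exact h3 h
    · exact h2 h
  · change G.vertexSet = insert v (G.vertexSet \ {v})
    rw [Set.insert_sdiff_singleton, Set.insert_eq_of_mem ha.left_mem]
  · intro e z w
    have e1 : (G.suppress v x y a b hab hx hy ha hb hv).IsLink e z w ∧ e ∉ ({a} : Set β) ↔
        G.IsLink e z w ∧ e ≠ a ∧ e ≠ b := by
      change ((G.IsLink e z w ∧ e ≠ a ∧ e ≠ b) ∨ (e = a ∧ s(z, w) = s(x, y))) ∧ e ≠ a ↔ _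
      tauto
    rw [e1]
    simp only [Set.mem_singleton_iff]
    by_cases h1 : e = a
    · subst h1
      rw [ha.isLink_iff_sym2_eq]
      simp only [ne_eq, not_true, false_and, and_false, true_and, false_or, hab, or_false]
      exact eq_comm
    · by_cases h2 : e = b
      · subst h2
        rw [hb.isLink_iff_sym2_eq]
        simp only [ne_eq, not_true, and_false, true_and, false_or, h1, false_and]
        exact eq_comm
      · simp [h1, h2]
  · by_cases hbn : b ∈ G.neg
    · left
      constructor
      · rintro _ rfl
        exact Or.inr ⟨rfl, hbn⟩
      · ext e
        change _ ↔ (((e ∈ G.neg ∧ e ≠ a ∧ e ≠ b) ∨ (e = a ∧ b ∈ G.neg)) ∧ e ≠ a) ∨ e = b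
        by_cases h1 : e = a
        · subst h1; simp [hneg, hab]
        · by_cases h2 : e = b
          · subst h2; simp [hbn]
          · simp [h1, h2]
    · right
      constructor
      · rw [Set.disjoint_singleton_left]
        rintro (h | h)
        · exact h.2.1 rfl
        · exact hbn h.2
      · ext e
        change _ ↔ ((e ∈ G.neg ∧ e ≠ a ∧ e ≠ b) ∨ (e = a ∧ b ∈ G.neg))
        by_cases h1 : e = a
        · subst h1; simp [hneg, hbn]
        · by_cases h2 : e = b
          · subst h2; simp [hbn, h1]
          · simp [h1, h2]

/-- The step relation that generates subdivisions. -/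
abbrev SubdivisionStep (K K' : SignedGraph α β) : Prop :=
  IsMultiedgeSubdivision K K' ∨ SwitchIso K K'

lemma noIsolatedVertex_suppress {G : SignedGraph α β} {v x y : α} {a b : β} (hab : a ≠ b)
    (hx : x ≠ v) (hy : y ≠ v) (ha : G.IsLink a v x) (hb : G.IsLink b v y)
    (hv : ∀ e, G.Inc e v → e = a ∨ e = b) (hG : G.NoIsolatedVertex) :
    (G.suppress v x y a b hab hx hy ha hb hv).NoIsolatedVertex := by
  rintro z ⟨hz, hzv⟩
  obtain ⟨e, w, hew⟩ := hG z hz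
  by_cases h1 : e = a
  · subst h1
    have : z = x := (hew.left_eq_or_eq ha).resolve_left hzv
    exact ⟨e, y, Or.inr ⟨rfl, by rw [this]⟩⟩
  · by_cases h2 : e = b
    · subst h2
      have : z = y := (hew.left_eq_or_eq hb).resolve_left hzv
      exact ⟨a, x, Or.inr ⟨rfl, by rw [this, Sym2.eq_swap]⟩⟩
    · exact ⟨e, w, Or.inl ⟨hew, h1, h2⟩⟩

/-- A vertex of degree two of a reduced critical signed graph can be suppressed. -/
lemma IsReducedCritical.exists_suppress {G : SignedGraph α β} {k : ℕ}
    (hG : G.IsReducedCritical k) {v : α} (hloop : ∀ e, ¬ G.IsLink e v v)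
    (hcut : (G.edgeCut {v}).ncard = 2) : ∃ K : SignedGraph α β, K.IsReducedCritical k ∧
      K.vertexSet.ncard < G.vertexSet.ncard ∧ Relation.ReflTransGen SubdivisionStep K G := by
  obtain ⟨a, b, hab, hc⟩ := Set.ncard_eq_two.1 hcut
  have hinc : ∀ e x, G.IsLink e v x → x ≠ v ∧ e ∈ G.edgeCut {v} := by
    intro e x hl
    have hx : x ≠ v := fun h => hloop e (h ▸ hl)
    exact ⟨hx, ⟨v, x, hl, rfl, hx⟩⟩
  obtain ⟨x, ha⟩ : ∃ x, G.IsLink a v x := by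
    obtain ⟨z, x, hl, rfl, -⟩ : a ∈ G.edgeCut {v} := by rw [hc]; simp
    exact ⟨x, hl⟩
  obtain ⟨y, hb⟩ : ∃ y, G.IsLink b v y := by
    obtain ⟨z, y, hl, rfl, -⟩ : b ∈ G.edgeCut {v} := by rw [hc]; simp
    exact ⟨y, hl⟩
  have hv : ∀ e, G.Inc e v → e = a ∨ e = b := by
    rintro e ⟨z, hl⟩
    have := (hinc e z hl).2
    rwa [hc] at this
  have hx := (hinc a x ha).1
  have hy := (hinc b y hb).1
  obtain ⟨W, hW⟩ : ∃ W, a ∉ G.sig W := by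
    by_cases han : a ∈ G.neg
    · refine ⟨{v}, ?_⟩
      rw [mem_sig ha]
      simp [han, hx]
    · exact ⟨∅, by rwa [sig_empty]⟩
  have hsw := SwitchIso.switch_self G W
  have hG' : (G.switch W).IsReducedCritical k := (SwitchIso.to_switch G W).isReducedCritical hG
  have hsub := isMultiedgeSubdivision_suppress (G := G.switch W) hab hx hy ha hb hv hW
  obtain ⟨F, A, B, hd⟩ := hsub.exists_edgeDoubling
  refine ⟨_, ⟨hd.isCritical_of hG'.1, hd.not_splits_of hG'.2.1,
    noIsolatedVertex_suppress _ _ _ _ _ _ hG'.2.2⟩, ?_,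
    .tail (.single (Or.inl hsub)) (Or.inr hsw)⟩
  exact Set.ncard_lt_ncard
    ⟨Set.sdiff_subset, fun h => (h ha.left_mem).2 rfl⟩ G.finite_vertexSet

section

variable {G : SignedGraph α β} {k : ℕ}

/-! ### Small cuts in critical signed graphs -/

lemma ncard_symmDiff {S T : Set β} (hS : S.Finite) (hT : T.Finite) :
    (((symmDiff S T).ncard : ℕ) : ZMod 2) = (S.ncard : ZMod 2) + (T.ncard : ZMod 2) := by
  have h1 := Set.ncard_inter_add_ncard_sdiff_eq_ncard S T hS
  have h2 := Set.ncard_inter_add_ncard_sdiff_eq_ncard T S hT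
  have h3 : (symmDiff S T).ncard = (S \ T).ncard + (T \ S).ncard :=
    Set.ncard_union_eq disjoint_sdiff_sdiff (hS.subset Set.sdiff_subset)
      (hT.subset Set.sdiff_subset)
  rw [h3, ← h1, ← h2, Set.inter_comm T S]
  push_cast
  have := CharTwo.add_self_eq_zero ((S ∩ T).ncard : ZMod 2)
  linear_combination -this

lemma IsCritical.ncard_edgeCut_ne_one (h : G.IsCritical k) (U : Set α) :
    (G.edgeCut U).ncard ≠ 1 := by
  intro hU
  obtain ⟨e, he⟩ := Set.ncard_eq_one.1 hU
  obtain ⟨W, heW, hW⟩ := h.exists_mem_sig (G.edgeCut_subset U (he ▸ rfl : e ∈ G.edgeCut U))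
  have h1 : G.sig (symmDiff W U) = G.sig W \ {e} := by
    rw [sig_symmDiff, he]
    ext f
    simp only [Set.mem_symmDiff, Set.mem_singleton_iff, Set.mem_sdiff]
    constructor
    · rintro (h | ⟨rfl, h⟩)
      · exact h
      · exact absurd heW h
    · exact Or.inl
  have h2 := h.le_ncard (symmDiff W U)
  rw [h1, Set.ncard_sdiff_singleton_of_mem heW] at h2
  have := h.1
  omega

lemma mem_sig_of_isLink_self {e : β} {x : α} (h : G.IsLink e x x) (U : Set α) :
    e ∈ G.sig U ↔ e ∈ G.neg := by
  rw [mem_sig h]; simp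

lemma IsCritical.loop_mem_sig (h : G.IsCritical k) {e : β} {x : α} (he : G.IsLink e x x)
    (U : Set α) : e ∈ G.sig U := by
  obtain ⟨W, hW, -⟩ := h.exists_mem_sig he.edge_mem
  rwa [mem_sig_of_isLink_self he, ← mem_sig_of_isLink_self he W]

lemma IsReducedCritical.not_isLink_self (h : G.IsReducedCritical 2) (e : β) (x : α) :
    ¬ G.IsLink e x x := by
  intro he
  refine h.2.1 ⟨{e}, fun U => ⟨⟨e, h.1.loop_mem_sig he U, rfl⟩, ?_⟩⟩
  obtain ⟨f, hf, hfe⟩ := Set.exists_ne_of_one_lt_ncard (h.1.le_ncard U) e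
  exact ⟨f, hf, hfe⟩

/-- The edges with both ends in `X`. -/
def inner (G : SignedGraph α β) (X : Set α) : Set β := {e | ∃ x ∈ X, ∃ y ∈ X, G.IsLink e x y}

lemma disjoint_inner_edgeCut (X : Set α) : Disjoint (G.inner X) (G.edgeCut X) := by
  rw [Set.disjoint_left]
  rintro e ⟨x, hx, y, hy, hl⟩ he
  rw [mem_edgeCut hl] at he
  tauto

lemma edgeCut_inter_subset (X Z : Set α) :
    G.edgeCut (X ∩ Z) ⊆ (G.edgeCut Z ∩ G.inner X) ∪ G.edgeCut X := by
  rintro e ⟨x, y, hl, ⟨hx, hxZ⟩, hy⟩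
  by_cases hyX : y ∈ X
  · exact Or.inl ⟨⟨x, y, hl, hxZ, fun h => hy ⟨hyX, h⟩⟩, ⟨x, hx, y, hyX, hl⟩⟩
  · exact Or.inr ⟨x, y, hl, hx, hyX⟩

lemma subset_edgeCut_inter (X Z : Set α) :
    G.edgeCut Z ∩ G.inner X ⊆ G.edgeCut (X ∩ Z) := by
  rintro e ⟨he, x, hx, y, hy, hl⟩
  rw [mem_edgeCut hl] at he ⊢
  simpa [hx, hy] using he

lemma edgeCut_compl (U : Set α) : G.edgeCut Uᶜ = G.edgeCut U := by
  ext e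
  constructor <;> rintro ⟨x, y, hl, hx, hy⟩
  · exact ⟨y, x, hl.symm, by simpa using hy, hx⟩
  · exact ⟨y, x, hl.symm, hy, by simpa using hx⟩

/-- If every edge inside `X` is alone in some cut of the subgraph induced by `X`, and `X` is bounded
by two edges, then there is a vertex of degree two. -/
lemma IsCritical.exists_ncard_edgeCut_singleton (h : G.IsCritical k)
    (hloop : ∀ e x, ¬ G.IsLink e x x) {X₀ : Set α} (hX₀ : (G.edgeCut X₀).ncard = 2)
    (hin : ∀ f ∈ G.inner X₀, ∃ Z, G.edgeCut Z ∩ G.inner X₀ = {f}) :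
    ∃ v, (G.edgeCut {v}).ncard = 2 := by
  have hmono : ∀ {X : Set α}, X ⊆ X₀ → G.inner X ⊆ G.inner X₀ := by
    rintro X hX e ⟨x, hx, y, hy, hl⟩
    exact ⟨x, hX hx, y, hX hy, hl⟩
  have hV : G.edgeCut (X₀ ∩ G.vertexSet) = G.edgeCut X₀ := by
    ext e
    constructor
    · rintro ⟨x, y, hl, hx, hy⟩
      exact ⟨x, y, hl, hx.1, fun h => hy ⟨h, hl.right_mem⟩⟩
    · rintro ⟨x, y, hl, hx, hy⟩
      exact ⟨x, y, hl, ⟨hx, hl.left_mem⟩, fun h => hy h.1⟩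
  have hfin : {X | X ⊆ X₀ ∩ G.vertexSet ∧ (G.edgeCut X).ncard = 2}.Finite :=
    (G.finite_vertexSet.inter_of_right X₀).finite_subsets.subset fun X hX => hX.1
  obtain ⟨X, hX⟩ := hfin.exists_minimal ⟨_, subset_rfl, by rw [hV, hX₀]⟩
  have hXX₀ : X ⊆ X₀ := hX.1.1.trans Set.inter_subset_left
  have hmin : ∀ Y ⊆ X, Y ≠ X → (G.edgeCut Y).ncard ≠ 2 := fun Y hY hne hc =>
    hne (hY.antisymm (hX.2 ⟨hY.trans hX.1.1, hc⟩ hY))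
  have hinner : G.inner X = ∅ := by
    rw [Set.eq_empty_iff_forall_notMem]
    intro f hf
    obtain ⟨Z, hZ⟩ := hin f (hmono hXX₀ hf)
    have hZX : G.edgeCut Z ∩ G.inner X ⊆ {f} :=
      hZ ▸ Set.inter_subset_inter_right _ (hmono hXX₀)
    have hfZ : f ∈ G.edgeCut Z := (hZ.ge rfl).1
    have key : ∀ Z', G.edgeCut Z' = G.edgeCut Z → X ∩ Z' ≠ X →
        f ∈ G.edgeCut (X ∩ Z') ∧ G.edgeCut X ⊆ G.edgeCut (X ∩ Z') := by
      intro Z' hZ' hne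
      have h1 : f ∈ G.edgeCut (X ∩ Z') := subset_edgeCut_inter X Z' ⟨hZ' ▸ hfZ, hf⟩
      refine ⟨h1, ?_⟩
      have h2 : G.edgeCut (X ∩ Z') ⊆ insert f (G.edgeCut X) := by
        refine (edgeCut_inter_subset X Z').trans ?_
        rintro e (he | he)
        · exact Or.inl (hZX (hZ' ▸ he))
        · exact Or.inr he
      have hfX : f ∉ G.edgeCut X := Set.disjoint_left.1 (disjoint_inner_edgeCut X) hf
      have h3 : (insert f (G.edgeCut X)).ncard = 3 := by
        rw [Set.ncard_insert_of_notMem hfX (G.finite_edgeCut X), hX.1.2]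
      have h4 : (G.edgeCut (X ∩ Z')).ncard ≠ 0 := by
        rw [Ne, Set.ncard_eq_zero (G.finite_edgeCut _)]
        exact (Set.nonempty_of_mem h1).ne_empty
      have h5 := hmin _ Set.inter_subset_left hne
      have h6 := h.ncard_edgeCut_ne_one (X ∩ Z')
      have h7 := Set.eq_of_subset_of_ncard_le h2 (by omega)
        ((G.finite_edgeCut X).insert f)
      rw [h7]
      exact Set.subset_insert _ _
    obtain ⟨x, hx, y, hy, hl⟩ := id hf
    have hfZ' := (mem_edgeCut hl Z).1 hfZ
    have n1 : X ∩ Z ≠ X := by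
      intro h; rw [Set.inter_eq_left] at h
      exact hfZ' (iff_of_true (h hx) (h hy))
    have n2 : X ∩ Zᶜ ≠ X := by
      intro h; rw [Set.inter_eq_left] at h
      exact hfZ' (iff_of_false (h hx) (h hy))
    have k1 := (key Z rfl n1).2
    have k2 := (key Zᶜ (edgeCut_compl Z) n2).2
    obtain ⟨e, he⟩ : (G.edgeCut X).Nonempty := by
      rw [← Set.ncard_pos (G.finite_edgeCut X), hX.1.2]; norm_num
    have hsd : symmDiff (X ∩ Z) (X ∩ Zᶜ) = X := by
      ext z; simp only [Set.mem_symmDiff, Set.mem_inter_iff, Set.mem_compl_iff]; tauto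
    have : e ∈ G.edgeCut (symmDiff (X ∩ Z) (X ∩ Zᶜ)) := hsd.symm ▸ he
    rw [edgeCut_symmDiff, Set.mem_symmDiff] at this
    have := k1 he
    have := k2 he
    tauto
  obtain ⟨e, v, y, hl, hv, hy⟩ : (G.edgeCut X).Nonempty := by
    rw [← Set.ncard_pos (G.finite_edgeCut X), hX.1.2]; norm_num
  refine ⟨v, ?_⟩
  have hsub : G.edgeCut {v} ⊆ G.edgeCut X := by
    rintro f ⟨_, z, hl', rfl, hz⟩
    refine ⟨_, z, hl', hv, fun hzX => ?_⟩
    exact (Set.eq_empty_iff_forall_notMem.1 hinner) f ⟨_, hv, z, hzX, hl'⟩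
  have h1 := Set.ncard_le_ncard hsub (G.finite_edgeCut X)
  have h2 : 0 < (G.edgeCut {v}).ncard := by
    rw [Set.ncard_pos (G.finite_edgeCut _)]
    exact ⟨e, v, y, hl, rfl, fun h => hloop e v (by rw [Set.mem_singleton_iff] at h; rwa [h] at hl)⟩
  have h3 := h.ncard_edgeCut_ne_one {v}
  rw [hX.1.2] at h1
  omega

/-! ### Reduced critical signed graphs of frustration index one -/

lemma IsCritical.exists_sig_eq_singleton (h : G.IsCritical 1) {e : β} (he : e ∈ G.edgeSet) :
    ∃ U, G.sig U = {e} := by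
  obtain ⟨U, heU, hU⟩ := h.exists_mem_sig he
  obtain ⟨f, hf⟩ := Set.ncard_eq_one.1 hU
  rw [hf] at heU
  exact ⟨U, by rw [hf, Set.mem_singleton_iff.1 heU]⟩

lemma IsCritical.edgeSet_nonempty (h : G.IsCritical k) : G.edgeSet.Nonempty := by
  obtain ⟨e, he⟩ : (G.sig ∅).Nonempty := by
    rw [← Set.ncard_pos (G.finite_sig _)]
    exact h.1.trans (h.le_ncard ∅)
  exact ⟨e, G.sig_subset _ he⟩

lemma IsCritical.exists_degree_two_of_loopless (h : G.IsCritical 1)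
    (hloop : ∀ e x, ¬ G.IsLink e x x) : ∃ v, (G.edgeCut {v}).ncard = 2 := by
  obtain ⟨e, he⟩ := h.edgeSet_nonempty
  obtain ⟨U, hU⟩ := h.exists_sig_eq_singleton he
  obtain ⟨g, hg, hge⟩ : ∃ g ∈ G.edgeSet, g ≠ e := by
    by_contra! hcon
    obtain ⟨x, y, hl⟩ := G.exists_isLink_of_mem_edgeSet he
    refine h.ncard_edgeCut_ne_one {x} ?_
    rw [Set.ncard_eq_one]
    refine ⟨e, Set.Subset.antisymm (fun f hf => hcon f (G.edgeCut_subset _ hf)) ?_⟩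
    rintro _ rfl
    exact ⟨x, y, hl, rfl, fun h => hloop _ x (by rw [Set.mem_singleton_iff] at h; rwa [h] at hl)⟩
  obtain ⟨W, hW⟩ := h.exists_sig_eq_singleton hg
  have hcut : G.edgeCut (symmDiff U W) = {e, g} := by
    rw [← sig_symmDiff_sig, hU, hW]
    exact (Set.disjoint_singleton.2 hge.symm).symmDiff_eq_sup
  refine h.exists_ncard_edgeCut_singleton hloop (X₀ := symmDiff U W)
    (by rw [hcut, Set.ncard_pair hge.symm]) fun f hf => ?_
  obtain ⟨Y, hY⟩ := h.exists_sig_eq_singleton (e := f) (by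
    obtain ⟨x, -, y, -, hl⟩ := hf; exact hl.edge_mem)
  have hd := Set.disjoint_left.1 (G.disjoint_inner_edgeCut (symmDiff U W))
  have he' : e ∉ G.inner (symmDiff U W) := fun h1 => hd h1 (by rw [hcut]; simp)
  have hfe : f ≠ e := fun h1 => he' (h1 ▸ hf)
  refine ⟨symmDiff U Y, ?_⟩
  rw [← sig_symmDiff_sig, hU, hY, (Set.disjoint_singleton.2 hfe.symm).symmDiff_eq_sup]
  ext a
  simp only [Set.mem_inter_iff, Set.sup_eq_union, Set.mem_union, Set.mem_singleton_iff]
  constructor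
  · rintro ⟨rfl | rfl, h1⟩
    · exact absurd h1 he'
    · rfl
  · rintro rfl
    exact ⟨Or.inr rfl, hf⟩

/-! ### Reduced critical signed graphs of frustration index two -/

lemma IsReducedCritical.exists_degree_two_aux (h : G.IsReducedCritical 2) {X₀ : Set α}
    (hX₀ : (G.edgeCut X₀).ncard = 2) {U : Set α} (hU : Disjoint (G.sig U) (G.inner X₀)) :
    ∃ v, (G.edgeCut {v}).ncard = 2 := by
  refine h.1.exists_ncard_edgeCut_singleton h.not_isLink_self hX₀ fun f hf => ?_
  obtain ⟨W, hfW, hW⟩ := h.1.exists_mem_sig (e := f) (by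
    obtain ⟨x, -, y, -, hl⟩ := hf; exact hl.edge_mem)
  have hUX := Set.disjoint_right.1 hU
  have hcut : G.edgeCut (symmDiff U W) ∩ G.inner X₀ = G.sig W ∩ G.inner X₀ := by
    rw [← sig_symmDiff_sig]
    ext e
    have := @hUX e
    simp only [Set.mem_inter_iff, Set.mem_symmDiff]
    tauto
  by_cases hWX : G.sig W ⊆ G.inner X₀
  · exfalso
    rw [Set.inter_eq_left.2 hWX] at hcut
    set Y := X₀ ∩ symmDiff U W with hY
    have h1 : G.edgeCut Y ⊆ G.sig W ∪ G.edgeCut X₀ := by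
      rw [← hcut]; exact edgeCut_inter_subset _ _
    have h2 : G.sig W ⊆ G.edgeCut Y := by
      rw [← hcut]; exact subset_edgeCut_inter _ _
    have h3 : G.sig (symmDiff W Y) ⊆ G.edgeCut X₀ := by
      rw [sig_symmDiff]
      rintro e (⟨h4, h5⟩ | ⟨h4, h5⟩)
      · exact absurd (h2 h4) h5
      · exact (h1 h4).resolve_left h5
    have h4 := Set.eq_of_subset_of_ncard_le h3
      (by rw [hX₀]; exact h.1.le_ncard _) (G.finite_edgeCut X₀)
    have h5 : G.sig (symmDiff (symmDiff W Y) X₀) = ∅ := by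
      rw [sig_symmDiff, h4, symmDiff_self]; rfl
    have := h.1.le_ncard (symmDiff (symmDiff W Y) X₀)
    rw [h5] at this
    simp at this
  · refine ⟨symmDiff U W, hcut.trans ?_⟩
    obtain ⟨g, hg, hgX⟩ := Set.not_subset.1 hWX
    have hfg : f ≠ g := fun h1 => hgX (h1 ▸ hf)
    have : G.sig W = {f, g} := by
      refine (Set.eq_of_subset_of_ncard_le ?_ ?_ (G.finite_sig W)).symm
      · rintro e (rfl | rfl)
        exacts [hfW, hg]
      · rw [hW, Set.ncard_pair hfg]
    rw [this]
    ext e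
    simp only [Set.mem_inter_iff, Set.mem_insert_iff, Set.mem_singleton_iff]
    constructor
    · rintro ⟨rfl | rfl, h1⟩
      · rfl
      · exact absurd h1 hgX
    · rintro rfl
      exact ⟨Or.inl rfl, hf⟩

lemma IsReducedCritical.exists_degree_two (h : G.IsReducedCritical 2) {X : Set α}
    (hX : (G.edgeCut X).ncard = 2) : ∃ v, (G.edgeCut {v}).ncard = 2 := by
  by_cases hU : ∃ U, Disjoint (G.sig U) (G.inner X)
  · obtain ⟨U, hU⟩ := hU
    exact h.exists_degree_two_aux hX hU
  · push Not at hU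
    obtain ⟨U, hU'⟩ : ∃ U, G.sig U ⊆ G.inner X := by
      by_contra! hcon
      refine h.2.1 ⟨G.inner X, fun U => ⟨Set.not_disjoint_iff_nonempty_inter.1 (hU U), ?_⟩⟩
      exact Set.sdiff_nonempty.2 (hcon U)
    refine h.exists_degree_two_aux (X₀ := Xᶜ) (U := U) (by rwa [edgeCut_compl]) ?_
    rw [Set.disjoint_left]
    rintro e he ⟨x, hx, y, hy, hl⟩
    obtain ⟨a, ha, b, hb, hl'⟩ := hU' he
    rcases hl.left_eq_or_eq hl' with rfl | rfl
    · exact hx ha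
    · exact hx hb

end

section

variable {G : SignedGraph α β}

/-! ### Signatures of size two in the irreducible case -/

lemma disjoint_sig_of_ne (hne : ∀ X, (G.edgeCut X).ncard ≠ 2) {U W : Set α}
    (hU : (G.sig U).ncard = 2) (hW : (G.sig W).ncard = 2) {e : β} (he : e ∈ G.sig W)
    (heU : e ∉ G.sig U) : Disjoint (G.sig U) (G.sig W) := by
  rw [Set.disjoint_iff_inter_eq_empty, ← Set.ncard_eq_zero ((G.finite_sig U).inter_of_left _)]
  have h1 := Set.ncard_inter_add_ncard_sdiff_eq_ncard (G.sig U) (G.sig W) (G.finite_sig U)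
  have h2 := Set.ncard_inter_add_ncard_sdiff_eq_ncard (G.sig W) (G.sig U) (G.finite_sig W)
  have h3 : (symmDiff (G.sig U) (G.sig W)).ncard =
      (G.sig U \ G.sig W).ncard + (G.sig W \ G.sig U).ncard :=
    Set.ncard_union_eq disjoint_sdiff_sdiff ((G.finite_sig U).subset Set.sdiff_subset)
      ((G.finite_sig W).subset Set.sdiff_subset)
  rw [sig_symmDiff_sig] at h3
  have h4 := hne (symmDiff U W)
  rw [Set.inter_comm] at h2
  have h5 : 0 < (G.sig W \ G.sig U).ncard := by
    rw [Set.ncard_pos ((G.finite_sig W).subset Set.sdiff_subset)]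
    exact ⟨e, he, heU⟩
  omega

lemma edgeCut_inter_vertexSet (U : Set α) : G.edgeCut (U ∩ G.vertexSet) = G.edgeCut U := by
  ext e
  constructor
  · rintro ⟨x, y, hl, hx, hy⟩
    exact ⟨x, y, hl, hx.1, fun h => hy ⟨h, hl.right_mem⟩⟩
  · rintro ⟨x, y, hl, hx, hy⟩
    exact ⟨x, y, hl, ⟨hx, hl.left_mem⟩, fun h => hy h.1⟩

lemma even_ncard_edgeCut (h : ∀ x, ((G.edgeCut {x}).ncard : ZMod 2) = 0) (U : Set α) :
    ((G.edgeCut U).ncard : ZMod 2) = 0 := by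
  rw [← edgeCut_inter_vertexSet]
  have hfin : (U ∩ G.vertexSet).Finite := G.finite_vertexSet.inter_of_right U
  generalize U ∩ G.vertexSet = S at hfin
  induction S, hfin using Set.Finite.induction_on with
  | empty =>
    have : G.edgeCut ∅ = ∅ := by
      ext e; simp [edgeCut]
    simp [this]
  | @insert a s ha hs ih =>
    have : insert a s = symmDiff {a} s := by
      rw [(Set.disjoint_singleton_left.2 ha).symmDiff_eq_sup]; rfl
    rw [this, edgeCut_symmDiff, ncard_symmDiff (G.finite_edgeCut _) (G.finite_edgeCut _), ih, h,
      add_zero]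

lemma IsReducedCritical.exists_odd_edgeCut (h : G.IsReducedCritical 2) :
    ∃ w, Odd (G.edgeCut {w}).ncard := by
  by_contra! hcon
  have heven : ∀ x, ((G.edgeCut {x}).ncard : ZMod 2) = 0 := fun x => by
    rw [ZMod.natCast_eq_zero_iff_even, ← Nat.not_odd_iff_even]; exact hcon x
  obtain ⟨-, hle, ⟨U, hU⟩, -⟩ := (G.isCritical_iff 2).1 h.1
  have hsig : ∀ W, ((G.sig W).ncard : ZMod 2) = 0 := by
    intro W
    have h1 : G.sig W = symmDiff (G.sig U) (G.edgeCut (symmDiff U W)) := by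
      rw [← sig_symmDiff_sig, symmDiff_symmDiff_cancel_left]
    rw [h1, ncard_symmDiff (G.finite_sig U) (G.finite_edgeCut _), hU, even_ncard_edgeCut heven]
    rfl
  obtain ⟨C, hC⟩ := exists_isNegativeCircuit (G := G) fun W => by
    rw [← Set.ncard_pos (G.finite_sig W)]
    have := hle W
    omega
  obtain ⟨W, hW⟩ : ∃ W, G.sig W ⊆ C := by
    by_contra! hn
    exact h.2.1 ⟨C, fun W => ⟨by rw [Set.inter_comm]; exact hC.inter_sig_nonempty W,
      Set.sdiff_nonempty.2 (hn W)⟩⟩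
  have h1 := hC.odd_inter_sig W
  rw [Set.inter_eq_right.2 hW, odd_iff_cast, hsig W] at h1
  exact zero_ne_one h1

/-- In the irreducible case some vertex is incident with edges from three disjoint signatures of
size two. -/
lemma IsReducedCritical.exists_three_sigs (h : G.IsReducedCritical 2)
    (hne : ∀ X, (G.edgeCut X).ncard ≠ 2) : ∃ (w : α) (U : Fin 3 → Set α) (g : Fin 3 → β),
      (∀ i, (G.sig (U i)).ncard = 2) ∧ (∀ i, g i ∈ G.sig (U i)) ∧ (∀ i, g i ∈ G.edgeCut {w}) ∧
      ∀ i j, i ≠ j → Disjoint (G.sig (U i)) (G.sig (U j)) := by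
  obtain ⟨w, hw⟩ := h.exists_odd_edgeCut
  set D := G.edgeCut {w} with hD
  have hDfin : D.Finite := G.finite_edgeCut _
  have hD3 : 3 ≤ D.ncard := by
    have h1 : D.ncard ≠ 1 := h.1.ncard_edgeCut_ne_one {w}
    obtain ⟨m, hm⟩ := hw
    omega
  have hget : ∀ e ∈ D, ∃ U, e ∈ G.sig U ∧ (G.sig U).ncard = 2 := fun e he =>
    h.1.exists_mem_sig (G.edgeCut_subset _ he)
  obtain ⟨g1, hg1⟩ : D.Nonempty := by rw [← Set.ncard_pos hDfin]; omega
  obtain ⟨U1, hgU1, hU1⟩ := hget g1 hg1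
  obtain ⟨g2, hg2, hg21⟩ : ∃ g ∈ D, g ∉ G.sig U1 := by
    by_contra! hcon
    have := Set.ncard_le_ncard (s := D) hcon (G.finite_sig U1)
    omega
  obtain ⟨U2, hgU2, hU2⟩ := hget g2 hg2
  have d12 := disjoint_sig_of_ne hne hU1 hU2 hgU2 hg21
  obtain ⟨g3, hg3, hg3'⟩ : ∃ g ∈ D, g ∉ G.sig U1 ∪ G.sig U2 := by
    by_contra! hcon
    have hsub : D ⊆ G.sig U1 ∪ G.sig U2 := hcon
    have h4 : (G.sig U1 ∪ G.sig U2).ncard = 4 := by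
      rw [Set.ncard_union_eq d12 (G.finite_sig _) (G.finite_sig _), hU1, hU2]
    have h5 : G.edgeCut (symmDiff (symmDiff U1 U2) {w}) = (G.sig U1 ∪ G.sig U2) \ D := by
      rw [edgeCut_symmDiff, ← sig_symmDiff_sig, d12.symmDiff_eq_sup]
      exact symmDiff_of_ge hsub
    have h6 := h.1.ncard_edgeCut_ne_one (symmDiff (symmDiff U1 U2) {w})
    have h7 := Set.ncard_le_ncard hsub ((G.finite_sig U1).union (G.finite_sig U2))
    rw [h5, Set.ncard_sdiff hsub hDfin, h4] at h6
    obtain ⟨m, hm⟩ := hw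
    omega
  obtain ⟨U3, hgU3, hU3⟩ := hget g3 hg3
  have d13 := disjoint_sig_of_ne hne hU1 hU3 hgU3 fun h' => hg3' (Or.inl h')
  have d23 := disjoint_sig_of_ne hne hU2 hU3 hgU3 fun h' => hg3' (Or.inr h')
  refine ⟨w, ![U1, U2, U3], ![g1, g2, g3], ?_, ?_, ?_, ?_⟩
  · intro i; fin_cases i <;> assumption
  · intro i; fin_cases i <;> assumption
  · intro i; fin_cases i <;> assumption
  · intro i j hij
    fin_cases i <;> fin_cases j
    exacts [absurd rfl hij, d12, d13, d12.symm, absurd rfl hij, d23, d13.symm, d23.symm,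
      absurd rfl hij]

/-- The number of the given pairs `(a, b)` that are separated by `{p}`. -/
def sepCount {ι κ : Type*} [Fintype ι] [DecidableEq κ] (a b : ι → κ) (p : κ) : ℕ :=
  ∑ i, if (a i = p) = (b i = p) then 0 else 1

lemma ncard_edgeCut_preimage {ι κ : Type*} [Fintype ι] [DecidableEq κ] (ψ : α → κ) {ε : ι → β}
    (hε : Function.Injective ε) {a b : ι → α} (hl : ∀ i, G.IsLink (ε i) (a i) (b i))
    (hψ : ∀ e x y, G.IsLink e x y → ψ x ≠ ψ y → e ∈ Set.range ε) (p : κ) :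
    (G.edgeCut (ψ ⁻¹' {p})).ncard = sepCount (ψ ∘ a) (ψ ∘ b) p := by
  have h1 : G.edgeCut (ψ ⁻¹' {p}) = ε '' {i | ¬ (ψ (a i) = p ↔ ψ (b i) = p)} := by
    ext e
    constructor
    · rintro ⟨x, y, hxy, hx, hy⟩
      have hx' : ψ x = p := hx
      have hy' : ψ y ≠ p := hy
      obtain ⟨i, rfl⟩ := hψ e x y hxy (fun h => hy' (h ▸ hx'))
      refine ⟨i, ?_, rfl⟩
      rcases hxy.eq_and_eq_or_eq_and_eq (hl i) with ⟨rfl, rfl⟩ | ⟨rfl, rfl⟩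
      · exact fun h => hy' (h.1 hx')
      · exact fun h => hy' (h.2 hx')
    · rintro ⟨i, hi, rfl⟩
      rw [mem_edgeCut (hl i)]
      exact hi
  rw [h1, Set.ncard_image_of_injective _ hε, Set.ncard_eq_toFinset_card', Set.toFinset_ofPred,
    Finset.card_filter, sepCount]
  refine Finset.sum_congr rfl fun i _ => ?_
  by_cases h2 : ψ (a i) = p <;> by_cases h3 : ψ (b i) = p <;> simp [h2, h3]

end

section

variable {G : SignedGraph α β}

/-! ### The irreducible signed graph of frustration index two -/

set_option maxRecDepth 100000 in
lemma sepCount_eight : ∀ p₁ q₁ p₂ q₂ p₃ q₃ p₄ q₄ p₅ q₅ : Bool,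
    ∃ p : Bool × Bool × Bool,
      sepCount ![(false, false, false), (false, p₁, q₁), (false, false, false), (false, p₂, q₂),
          (false, false, false), (p₃, false, q₃), (p₄, q₄, false), (p₅, q₅, false)]
        ![(true, true, true), (true, !p₁, !q₁), (true, false, false), (true, p₂, q₂),
          (false, true, false), (p₃, true, q₃), (p₄, q₄, true), (p₅, q₅, true)] p ∈ [1, 2] := by
  decide +kernel

lemma sepCount_six : ∀ p₁ p₂ p₃ : Bool,
    (∀ p : Bool × Bool, sepCount ![(false, false), (false, p₁), (false, false), (false, p₂),
          (false, false), (p₃, false)]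
        ![(true, true), (true, !p₁), (true, false), (true, p₂),
          (false, true), (p₃, true)] p ∉ [1, 2]) → p₁ = true ∧ p₂ = true ∧ p₃ = true := by
  decide

lemma exists_sig_eq_pair {U : Set α} (hU : (G.sig U).ncard = 2) {g : β} (hg : g ∈ G.sig U) :
    ∃ g', g ≠ g' ∧ G.sig U = {g, g'} := by
  obtain ⟨a, b, hab, hc⟩ := Set.ncard_eq_two.1 hU
  rw [hc] at hg ⊢
  rcases hg with rfl | rfl
  · exact ⟨b, hab, rfl⟩
  · exact ⟨a, hab.symm, Set.pair_comm _ _⟩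

open Classical in
/-- Whether `v` and `w` are separated by the difference of `U` and `W`. -/
noncomputable def side (U W : Set α) (w v : α) : Bool :=
  decide (¬ (v ∈ symmDiff U W ↔ w ∈ symmDiff U W))

lemma side_self (U W : Set α) (w : α) : side U W w w = false := by simp [side]

lemma side_ne_iff {U W : Set α} {w x y : α} {e : β} (hl : G.IsLink e x y) :
    side U W w x ≠ side U W w y ↔ ¬ (e ∈ G.sig U ↔ e ∈ G.sig W) := by
  have h1 : e ∈ G.edgeCut (symmDiff U W) ↔ ¬ (e ∈ G.sig U ↔ e ∈ G.sig W) := by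
    rw [← sig_symmDiff_sig, Set.mem_symmDiff]; tauto
  rw [← h1, mem_edgeCut hl, side, side, Ne, decide_eq_decide]
  tauto

lemma side_eq_not {U W : Set α} {w x y : α} {e : β} (hl : G.IsLink e x y)
    (h : ¬ (e ∈ G.sig U ↔ e ∈ G.sig W)) : side U W w y = !side U W w x := by
  have := (side_ne_iff (w := w) hl).2 h
  revert this
  cases side U W w x <;> cases side U W w y <;> simp

lemma side_eq {U W : Set α} {w x y : α} {e : β} (hl : G.IsLink e x y)
    (h : e ∈ G.sig U ↔ e ∈ G.sig W) : side U W w y = side U W w x := by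
  by_contra hn
  exact (side_ne_iff (w := w) hl).1 (Ne.symm hn) h

lemma exists_isLink_side_eq_false {U W : Set α} (w : α) {e : β} (he : e ∈ G.edgeSet)
    (h : ¬ (e ∈ G.sig U ↔ e ∈ G.sig W)) :
    ∃ x y, G.IsLink e x y ∧ side U W w x = false ∧ side U W w y = true := by
  obtain ⟨x, y, hl⟩ := G.exists_isLink_of_mem_edgeSet he
  have h1 := side_eq_not (w := w) hl h
  rcases hx : side U W w x with _ | _
  · exact ⟨x, y, hl, hx, by rw [h1, hx]; rfl⟩
  · exact ⟨y, x, hl.symm, by rw [h1, hx]; rfl, hx⟩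

section atoms

variable {n : ℕ} {U : Fin n → Set α}
  (hd : ∀ i j, i ≠ j → Disjoint (G.sig (U i)) (G.sig (U j)))
include hd

lemma mem_sig_iff_eq_of_disjoint {i : Fin n} {e : β} (he : e ∈ G.sig (U i)) (j : Fin n) :
    e ∈ G.sig (U j) ↔ i = j := by
  refine ⟨fun h => ?_, fun h => h ▸ he⟩
  by_contra hij
  exact Set.disjoint_left.1 (hd i j hij) he h

lemma injective_of_mem_sig {ι : Type*} {ε : ι → β} {q : ι → Fin n}
    (hq : ∀ i, ε i ∈ G.sig (U (q i))) (hne : ∀ i j, q i = q j → ε i = ε j → i = j) :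
    Function.Injective ε := by
  intro i j hij
  refine hne i j ?_ hij
  have h1 := hq j
  rw [← hij, mem_sig_iff_eq_of_disjoint hd (hq i)] at h1
  exact h1

end atoms

lemma no_four_sigs (h1 : ∀ X, (G.edgeCut X).ncard ≠ 1) (h2 : ∀ X, (G.edgeCut X).ncard ≠ 2)
    {w : α} {U : Fin 4 → Set α} (hU : ∀ i, (G.sig (U i)).ncard = 2)
    (hd : ∀ i j, i ≠ j → Disjoint (G.sig (U i)) (G.sig (U j))) {g : Fin 3 → β}
    (hg : ∀ i, g i ∈ G.sig (U i.castSucc)) (hw : ∀ i, g i ∈ G.edgeCut {w}) : False := by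
  have hpair : ∀ i, ∃ a b, a ≠ b ∧ G.sig (U i) = {a, b} := fun i => by
    obtain ⟨a, b, hab, hc⟩ := Set.ncard_eq_two.1 (hU i)
    exact ⟨a, b, hab, hc⟩
  obtain ⟨g0', n0, e0⟩ := exists_sig_eq_pair (hU 0) (hg 0)
  obtain ⟨g1', n1, e1⟩ := exists_sig_eq_pair (hU 1) (hg 1)
  obtain ⟨g2', n2, e2⟩ := exists_sig_eq_pair (hU 2) (hg 2)
  obtain ⟨g3, g3', n3, e3⟩ := hpair 3
  have m0 : g0' ∈ G.sig (U 0) := by rw [e0]; simp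
  have m1 : g1' ∈ G.sig (U 1) := by rw [e1]; simp
  have m2 : g2' ∈ G.sig (U 2) := by rw [e2]; simp
  have m3 : g3 ∈ G.sig (U 3) := by rw [e3]; simp
  have m3' : g3' ∈ G.sig (U 3) := by rw [e3]; simp
  have k0 : g 0 ∈ G.sig (U 0) := hg 0
  have k1 : g 1 ∈ G.sig (U 1) := hg 1
  have k2 : g 2 ∈ G.sig (U 2) := hg 2
  have hw' : ∀ i, ∃ y, G.IsLink (g i) w y := fun i => by
    obtain ⟨x, y, hl, rfl, -⟩ := hw i
    exact ⟨y, hl⟩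
  choose y hy using hw'
  have mm := fun (i : Fin 4) (e : β) (he : e ∈ G.sig (U i)) => mem_sig_iff_eq_of_disjoint hd he
  obtain ⟨x0, y0, l0, s0, t0⟩ := exists_isLink_side_eq_false (U := U 0) (W := U 1) w
    (G.sig_subset _ m0) (by rw [mm 0 _ m0, mm 0 _ m0]; decide)
  obtain ⟨x1, y1, l1, s1, t1⟩ := exists_isLink_side_eq_false (U := U 0) (W := U 1) w
    (G.sig_subset _ m1) (by rw [mm 1 _ m1, mm 1 _ m1]; decide)
  obtain ⟨x2, y2, l2, s2, t2⟩ := exists_isLink_side_eq_false (U := U 0) (W := U 2) w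
    (G.sig_subset _ m2) (by rw [mm 2 _ m2, mm 2 _ m2]; decide)
  obtain ⟨x3, y3, l3, s3, t3⟩ := exists_isLink_side_eq_false (U := U 0) (W := U 3) w
    (G.sig_subset _ m3) (by rw [mm 3 _ m3, mm 3 _ m3]; decide)
  obtain ⟨x3', y3', l3', s3', t3'⟩ := exists_isLink_side_eq_false (U := U 0) (W := U 3) w
    (G.sig_subset _ m3') (by rw [mm 3 _ m3', mm 3 _ m3']; decide)
  have flip : ∀ (i j : Fin 4) (e : β) (x y : α), e ∈ G.sig (U i) → G.IsLink e x y →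
      side (U 0) (U j) w y = if (i = 0) = (i = j) then side (U 0) (U j) w x
        else !side (U 0) (U j) w x := by
    intro i j e x y he hl
    split_ifs with hij
    · exact side_eq hl (by rw [mm i e he, mm i e he, hij])
    · exact side_eq_not hl (by rw [mm i e he, mm i e he]; exact fun h => hij (propext h))
  set ψ : α → Bool × Bool × Bool := fun v =>
    (side (U 0) (U 1) w v, side (U 0) (U 2) w v, side (U 0) (U 3) w v) with hψ
  set ε : Fin 8 → β := ![g 0, g0', g 1, g1', g 2, g2', g3, g3'] with hε
  have hψw : ψ w = (false, false, false) := by simp [hψ, side_self]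
  have hinj : Function.Injective ε := by
    refine injective_of_mem_sig (q := ![0, 0, 1, 1, 2, 2, 3, 3]) hd ?_ ?_
    · intro i; fin_cases i <;> assumption
    · intro i j
      fin_cases i <;> fin_cases j <;> simp [hε, n0, n1, n2, n3, n0.symm, n1.symm, n2.symm, n3.symm]
  have hrange : ∀ e x y, G.IsLink e x y → ψ x ≠ ψ y → e ∈ Set.range ε := by
    intro e x y hl hne
    by_contra hn
    have hn0 : ∀ i, e ∉ G.sig (U i) := by
      have hr : ∀ i, e ≠ ε i := fun i h => hn ⟨i, h.symm⟩
      intro i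
      fin_cases i
      · change e ∉ G.sig (U 0)
        rw [e0]; rintro (h | h); exacts [hr 0 h, hr 1 h]
      · change e ∉ G.sig (U 1)
        rw [e1]; rintro (h | h); exacts [hr 2 h, hr 3 h]
      · change e ∉ G.sig (U 2)
        rw [e2]; rintro (h | h); exacts [hr 4 h, hr 5 h]
      · change e ∉ G.sig (U 3)
        rw [e3]; rintro (h | h); exacts [hr 6 h, hr 7 h]
    have := fun j => side_eq (w := w) hl (iff_of_false (hn0 0) (hn0 j))
    exact hne (by simp [hψ, this])
  have hcut := ncard_edgeCut_preimage ψ hinj (a := ![w, x0, w, x1, w, x2, x3, x3'])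
    (b := ![y 0, y0, y 1, y1, y 2, y2, y3, y3']) (by intro i; fin_cases i <;> simp_all) hrange
  have ha : ψ ∘ ![w, x0, w, x1, w, x2, x3, x3'] =
      ![(false, false, false), (false, (ψ x0).2.1, (ψ x0).2.2), (false, false, false),
        (false, (ψ x1).2.1, (ψ x1).2.2), (false, false, false), ((ψ x2).1, false, (ψ x2).2.2),
        ((ψ x3).1, (ψ x3).2.1, false), ((ψ x3').1, (ψ x3').2.1, false)] := by
    funext i; fin_cases i <;> simp [hψw] <;> simp [hψ, s0, s1, s2, s3, s3']
  have hb : ψ ∘ ![y 0, y0, y 1, y1, y 2, y2, y3, y3'] =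
      ![(true, true, true), (true, !(ψ x0).2.1, !(ψ x0).2.2), (true, false, false),
        (true, (ψ x1).2.1, (ψ x1).2.2), (false, true, false), ((ψ x2).1, true, (ψ x2).2.2),
        ((ψ x3).1, (ψ x3).2.1, true), ((ψ x3').1, (ψ x3').2.1, true)] := by
    funext i
    fin_cases i
    · simp [hψ, flip 0 _ _ _ _ k0 (hy 0), side_self]
    · simp [hψ, flip 0 _ _ _ _ m0 l0, s0]
    · simp [hψ, flip 1 _ _ _ _ k1 (hy 1), side_self]
    · simp [hψ, flip 1 _ _ _ _ m1 l1, s1]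
    · simp [hψ, flip 2 _ _ _ _ k2 (hy 2), side_self]
    · simp [hψ, flip 2 _ _ _ _ m2 l2, s2]
    · simp [hψ, flip 3 _ _ _ _ m3 l3, s3]
    · simp [hψ, flip 3 _ _ _ _ m3' l3', s3']
  obtain ⟨p, hp⟩ := sepCount_eight (ψ x0).2.1 (ψ x0).2.2 (ψ x1).2.1 (ψ x1).2.2 (ψ x2).1
    (ψ x2).2.2 (ψ x3).1 (ψ x3).2.1 (ψ x3').1 (ψ x3').2.1
  rw [← ha, ← hb, ← hcut p] at hp
  simp only [List.mem_cons, List.not_mem_nil, or_false] at hp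
  exact hp.elim (h1 _) (h2 _)

end

section

variable {G : SignedGraph α β}

lemma presents_of_isLink {V E : Type*} {ι : V → α} {κ : E → β} {a b : E → V} {N : Set E}
    (hι : Function.Injective ι) (hκ : Function.Injective κ) (hE : Set.range κ = G.edgeSet)
    (hl : ∀ e, G.IsLink (κ e) (ι (a e)) (ι (b e))) (hN : ∀ e, κ e ∈ G.neg ↔ e ∈ N) :
    G.Presents κ (fun c : V → Bool => {e | e ∈ N ↔ c (a e) = c (b e)}) := by
  classical
  have key : ∀ U (c : V → Bool), (∀ v, ι v ∈ U ↔ c v = true) →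
      G.sig U = κ '' {e | e ∈ N ↔ c (a e) = c (b e)} := by
    intro U c hc
    have h1 : ∀ e, κ e ∈ G.sig U ↔ (e ∈ N ↔ c (a e) = c (b e)) := fun e => by
      rw [mem_sig (hl e), hN, hc, hc, ← Bool.eq_iff_iff]
    ext f
    constructor
    · intro hf
      obtain ⟨e, rfl⟩ : f ∈ Set.range κ := hE ▸ G.sig_subset U hf
      exact ⟨e, (h1 e).1 hf, rfl⟩
    · rintro ⟨e, he, rfl⟩
      exact (h1 e).2 he
  refine ⟨hκ, hE, fun U => ⟨fun v => decide (ι v ∈ U), key U (fun v => decide (ι v ∈ U)) fun v => by simp⟩,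
    fun c => ⟨ι '' {v | c v = true}, key _ _ fun v => ?_⟩⟩
  rw [hι.mem_set_image]; rfl

/-! ### The signed graph `-C₁` -/

lemma sig_negC1 (U : Set Unit) : negC1.sig U = {()} := by
  ext e
  have h : negC1.IsLink e () () := by simp [negC1, allNegative]
  rw [mem_sig h]
  simp [negC1, allNegative]

lemma isReducedCritical_negC1 : negC1.IsReducedCritical 1 := by
  refine ⟨(isCritical_iff _ _).2 ⟨le_rfl, fun U => by simp [sig_negC1], ⟨∅, by simp [sig_negC1]⟩,
    fun e _ => ⟨∅, by simp [sig_negC1]⟩⟩, ?_, fun x _ => ⟨(), (), by simp [negC1, allNegative]⟩⟩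
  rintro ⟨X, hX⟩
  obtain ⟨⟨e, -, he⟩, ⟨f, -, hf⟩⟩ := hX ∅
  exact hf he

lemma IsReducedCritical.switchIso_negC1 (h : G.IsReducedCritical 1) {e : β} {x : α}
    (he : G.IsLink e x x) : SwitchIso negC1 G := by
  have hE : G.edgeSet = {e} := by
    refine Set.Subset.antisymm (fun f hf => ?_) (by simpa using he.edge_mem)
    obtain ⟨U, hU⟩ := h.1.exists_sig_eq_singleton hf
    have := h.1.loop_mem_sig he U
    rw [hU] at this
    exact (Set.mem_singleton_iff.1 this).symm
  have hV : G.vertexSet = {x} := by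
    refine Set.Subset.antisymm (fun y hy => ?_) (by simpa using he.left_mem)
    obtain ⟨f, z, hl⟩ := h.2.2 y hy
    have hf : f = e := by have := hl.edge_mem; rwa [hE] at this
    rw [hf] at hl
    rcases hl.left_eq_or_eq he with h1 | h1 <;> exact h1
  have hneg : e ∈ G.neg := (mem_sig_of_isLink_self he ∅).1 (h.1.loop_mem_sig he ∅)
  have hV1 : (negC1.switch ∅).vertexSet = Set.univ := by ext; simp [negC1, allNegative, switch]
  have hE1 : (negC1.switch ∅).edgeSet = Set.univ := by ext; simp [negC1, allNegative, switch]
  refine ⟨∅, ⟨⟨(Equiv.setCongr hV1).trans ((Equiv.Set.univ _).trans ((Equiv.ofUnique _ _).trans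
    (Equiv.setCongr hV.symm))), (Equiv.setCongr hE1).trans ((Equiv.Set.univ _).trans
      ((Equiv.ofUnique _ _).trans (Equiv.setCongr hE.symm))), ?_, ?_⟩⟩⟩
  · intro f y z
    refine iff_of_true ?_ ?_
    · generalize Equiv.trans _ _ f = f'
      generalize Equiv.trans _ _ y = y'
      generalize Equiv.trans _ _ z = z'
      have h1 := hE.le f'.2
      have h2 := hV.le y'.2
      have h3 := hV.le z'.2
      rw [Set.mem_singleton_iff] at h1 h2 h3
      rw [h1, h2, h3]; exact he
    · simp [negC1, allNegative, switch]
  · intro f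
    refine iff_of_true ?_ ?_
    · generalize Equiv.trans _ _ f = f'
      have h1 := hE.le f'.2
      rw [Set.mem_singleton_iff] at h1
      rwa [h1]
    · have h1 := sig_negC1 ∅
      change (f : Unit) ∈ negC1.sig ∅
      rw [h1]; rfl

/-! ### The signed graph `-K₄` -/

/-- First ends of the six edges of `K₄`. -/
def endA : Fin 6 → Fin 4 := ![0, 1, 0, 1, 0, 2]

/-- Second ends of the six edges of `K₄`. -/
def endB : Fin 6 → Fin 4 := ![3, 2, 2, 3, 1, 3]

lemma ends_inj : ∀ i j, s(endA i, endB i) = s(endA j, endB j) → i = j := by decide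

lemma ends_surj : ∀ x y : Fin 4, x ≠ y → ∃ i, s(endA i, endB i) = s(x, y) := by decide

lemma endA_ne_endB : ∀ i, endA i ≠ endB i := by decide

lemma edgeSet_negK4 : Set.range (fun i => s(endA i, endB i)) = negK4.edgeSet := by
  ext z
  induction z with
  | _ x y =>
    change _ ↔ s(x, y) ∈ (⊤ : SimpleGraph (Fin 4)).edgeSet
    rw [SimpleGraph.mem_edgeSet, SimpleGraph.top_adj]
    constructor
    · rintro ⟨i, hi⟩ rfl
      have := endA_ne_endB i
      rw [Sym2.eq_iff] at hi
      rcases hi with ⟨h1, h2⟩ | ⟨h1, h2⟩ <;> exact this (h1.trans h2.symm)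
    · exact ends_surj x y

lemma isLink_negK4 (i : Fin 6) : negK4.IsLink s(endA i, endB i) (endA i) (endB i) := by
  simp [negK4, allNegative, endA_ne_endB]

lemma presents_negK4 : negK4.Presents (fun i => s(endA i, endB i))
    (fun c : Fin 4 → Bool => {i | i ∈ Set.univ ↔ c (endA i) = c (endB i)}) :=
  presents_of_isLink (ι := id) Function.injective_id ends_inj edgeSet_negK4 isLink_negK4
    fun i => by
      refine iff_of_true ?_ trivial
      exact edgeSet_negK4.le ⟨i, rfl⟩

lemma isReducedCritical_negK4 : negK4.IsReducedCritical 2 := by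
  have hfr : ∀ c : Fin 4 → Bool, {i | i ∈ Set.univ ↔ c (endA i) = c (endB i)} =
      ((Finset.univ.filter fun i => c (endA i) = c (endB i) : Finset (Fin 6)) : Set (Fin 6)) := by
    intro c; ext i; simp
  refine ⟨?_, ?_, ?_⟩
  · rw [presents_negK4.isCritical_iff]
    simp only [hfr, Set.ncard_coe_finset, Finset.mem_coe]
    decide
  · rw [presents_negK4.splits_iff]
    rintro ⟨X, hX⟩
    classical
    have key : ∀ Y : Finset (Fin 6), ∃ c : Fin 4 → Bool,
        (∀ i, c (endA i) = c (endB i) → i ∉ Y) ∨ ∀ i, c (endA i) = c (endB i) → i ∈ Y := by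
      decide
    obtain ⟨c, hc | hc⟩ := key (Finset.univ.filter (· ∈ X))
    · obtain ⟨i, hi, hiX⟩ := (hX c).1
      have := hc i (by simpa using hi)
      simp [hiX] at this
    · obtain ⟨i, hi, hiX⟩ := (hX c).2
      have := hc i (by simpa using hi)
      simp [hiX] at this
  · intro x _
    obtain ⟨y, hy⟩ := exists_ne x
    exact ⟨s(x, y), y, by simp [negK4, allNegative, hy.symm]⟩

lemma switchIso_negK4 {ν : Fin 4 → α} {ε : Fin 6 → β} (hν : Function.Injective ν)
    (hV : Set.range ν = G.vertexSet) (hε : Function.Injective ε) (hE : Set.range ε = G.edgeSet)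
    (hl : ∀ i, G.IsLink (ε i) (ν (endA i)) (ν (endB i))) {U : Set α} (hU : G.sig U = G.edgeSet) :
    SwitchIso negK4 G := by
  have hV1 : (negK4.switch (ν ⁻¹' U)).vertexSet = Set.univ := rfl
  set f := (Equiv.setCongr hV1).trans ((Equiv.Set.univ (Fin 4)).trans
    ((Equiv.ofInjective ν hν).trans (Equiv.setCongr hV))) with hf
  set g : (negK4.switch (ν ⁻¹' U)).edgeSet ≃ G.edgeSet := (Equiv.setCongr edgeSet_negK4).symm.trans
    ((Equiv.ofInjective _ ends_inj).symm.trans ((Equiv.ofInjective ε hε).trans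
      (Equiv.setCongr hE))) with hg
  have hf' : ∀ x, (f x : α) = ν x := fun x => rfl
  have hg' : ∀ i (h : s(endA i, endB i) ∈ (negK4.switch (ν ⁻¹' U)).edgeSet),
      (g ⟨s(endA i, endB i), h⟩ : β) = ε i := by
    intro i h
    have : g.symm ⟨ε i, hE ▸ ⟨i, rfl⟩⟩ = ⟨s(endA i, endB i), h⟩ := by
      apply Subtype.ext
      have : (Equiv.ofInjective ε hε).symm ⟨ε i, ⟨i, rfl⟩⟩ = i :=
        Equiv.ofInjective_symm_apply hε i
      change (fun i => s(endA i, endB i)) ((Equiv.ofInjective ε hε).symm ⟨ε i, _⟩) = _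
      rw [this]
    rw [← this, Equiv.apply_symm_apply]
  refine ⟨ν ⁻¹' U, ⟨⟨f, g, ?_, ?_⟩⟩⟩
  · rintro ⟨e, he⟩ x y
    obtain ⟨i, rfl⟩ := edgeSet_negK4.ge he
    rw [hg', hf', hf', (hl i).isLink_iff_sym2_eq]
    have h1 : (negK4.switch (ν ⁻¹' U)).IsLink s(endA i, endB i) (endA i) (endB i) :=
      isLink_negK4 i
    rw [h1.isLink_iff_sym2_eq]
    exact (Sym2.map.injective hν).eq_iff (a := s(endA i, endB i)) (b := s((x : Fin 4), (y : Fin 4)))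
  · rintro ⟨e, he⟩
    obtain ⟨i, rfl⟩ := edgeSet_negK4.ge he
    rw [hg']
    have h1 : ε i ∈ G.sig U := hU.ge (hE.le ⟨i, rfl⟩)
    rw [mem_sig (hl i)] at h1
    rw [h1]
    change _ ↔ s(endA i, endB i) ∈ negK4.sig (ν ⁻¹' U)
    have h2 : s(endA i, endB i) ∈ negK4.neg := edgeSet_negK4.le ⟨i, rfl⟩
    rw [mem_sig (isLink_negK4 i), iff_true_left h2]
    rfl

end

section

variable {G : SignedGraph α β}

/-- The four points of `Bool × Bool`. -/
def boolPoint : Fin 4 → Bool × Bool :=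
  ![(false, false), (false, true), (true, false), (true, true)]

lemma boolPoint_surj : ∀ p, ∃ i, boolPoint i = p := by decide

lemma boolPoint_inj : Function.Injective boolPoint := by decide

lemma sepCount_boolPoint : ∀ p, sepCount (boolPoint ∘ endA) (boolPoint ∘ endB) p = 3 := by decide

lemma IsReducedCritical.switchIso_negK4 (h : G.IsReducedCritical 2)
    (h2 : ∀ X, (G.edgeCut X).ncard ≠ 2) : SwitchIso negK4 G := by
  have h1 := h.1.ncard_edgeCut_ne_one
  obtain ⟨w, U, g, hU, hg, hw, hd⟩ := h.exists_three_sigs h2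
  have hE : ∀ e ∈ G.edgeSet, ∃ i, e ∈ G.sig (U i) := by
    intro e he
    by_contra! hcon
    obtain ⟨U3, heU, hU3⟩ := h.1.exists_mem_sig he
    have hd3 := fun i => disjoint_sig_of_ne h2 (hU i) hU3 heU (hcon i)
    refine no_four_sigs h1 h2 (w := w) (U := ![U 0, U 1, U 2, U3]) ?_ ?_ (g := g) ?_ hw
    · intro i; fin_cases i
      exacts [hU 0, hU 1, hU 2, hU3]
    · intro i j hij
      fin_cases i <;> fin_cases j
      exacts [absurd rfl hij, hd 0 1 (by decide), hd 0 2 (by decide), hd3 0,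
        hd 1 0 (by decide), absurd rfl hij, hd 1 2 (by decide), hd3 1,
        hd 2 0 (by decide), hd 2 1 (by decide), absurd rfl hij, hd3 2,
        (hd3 0).symm, (hd3 1).symm, (hd3 2).symm, absurd rfl hij]
    · intro i; fin_cases i
      exacts [hg 0, hg 1, hg 2]
  obtain ⟨g0', n0, e0⟩ := exists_sig_eq_pair (hU 0) (hg 0)
  obtain ⟨g1', n1, e1⟩ := exists_sig_eq_pair (hU 1) (hg 1)
  obtain ⟨g2', n2, e2⟩ := exists_sig_eq_pair (hU 2) (hg 2)
  have m0 : g0' ∈ G.sig (U 0) := by rw [e0]; simp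
  have m1 : g1' ∈ G.sig (U 1) := by rw [e1]; simp
  have m2 : g2' ∈ G.sig (U 2) := by rw [e2]; simp
  have k0 := hg 0
  have k1 := hg 1
  have k2 := hg 2
  have hw' : ∀ i, ∃ y, G.IsLink (g i) w y := fun i => by
    obtain ⟨x, y, hl, rfl, -⟩ := hw i
    exact ⟨y, hl⟩
  choose y hy using hw'
  have mm := fun (i : Fin 3) (e : β) (he : e ∈ G.sig (U i)) => mem_sig_iff_eq_of_disjoint hd he
  obtain ⟨x0, y0, l0, s0, t0⟩ := exists_isLink_side_eq_false (U := U 0) (W := U 1) w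
    (G.sig_subset _ m0) (by rw [mm 0 _ m0, mm 0 _ m0]; decide)
  obtain ⟨x1, y1, l1, s1, t1⟩ := exists_isLink_side_eq_false (U := U 0) (W := U 1) w
    (G.sig_subset _ m1) (by rw [mm 1 _ m1, mm 1 _ m1]; decide)
  obtain ⟨x2, y2, l2, s2, t2⟩ := exists_isLink_side_eq_false (U := U 0) (W := U 2) w
    (G.sig_subset _ m2) (by rw [mm 2 _ m2, mm 2 _ m2]; decide)
  have flip : ∀ (i j : Fin 3) (e : β) (x y : α), e ∈ G.sig (U i) → G.IsLink e x y →
      side (U 0) (U j) w y = if (i = 0) = (i = j) then side (U 0) (U j) w x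
        else !side (U 0) (U j) w x := by
    intro i j e x y he hl
    split_ifs with hij
    · exact side_eq hl (by rw [mm i e he, mm i e he, hij])
    · exact side_eq_not hl (by rw [mm i e he, mm i e he]; exact fun h => hij (propext h))
  set ψ : α → Bool × Bool := fun v => (side (U 0) (U 1) w v, side (U 0) (U 2) w v) with hψ
  set ε : Fin 6 → β := ![g 0, g0', g 1, g1', g 2, g2'] with hε
  have hψw : ψ w = (false, false) := by simp [hψ, side_self]
  have hinj : Function.Injective ε := by
    refine injective_of_mem_sig (q := ![0, 0, 1, 1, 2, 2]) hd ?_ ?_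
    · intro i; fin_cases i <;> assumption
    · intro i j
      fin_cases i <;> fin_cases j <;> simp [hε, n0, n1, n2, n0.symm, n1.symm, n2.symm]
  have hmem : ∀ i, ε i ∈ G.edgeSet := by
    intro i; fin_cases i
    exacts [G.sig_subset _ k0, G.sig_subset _ m0, G.sig_subset _ k1, G.sig_subset _ m1,
      G.sig_subset _ k2, G.sig_subset _ m2]
  have hεE : Set.range ε = G.edgeSet := by
    refine Set.Subset.antisymm (by rintro _ ⟨i, rfl⟩; exact hmem i) fun e he => ?_
    obtain ⟨i, hi⟩ := hE e he
    fin_cases i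
    · change e ∈ G.sig (U 0) at hi
      rw [e0] at hi; rcases hi with h | h
      exacts [⟨0, h.symm⟩, ⟨1, h.symm⟩]
    · change e ∈ G.sig (U 1) at hi
      rw [e1] at hi; rcases hi with h | h
      exacts [⟨2, h.symm⟩, ⟨3, h.symm⟩]
    · change e ∈ G.sig (U 2) at hi
      rw [e2] at hi; rcases hi with h | h
      exacts [⟨4, h.symm⟩, ⟨5, h.symm⟩]
  have hψne : ∀ e x y, G.IsLink e x y → ψ x ≠ ψ y := by
    intro e x y hl heq
    obtain ⟨i, hi⟩ := hE e hl.edge_mem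
    have heq1 : side (U 0) (U 1) w x = side (U 0) (U 1) w y := congrArg Prod.fst heq
    have heq2 : side (U 0) (U 2) w x = side (U 0) (U 2) w y := congrArg Prod.snd heq
    have f1 := flip i 1 e x y hi hl
    have f2 := flip i 2 e x y hi hl
    rw [← heq1] at f1
    rw [← heq2] at f2
    fin_cases i <;> simp at f1 f2
  have hab : ∃ a b : Fin 6 → α, (∀ i, G.IsLink (ε i) (a i) (b i)) ∧
      ψ ∘ a = boolPoint ∘ endA ∧ ψ ∘ b = boolPoint ∘ endB := by
    have hl : ∀ i, G.IsLink (ε i) ((![w, x0, w, x1, w, x2] : Fin 6 → α) i)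
        ((![y 0, y0, y 1, y1, y 2, y2] : Fin 6 → α) i) := by
      intro i; fin_cases i
      exacts [hy 0, l0, hy 1, l1, hy 2, l2]
    have ha : ψ ∘ ![w, x0, w, x1, w, x2] =
        ![(false, false), (false, (ψ x0).2), (false, false), (false, (ψ x1).2), (false, false),
          ((ψ x2).1, false)] := by
      funext i; fin_cases i <;> simp [hψw] <;> simp [hψ, s0, s1, s2]
    have hb : ψ ∘ ![y 0, y0, y 1, y1, y 2, y2] =
        ![(true, true), (true, !(ψ x0).2), (true, false), (true, (ψ x1).2), (false, true),
          ((ψ x2).1, true)] := by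
      funext i
      fin_cases i
      · simp [hψ, flip 0 _ _ _ _ k0 (hy 0), side_self]
      · simp [hψ, flip 0 _ _ _ _ m0 l0, s0]
      · simp [hψ, flip 1 _ _ _ _ k1 (hy 1), side_self]
      · simp [hψ, flip 1 _ _ _ _ m1 l1, s1]
      · simp [hψ, flip 2 _ _ _ _ k2 (hy 2), side_self]
      · simp [hψ, flip 2 _ _ _ _ m2 l2, s2]
    have hcut := ncard_edgeCut_preimage ψ hinj hl fun e _ _ hl _ => hεE ▸ hl.edge_mem
    obtain ⟨q1, q2, q3⟩ := sepCount_six (ψ x0).2 (ψ x1).2 (ψ x2).1 fun p => by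
      rw [← ha, ← hb, ← hcut p]
      simp [h1, h2]
    refine ⟨_, _, hl, ?_, ?_⟩
    · rw [ha, q1, q2, q3]
      funext i; fin_cases i <;> rfl
    · rw [hb, q1, q2, q3]
      funext i; fin_cases i <;> rfl
  obtain ⟨a, b, hl, ha, hb⟩ := hab
  have hcut : ∀ p, (G.edgeCut (ψ ⁻¹' {p})).ncard = 3 := fun p => by
    rw [ncard_edgeCut_preimage ψ hinj hl fun e _ _ hl _ => hεE ▸ hl.edge_mem, ha, hb,
      sepCount_boolPoint]
  have hstar : ∀ v ∈ G.vertexSet, G.edgeCut {v} = G.edgeCut (ψ ⁻¹' {ψ v}) := by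
    intro v hv
    refine Set.eq_of_subset_of_ncard_le ?_ ?_ (G.finite_edgeCut _)
    · rintro e ⟨_, y, hl', rfl, -⟩
      exact ⟨_, y, hl', rfl, fun h' => hψne e _ y hl' (Set.mem_singleton_iff.1 h').symm⟩
    · rw [hcut]
      have h3 : 0 < (G.edgeCut {v}).ncard := by
        rw [Set.ncard_pos (G.finite_edgeCut _)]
        obtain ⟨e, y, hl'⟩ := h.2.2 v hv
        exact ⟨e, v, y, hl', rfl, fun h' => hψne e v y hl' (by rw [Set.mem_singleton_iff.1 h'])⟩
      have := h1 {v}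
      have := h2 {v}
      omega
  have hψinj : ∀ v ∈ G.vertexSet, ∀ v' ∈ G.vertexSet, ψ v = ψ v' → v = v' := by
    intro v hv v' hv' heq
    by_contra hne
    obtain ⟨e, x, z, hl', rfl, hz⟩ : (G.edgeCut {v}).Nonempty := by
      rw [← Set.ncard_pos (G.finite_edgeCut _), hstar v hv, hcut]; norm_num
    have h3 : e ∈ G.edgeCut {v'} := by
      rw [hstar v' hv', ← heq, ← hstar x hv]; exact ⟨x, z, hl', rfl, hz⟩
    rw [mem_edgeCut hl', Set.mem_singleton_iff, Set.mem_singleton_iff] at h3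
    have h4 : z = v' := by tauto
    exact hψne e x z hl' (by rw [heq, h4])
  have hψsurj : ∀ i, ∃ v ∈ G.vertexSet, ψ v = boolPoint i := by
    intro i
    obtain ⟨e, x, z, hl', hx, -⟩ : (G.edgeCut (ψ ⁻¹' {boolPoint i})).Nonempty := by
      rw [← Set.ncard_pos (G.finite_edgeCut _), hcut]; norm_num
    exact ⟨x, hl'.left_mem, hx⟩
  choose ν hνV hν using hψsurj
  refine SignedGraph.switchIso_negK4 (ν := ν) ?_ ?_ hinj hεE ?_
    (U := symmDiff (U 2) (symmDiff (U 0) (U 1))) ?_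
  · intro i j hij
    exact boolPoint_inj (by rw [← hν, ← hν, hij])
  · refine Set.Subset.antisymm (by rintro _ ⟨i, rfl⟩; exact hνV i) fun v hv => ?_
    obtain ⟨i, hi⟩ := boolPoint_surj (ψ v)
    exact ⟨i, hψinj _ (hνV i) _ hv (by rw [hν, hi])⟩
  · intro i
    have h3 : a i = ν (endA i) := hψinj _ (hl i).left_mem _ (hνV _) (by
      rw [hν]; exact congrFun ha i)
    have h4 : b i = ν (endB i) := hψinj _ (hl i).right_mem _ (hνV _) (by
      rw [hν]; exact congrFun hb i)
    rw [← h3, ← h4]; exact hl i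
  · refine Set.Subset.antisymm (G.sig_subset _) fun e he => ?_
    obtain ⟨i, hi⟩ := hE e he
    rw [sig_symmDiff, ← sig_symmDiff_sig, Set.mem_symmDiff, Set.mem_symmDiff, mm i e hi,
      mm i e hi, mm i e hi]
    clear hi; fin_cases i <;> simp

/-! ### Characterization of subdivisions -/

lemma IsReducedCritical.isSubdivisionOf {H : SignedGraph α' β'} {k : ℕ}
    (hstep : ∀ G : SignedGraph α β, G.IsReducedCritical k → SwitchIso H G ∨
      ∃ v, (∀ e, ¬ G.IsLink e v v) ∧ (G.edgeCut {v}).ncard = 2)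
    (hG : G.IsReducedCritical k) : G.IsSubdivisionOf H := by
  induction hn : G.vertexSet.ncard using Nat.strong_induction_on generalizing G with
  | _ n ih =>
    rcases hstep G hG with h | ⟨v, hv, hc⟩
    · exact ⟨G, h, .refl⟩
    · obtain ⟨K, hK, hlt, hr⟩ := hG.exists_suppress hv hc
      obtain ⟨H₀, h0, hr'⟩ := ih _ (hn ▸ hlt) hK rfl
      exact ⟨H₀, h0, hr'.trans hr⟩

lemma isSubdivisionOf_negC1_iff : G.IsSubdivisionOf negC1 ↔ G.IsReducedCritical 1 := by
  refine ⟨fun h => h.isReducedCritical isReducedCritical_negC1, fun h => h.isSubdivisionOf ?_⟩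
  intro G hG
  by_cases hloop : ∃ e x, G.IsLink e x x
  · obtain ⟨e, x, he⟩ := hloop
    exact Or.inl (hG.switchIso_negC1 he)
  · push Not at hloop
    obtain ⟨v, hv⟩ := hG.1.exists_degree_two_of_loopless hloop
    exact Or.inr ⟨v, fun e => hloop e v, hv⟩

lemma isSubdivisionOf_negK4_iff : G.IsSubdivisionOf negK4 ↔ G.IsReducedCritical 2 := by
  refine ⟨fun h => h.isReducedCritical isReducedCritical_negK4, fun h => h.isSubdivisionOf ?_⟩
  intro G hG
  by_cases hc : ∃ X, (G.edgeCut X).ncard = 2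
  · obtain ⟨X, hX⟩ := hc
    obtain ⟨v, hv⟩ := hG.exists_degree_two hX
    exact Or.inr ⟨v, fun e => hG.not_isLink_self e v, hv⟩
  · push Not at hc
    exact Or.inl (hG.switchIso_negK4 hc)

lemma not_splits_of_isCritical_one (h : G.IsCritical 1) : ¬ G.Splits := by
  rintro ⟨X, hX⟩
  obtain ⟨-, -, ⟨U, hU⟩, -⟩ := (G.isCritical_iff 1).1 h
  obtain ⟨a, ha⟩ := Set.ncard_eq_one.1 hU
  obtain ⟨⟨e, he, heX⟩, ⟨f, hf, hfX⟩⟩ := hX U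
  rw [ha, Set.mem_singleton_iff] at he hf
  exact hfX (hf ▸ he ▸ heX)

end

/-! ### Copies of a finite signed graph -/

/-- The copy of `H` under injections of the names of vertices and edges. -/
def mapEmb (H : SignedGraph α' β') (f : α' ↪ α) (g : β' ↪ β) : SignedGraph α β where
  vertexSet := f '' H.vertexSet
  IsLink e x y := ∃ e' x' y', H.IsLink e' x' y' ∧ g e' = e ∧ f x' = x ∧ f y' = y
  isLink_symm := by
    refine fun e _ => ⟨?_⟩
    rintro _ _ ⟨e', x', y', h, rfl, rfl, rfl⟩
    exact ⟨e', y', x', h.symm, rfl, rfl, rfl⟩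
  eq_or_eq_of_isLink_of_isLink := by
    rintro _ _ _ _ _ ⟨e', x', y', h, rfl, rfl, rfl⟩ ⟨e'', x'', y'', h', he, rfl, rfl⟩
    rw [g.injective he] at h'
    exact (h.left_eq_or_eq h').imp (congrArg f) (congrArg f)
  edgeSet := g '' H.edgeSet
  edge_mem_iff_exists_isLink := by
    intro e
    constructor
    · rintro ⟨e', he', rfl⟩
      obtain ⟨x, y, h⟩ := H.exists_isLink_of_mem_edgeSet he'
      exact ⟨_, _, e', x, y, h, rfl, rfl, rfl⟩
    · rintro ⟨_, _, e', x', y', h, rfl, -, -⟩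
      exact ⟨e', h.edge_mem, rfl⟩
  left_mem_of_isLink := by
    rintro _ _ _ ⟨e', x', y', h, rfl, rfl, rfl⟩
    exact ⟨x', h.left_mem, rfl⟩
  neg := g '' H.neg
  neg_subset := Set.image_mono H.neg_subset
  finite_vertexSet := H.finite_vertexSet.image f
  finite_edgeSet := H.finite_edgeSet.image g

lemma switchIso_mapEmb (H : SignedGraph α' β') (f : α' ↪ α) (g : β' ↪ β) :
    SwitchIso H (H.mapEmb f g) := by
  refine ⟨∅, ⟨⟨Equiv.Set.image f H.vertexSet f.injective, Equiv.Set.image g H.edgeSet g.injective,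
    ?_, ?_⟩⟩⟩
  · rintro ⟨e, he⟩ ⟨x, hx⟩ ⟨y, hy⟩
    constructor
    · rintro ⟨e', x', y', h, he', hx', hy'⟩
      have h1 : e' = e := g.injective he'
      have h2 : x' = x := f.injective hx'
      have h3 : y' = y := f.injective hy'
      rwa [h1, h2, h3] at h
    · intro h
      exact ⟨e, x, y, h, rfl, rfl, rfl⟩
  · rintro ⟨e, he⟩
    have h1 : (H.switch ∅).neg = H.neg := H.sig_empty
    rw [h1]
    exact g.injective.mem_set_image

lemma exists_switchIso (α β : Type*) [Infinite α] [Infinite β] [Countable α'] [Countable β']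
    (H : SignedGraph α' β') : ∃ G : SignedGraph α β, SwitchIso H G := by
  obtain ⟨f, hf⟩ := exists_injective_nat α'
  obtain ⟨g, hg⟩ := exists_injective_nat β'
  exact ⟨_, H.switchIso_mapEmb (Function.Embedding.trans ⟨f, hf⟩ (Infinite.natEmbedding α))
    (Function.Embedding.trans ⟨g, hg⟩ (Infinite.natEmbedding β))⟩

/-! ### Signatures of odd wheels -/

/-- The signature of `-W_n` that corresponds to the set `c` of rim vertices on the side of the hub:
`inl j` is the rim edge from `j` to `j + 1`, and `inr j` is the spoke at `j`. -/
def wheelSig {n : ℕ} [NeZero n] (c : Fin n → Bool) : Set (Fin n ⊕ Fin n) :=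
  {e | Sum.elim (fun j => c j = c (j + 1)) (fun j => c j = true) e}

/-- The edges of a wheel. -/
def wheelEdge {n : ℕ} [NeZero n] : Fin n ⊕ Fin n → Sym2 (Option (Fin n)) :=
  Sum.elim (fun j => s(some j, some (j + 1))) (fun j => s(none, some j))

lemma presents_negOddWheel {t : ℕ} (ht : 1 ≤ t) :
    (negOddWheel t).Presents wheelEdge (wheelSig (n := 2 * t + 1)) := by
  have h1 : ∀ j : Fin (2 * t + 1), j + 1 ≠ j := by
    intro j h
    have : (1 : Fin (2 * t + 1)) = 0 := by simpa using h
    rw [Fin.ext_iff, Fin.val_one', Fin.val_zero, Nat.mod_eq_of_lt (by omega)] at this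
    omega
  have h2 : ∀ j : Fin (2 * t + 1), j + 1 + 1 ≠ j := by
    intro j h
    rw [add_assoc] at h
    have : (1 + 1 : Fin (2 * t + 1)) = 0 := by simpa using h
    rw [Fin.ext_iff, Fin.val_add, Fin.val_one', Fin.val_zero, Nat.mod_eq_of_lt (a := 1) (by omega),
      Nat.mod_eq_of_lt (by omega)] at this
    omega
  have hinj : Function.Injective (wheelEdge (n := 2 * t + 1)) := by
    rintro (i | i) (j | j) h
    · simp only [wheelEdge, Sum.elim_inl, Sym2.eq_iff, Option.some.injEq] at h
      rcases h with ⟨h, -⟩ | ⟨rfl, h⟩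
      · rw [h]
      · exact absurd h (h2 j)
    · simp [wheelEdge] at h
    · simp [wheelEdge] at h
    · simpa [wheelEdge] using h
  have hadj : ∀ i j : Fin (2 * t + 1), (SimpleGraph.cycleGraph (2 * t + 1)).Adj i j ↔
      i = j + 1 ∨ j = i + 1 := by
    intro i j
    have h3 : ∀ a b : Fin (2 * t + 1), (a - b).val = 1 ↔ a = b + 1 := by
      intro a b
      have : (1 : Fin (2 * t + 1)).val = 1 := by
        rw [Fin.val_one', Nat.mod_eq_of_lt (by omega)]
      rw [← sub_eq_iff_eq_add', Fin.ext_iff, this]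
    rw [SimpleGraph.cycleGraph_adj', h3, h3]
  have hE : Set.range (wheelEdge (n := 2 * t + 1)) = (negOddWheel t).edgeSet := by
    change _ = (wheelGraph (2 * t + 1)).edgeSet
    ext z
    induction z with
    | _ x y =>
      rw [SimpleGraph.mem_edgeSet]
      constructor
      · rintro ⟨i | i, hi⟩
        · simp only [wheelEdge, Sum.elim_inl, Sym2.eq_iff] at hi
          rcases hi with ⟨rfl, rfl⟩ | ⟨rfl, rfl⟩
          · exact (hadj _ _).2 (Or.inr rfl)
          · exact (hadj _ _).2 (Or.inl rfl)
        · simp only [wheelEdge, Sum.elim_inr, Sym2.eq_iff] at hi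
          rcases hi with ⟨rfl, rfl⟩ | ⟨rfl, rfl⟩ <;> trivial
      · intro h
        rcases x with _ | i <;> rcases y with _ | j
        · exact absurd h id
        · exact ⟨Sum.inr j, rfl⟩
        · exact ⟨Sum.inr i, Sym2.eq_swap⟩
        · rcases (hadj i j).1 h with rfl | rfl
          · exact ⟨Sum.inl j, Sym2.eq_swap⟩
          · exact ⟨Sum.inl i, rfl⟩
  have hP := presents_of_isLink (G := negOddWheel t) (ι := id) (κ := wheelEdge (n := 2 * t + 1))
    (a := Sum.elim some (fun _ => none)) (b := Sum.elim (fun j => some (j + 1)) some)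
    (N := Set.univ) Function.injective_id hinj hE ?_ ?_
  · refine ⟨hinj, hE, fun U => ?_, fun c => ?_⟩
    · obtain ⟨c, hc⟩ := hP.exists_fr U
      refine ⟨fun j => c (some j) == c none, hc.trans (congrArg _ ?_)⟩
      ext (j | j)
      · simp only [wheelSig, Set.mem_ofPred_eq, Sum.elim_inl, Set.mem_univ, true_iff]
        cases c (some j) <;> cases c (some (j + 1)) <;> cases c none <;> decide
      · simp only [wheelSig, Set.mem_ofPred_eq, Sum.elim_inr, Set.mem_univ, true_iff]
        cases c (some j) <;> cases c none <;> decide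
    · obtain ⟨U, hU⟩ := hP.exists_sig (fun x => x.elim true c)
      refine ⟨U, hU.trans (congrArg _ ?_)⟩
      ext (j | j)
      · simp [wheelSig]
      · simp only [wheelSig, Set.mem_ofPred_eq, Sum.elim_inr, Set.mem_univ, true_iff,
          Option.elim_none, Option.elim_some]
        exact eq_comm
  · intro e
    have he : wheelEdge e ∈ (negOddWheel t).edgeSet := hE.le ⟨e, rfl⟩
    rcases e with j | j
    · exact ⟨rfl, he⟩
    · exact ⟨rfl, he⟩
  · exact fun e => iff_of_true (hE.le ⟨e, rfl⟩) trivial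

lemma one_le_of_alternating (d : ℕ → Bool) {a n : ℕ} (hn : Odd n) (h : d (a + n) = d a) :
    1 ≤ ∑ j ∈ Finset.range n, if d (a + j) = d (a + j + 1) then 1 else 0 := by
  by_contra! hcon
  have h0 : ∀ j < n, d (a + j + 1) = !d (a + j) := by
    intro j hj
    have h1 := Finset.sum_eq_zero_iff.1 (Nat.lt_one_iff.1 hcon) j (Finset.mem_range.2 hj)
    have h2 : d (a + j) ≠ d (a + j + 1) := fun h2 => by simp [h2] at h1
    revert h2
    cases d (a + j) <;> cases d (a + j + 1) <;> simp
  have h1 : ∀ j ≤ n, d (a + j) = if Even j then d a else !d a := by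
    intro j
    induction j with
    | zero => simp
    | succ j ih =>
      intro hj
      rw [← add_assoc, h0 j (by omega), ih (by omega)]
      by_cases he : Even j
      · simp [he, Nat.even_add_one]
      · simp [he, Nat.even_add_one]
  have h2 := h1 n le_rfl
  rw [if_neg (Nat.not_even_iff_odd.2 hn), h] at h2
  revert h2
  cases d a <;> simp

/-- The triangles on consecutive spokes and the remaining negative circuit cover every spoke
twice. -/
lemma le_alternating_sum (d : ℕ → Bool) {m n : ℕ} (hmn : 2 * m ≤ n) (hn : Even n)
    (h : d (n + 1) = d 0) :
    2 * m + 1 ≤ (∑ j ∈ Finset.range (n + 1), if d j = d (j + 1) then 1 else 0) +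
      2 * ∑ j ∈ Finset.range (2 * m + 1), if d j = true then 1 else 0 := by
  obtain ⟨l, rfl⟩ : ∃ l, n = 2 * m + l := ⟨n - 2 * m, by omega⟩
  have hl : Odd (l + 1) := by
    rw [Nat.odd_iff]; rw [Nat.even_iff] at hn; omega
  have h1 : 2 * m ≤ ∑ j ∈ Finset.range (2 * m), ((if d j = d (j + 1) then 1 else 0) +
      ((if d j = true then 1 else 0) + if d (j + 1) = true then 1 else 0)) := by
    calc 2 * m = ∑ j ∈ Finset.range (2 * m), 1 := by simp
      _ ≤ _ := Finset.sum_le_sum fun j _ => by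
        cases d j <;> cases d (j + 1) <;> simp
  have h2 : 1 ≤ (∑ j ∈ Finset.range (l + 1),
      if d (2 * m + j) = d (2 * m + j + 1) then 1 else 0) +
      ((if d 0 = true then 1 else 0) + if d (2 * m) = true then 1 else 0) := by
    by_cases h3 : d 0 = true
    · rw [if_pos h3]; omega
    · by_cases h4 : d (2 * m) = true
      · rw [if_pos h4]; omega
      · refine (one_le_of_alternating d hl ?_).trans (Nat.le_add_right _ _)
        rw [← add_assoc, h]
        simp only [Bool.not_eq_true] at h3 h4
        rw [h3, h4]
  rw [Finset.sum_add_distrib, Finset.sum_add_distrib] at h1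
  have h5 := Finset.sum_range_succ (fun j => if d j = true then 1 else 0) (2 * m)
  have h6 := Finset.sum_range_succ' (fun j => if d j = true then 1 else 0) (2 * m)
  have h7 := Finset.sum_range_add (fun j => if d j = d (j + 1) then 1 else 0) (2 * m) (l + 1)
  rw [← add_assoc] at h7
  omega

section

variable {n : ℕ} [NeZero n]

/-- The rim and the first `M` spokes of a wheel. -/
def wheelPart (n M : ℕ) : Set (Fin n ⊕ Fin n) := {e | Sum.elim (fun _ => True) (fun j => j.val < M) e}

lemma ncard_wheelSig_inter (c : Fin n → Bool) (M : ℕ) :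
    (wheelSig c ∩ wheelPart n M).ncard = (∑ j, if c j = c (j + 1) then 1 else 0) +
      ∑ j, if c j = true ∧ j.val < M then 1 else 0 := by
  have : wheelSig c ∩ wheelPart n M = Sum.inl '' {j | c j = c (j + 1)} ∪
      Sum.inr '' {j | c j = true ∧ j.val < M} := by
    ext (j | j) <;> simp [wheelSig, wheelPart]
  rw [this, Set.ncard_union_eq, Set.ncard_image_of_injective _ Sum.inl_injective,
    Set.ncard_image_of_injective _ Sum.inr_injective, Set.ncard_eq_toFinset_card',
    Set.ncard_eq_toFinset_card', Set.toFinset_ofPred, Set.toFinset_ofPred, Finset.card_filter,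
    Finset.card_filter]
  rw [Set.disjoint_left]
  rintro _ ⟨i, -, rfl⟩ ⟨j, -, hj⟩
  cases hj

lemma le_ncard_wheelSig_inter {m : ℕ} (hn : Odd n) (hm : 1 ≤ m) (hmn : 2 * m - 1 ≤ n)
    (c : Fin n → Bool) : m ≤ (wheelSig c ∩ wheelPart n (2 * m - 1)).ncard := by
  obtain ⟨m, rfl⟩ : ∃ m', m = m' + 1 := ⟨m - 1, by omega⟩
  obtain ⟨n', rfl⟩ : ∃ n', n = n' + 1 := ⟨n - 1, by have := NeZero.pos n; omega⟩
  have hM : 2 * (m + 1) - 1 = 2 * m + 1 := by omega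
  rw [hM] at hmn ⊢
  rw [ncard_wheelSig_inter]
  set d : ℕ → Bool := fun i => c (Fin.ofNat (n' + 1) i) with hd
  have hd0 : ∀ j : Fin (n' + 1), d j = c j := fun j => by
    simp only [hd]; congr 1; ext; simp
  have hd1 : ∀ j : Fin (n' + 1), d (j + 1) = c (j + 1) := fun j => by
    simp only [hd]; congr 1; ext; simp [Fin.val_add]
  have hn' : Even n' := by rwa [Nat.odd_add_one, Nat.not_odd_iff_even] at hn
  have h1 := le_alternating_sum d (m := m) (n := n') (by omega) hn' (by simp only [hd]; congr 1; ext; simp)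
  have h2 : (∑ j, if c j = c (j + 1) then 1 else 0) =
      ∑ j ∈ Finset.range (n' + 1), if d j = d (j + 1) then 1 else 0 := by
    rw [← Fin.sum_univ_eq_sum_range (fun j => if d j = d (j + 1) then 1 else 0)]
    simp only [hd0, hd1]
  have h3 : (∑ j : Fin (n' + 1), if c j = true ∧ j.val < 2 * m + 1 then 1 else 0) =
      ∑ j ∈ Finset.range (2 * m + 1), if d j = true then 1 else 0 := by
    have h4 : (∑ j : Fin (n' + 1), if c j = true ∧ j.val < 2 * m + 1 then 1 else 0) =
        ∑ j ∈ Finset.range (n' + 1), if d j = true ∧ j < 2 * m + 1 then 1 else 0 := by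
      rw [← Fin.sum_univ_eq_sum_range (fun j => if d j = true ∧ j < 2 * m + 1 then 1 else 0)]
      simp only [hd0]
    rw [h4, ← Finset.card_filter, ← Finset.card_filter]
    congr 1
    ext j
    simp only [Finset.mem_filter, Finset.mem_range]
    constructor
    · rintro ⟨-, h5, h6⟩; exact ⟨h6, h5⟩
    · rintro ⟨h5, h6⟩; exact ⟨by omega, h6, h5⟩
  rw [h2, h3]
  omega

lemma exists_unique_mono (hn : Odd n) (r : Fin n) (b : Bool) :
    ∃ c : Fin n → Bool, c r = b ∧ ∀ j, c j = c (j + 1) ↔ j = r := by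
  suffices h : ∃ c : Fin n → Bool, ∀ j, c j = c (j + 1) ↔ j = r by
    obtain ⟨c, hc⟩ := h
    refine ⟨fun j => c j ^^ (c r ^^ b), by simp, fun j => ?_⟩
    rw [← hc]
    simp
  obtain ⟨n, rfl⟩ : ∃ n', n = n' + 1 := ⟨n - 1, by have := NeZero.pos n; omega⟩
  have hn' : Even n := by rwa [Nat.odd_add_one, Nat.not_odd_iff_even] at hn
  refine ⟨fun j => decide (Even (if j ≤ r then j.val else j.val + 1)), fun j => ?_⟩
  rw [decide_eq_decide]
  rcases eq_or_ne j (Fin.last n) with rfl | hj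
  · rw [Fin.last_add_one, if_pos (Fin.zero_le r)]
    by_cases hr : Fin.last n = r
    · rw [if_pos hr.le]
      simp [hr.symm, hn']
    · rw [if_neg fun h => hr (le_antisymm h (Fin.le_last r))]
      simp [hr, Nat.even_add_one, hn']
  · have hlt : j < Fin.last n := lt_of_le_of_ne (Fin.le_last j) hj
    have hv : (j + 1).val = j.val + 1 := Fin.val_add_one_of_lt hlt
    simp only [Fin.le_def, hv, Fin.ext_iff]
    split_ifs with h1 h2 h2
    · rw [Nat.even_add_one]; constructor <;> intro h
      · tauto
      · omega
    · rw [Nat.even_add_one, Nat.even_add_one, not_not]; constructor <;> intro h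
      · omega
      · rfl
    · omega
    · rw [Nat.even_add_one, Nat.even_add_one (n := j.val + 1), Nat.even_add_one]; constructor <;> intro h
      · tauto
      · omega

/-- Two groups of edges of a wheel that contain few spokes cannot have a large total frustration
index. -/
lemma not_wheel_bipartition (hn : Odd n) {a b : ℕ} (ha : 1 ≤ a) (hb : 1 ≤ b)
    {P Q : Set (Fin n ⊕ Fin n)} (hPQ : Disjoint P Q)
    (hS : (P ∩ Set.range Sum.inr).ncard + (Q ∩ Set.range Sum.inr).ncard < 2 * (a + b))
    (hP : ∀ c, a ≤ (wheelSig c ∩ P).ncard) (hQ : ∀ c, b ≤ (wheelSig c ∩ Q).ncard) : False := by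
  have main : ∀ (a : ℕ) (P : Set (Fin n ⊕ Fin n)), (∀ c, a ≤ (wheelSig c ∩ P).ncard) →
      (P ∩ Set.range Sum.inr).ncard < 2 * a → ∀ r, Sum.inl r ∈ P := by
    intro a P hP hlt r
    by_contra hr
    obtain ⟨c, -, hc⟩ := exists_unique_mono hn r true
    have h1 := hP c
    have h2 := hP (fun j => !c j)
    have h3 := Set.ncard_union_add_ncard_inter (wheelSig c ∩ P) (wheelSig (fun j => !c j) ∩ P)
    have h4 : wheelSig c ∩ P ∩ (wheelSig (fun j => !c j) ∩ P) = ∅ := by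
      rw [Set.eq_empty_iff_forall_notMem]
      rintro (j | j) ⟨⟨h5, h6⟩, h7, -⟩
      · have : c j = c (j + 1) := h5
        rw [hc] at this
        exact hr (this ▸ h6)
      · have h8 : c j = true := h5
        have h9 : (!c j) = true := h7
        simp [h8] at h9
    have h5 : (wheelSig c ∩ P ∪ wheelSig (fun j => !c j) ∩ P).ncard ≤
        (P ∩ Set.range Sum.inr).ncard := by
      refine Set.ncard_le_ncard ?_
      have h6 : ∀ j, Sum.inl j ∈ P → c j ≠ c (j + 1) := by
        intro j hj h7
        rw [hc] at h7
        exact hr (h7 ▸ hj)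
      rintro (j | j) (⟨h7, h8⟩ | ⟨h7, h8⟩)
      · exact absurd h7 (h6 j h8)
      · exact absurd (Bool.not_inj (h7 : (!c j) = !c (j + 1))) (h6 j h8)
      · exact ⟨h8, j, rfl⟩
      · exact ⟨h8, j, rfl⟩
    rw [h4, Set.ncard_empty] at h3
    omega
  have rim : ∀ (b : ℕ) (Q : Set (Fin n ⊕ Fin n)), 1 ≤ b → (∀ c, b ≤ (wheelSig c ∩ Q).ncard) →
      ∃ r, Sum.inl r ∈ Q := by
    intro b Q hb hQ
    have h1 := hb.trans (hQ fun _ => false)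
    obtain ⟨e | e, he, heQ⟩ := (Set.ncard_pos (Set.toFinite _)).1 h1
    · exact ⟨e, heQ⟩
    · have : false = true := he
      cases this
  rw [Set.disjoint_left] at hPQ
  rcases lt_or_ge (P ∩ Set.range Sum.inr).ncard (2 * a) with h | h
  · obtain ⟨r, hr⟩ := rim b Q hb hQ
    exact hPQ (main a P hP h r) hr
  · obtain ⟨r, hr⟩ := rim a P ha hP
    exact hPQ hr (main b Q hQ (by omega) r)

end

section

variable {n : ℕ} [NeZero n]

lemma ncard_wheelSig (c : Fin n → Bool) : (wheelSig c).ncard =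
    (∑ j, if c j = c (j + 1) then 1 else 0) + ∑ j, if c j = true then 1 else 0 := by
  have h := ncard_wheelSig_inter c n
  have h1 : wheelPart n n = Set.univ := by
    ext (j | j) <;> simp [wheelPart]
  simpa [h1] using h

lemma ncard_wheelSig_of_unique {t : ℕ} (hn : n = 2 * t + 1) {c : Fin n → Bool} {r : Fin n}
    (hr : c r = false) (hc : ∀ j, c j = c (j + 1) ↔ j = r) : (wheelSig c).ncard = t + 1 := by
  have h1 : (∑ j, if c j = c (j + 1) then 1 else 0) = 1 := by simp [hc]
  have h2 : ∑ j, ((if c j = true then 1 else 0) + ((if c (j + 1) = true then 1 else 0) +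
      if j = r then 1 else 0)) = n := by
    calc _ = ∑ j : Fin n, 1 := Finset.sum_congr rfl fun j _ => ?_
      _ = n := by simp
    have h3 := hc j
    rcases eq_or_ne j r with rfl | hj
    · have h4 := h3.2 rfl
      rw [← h4]
      simp [hr]
    · have h4 : c j ≠ c (j + 1) := fun h => hj (h3.1 h)
      rw [if_neg hj]
      revert h4
      cases c j <;> cases c (j + 1) <;> simp
  rw [Finset.sum_add_distrib, Finset.sum_add_distrib] at h2
  have h5 : (∑ j, if c (j + 1) = true then 1 else 0) = ∑ j, if c j = true then 1 else 0 :=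
    Fintype.sum_equiv (Equiv.addRight (1 : Fin n)) _ _ fun _ => rfl
  rw [h5] at h2
  have h6 : (∑ j, if j = r then 1 else 0) = 1 := by simp
  rw [ncard_wheelSig, h1]
  omega

lemma keep_mono {G : SignedGraph α β} {K L : Set β} (h : K ⊆ L) :
    (G.keep K).IsSubgraph (G.keep L) := by
  refine ⟨?_, ?_⟩
  · change G.toGraph.deleteEdges (G.edgeSet \ K) ≤ G.toGraph.deleteEdges (G.edgeSet \ L)
    have h1 : G.edgeSet \ L ⊆ G.edgeSet \ K := fun e he => ⟨he.1, fun hK => he.2 (h hK)⟩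
    rw [← Set.union_eq_self_of_subset_left h1, ← Graph.deleteEdges_deleteEdges]
    exact Graph.deleteEdges_le
  rw [edgeSet_keep]
  change G.neg \ (G.edgeSet \ K) = (G.neg \ (G.edgeSet \ L)) ∩ (G.edgeSet ∩ K)
  ext e
  have h1 : e ∈ G.neg → e ∈ G.edgeSet := fun h => G.neg_subset h
  have h2 : e ∈ K → e ∈ L := fun he => h he
  simp only [Set.mem_sdiff, Set.mem_inter_iff]
  tauto

lemma isCritical_of_presents_wheelSig {G : SignedGraph α β} {t : ℕ} (ht : 1 ≤ t)
    {κ : Fin (2 * t + 1) ⊕ Fin (2 * t + 1) → β} (h : G.Presents κ wheelSig) :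
    G.IsCritical (t + 1) := by
  have hodd : Odd (2 * t + 1) := odd_two_mul_add_one t
  have hex : ∀ e : Fin (2 * t + 1) ⊕ Fin (2 * t + 1),
      ∃ c, e ∈ wheelSig c ∧ (wheelSig c).ncard = t + 1 := by
    rintro (r | j)
    · obtain ⟨c, h1, h2⟩ := exists_unique_mono hodd r false
      exact ⟨c, (h2 r).2 rfl, ncard_wheelSig_of_unique rfl h1 h2⟩
    · obtain ⟨c, h1, h2⟩ := exists_unique_mono hodd (j + 1) false
      refine ⟨c, ?_, ncard_wheelSig_of_unique rfl h1 h2⟩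
      have h3 : c j ≠ c (j + 1) := fun h3 => by
        have h4 : (1 : Fin (2 * t + 1)) = 0 := by simpa using ((h2 j).1 h3).symm
        rw [Fin.ext_iff, Fin.val_one', Fin.val_zero, Nat.mod_eq_of_lt (by omega)] at h4
        omega
      rw [h1] at h3
      simpa [wheelSig] using h3
  refine (h.isCritical_iff _).2 ⟨by omega, fun c => ?_, (hex (Sum.inl 0)).imp fun c h => h.2, hex⟩
  have := le_ncard_wheelSig_inter hodd (m := t + 1) (by omega) (by omega) c
  exact this.trans (Set.ncard_le_ncard Set.inter_subset_left)

lemma exists_not_isDecomposable {G : SignedGraph α β} {κ : Fin n ⊕ Fin n → β}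
    (h : G.Presents κ wheelSig) (hn : Odd n) {m : ℕ} (hm : 1 ≤ m) (hmn : 2 * m - 1 ≤ n) :
    ∃ H : SignedGraph α β, H.IsSubgraph G ∧ H.IsCritical m ∧ ¬ H.IsDecomposable := by
  obtain ⟨L, hL, hLm⟩ := G.exists_isCritical_keep hm (K := κ '' wheelPart n (2 * m - 1))
    (h.range_eq ▸ Set.image_subset_range _ _)
    ((h.le_ncard_iff _ _).2 fun c => le_ncard_wheelSig_inter hn hm hmn c)
  refine ⟨_, G.isSubgraph_keep L, hLm, fun hd => ?_⟩
  obtain ⟨k, a, b, A, hk, ha, hb, hab, hA⟩ := hd.exists_bipartition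
  obtain rfl := hLm.eq hk
  have hdisj : Disjoint (κ ⁻¹' (L ∩ A)) (κ ⁻¹' (L \ A)) :=
    Set.disjoint_left.2 fun e h1 h2 => h2.2 h1.2
  have himg : ∀ B ⊆ L, κ '' (κ ⁻¹' B) = B := fun B hB =>
    Set.image_preimage_eq_of_subset (hB.trans (hL.trans (Set.image_subset_range _ _)))
  refine not_wheel_bipartition hn ha hb hdisj ?_
    ((h.le_ncard_iff _ _).1 fun U => ?_) ((h.le_ncard_iff _ _).1 fun U => ?_)
  · rw [← Set.ncard_union_eq (hdisj.mono Set.inter_subset_left Set.inter_subset_left)]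
    refine (Set.ncard_le_ncard (t := Sum.inr '' {j : Fin n | j.val < 2 * m - 1}) ?_).trans_lt ?_
    · have : ∀ e, κ e ∈ L → e ∈ wheelPart n (2 * m - 1) := fun e he => by
        simpa [h.injective.eq_iff] using hL he
      rintro _ (⟨h1, j, rfl⟩ | ⟨h1, j, rfl⟩)
      · exact ⟨j, this _ h1.1, rfl⟩
      · exact ⟨j, this _ h1.1, rfl⟩
    · rw [Set.ncard_image_of_injective _ Sum.inr_injective,
        ← Set.ncard_image_of_injective _ Fin.val_injective]
      refine (Set.ncard_le_ncard (t := Set.Iio (2 * m - 1)) ?_ (Set.finite_Iio _)).trans_lt ?_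
      · rintro _ ⟨j, hj, rfl⟩
        exact hj
      · rw [Set.ncard_eq_toFinset_card', Set.toFinset_Iio, Nat.card_Iio]
        omega
  · rw [himg _ Set.inter_subset_left, ← Set.inter_assoc, ← sig_keep]
    exact (hA U).1
  · rw [himg _ Set.sdiff_subset, ← Set.inter_sdiff_assoc, ← sig_keep]
    exact (hA U).2

/-- The edges of the triangle on two consecutive spokes of a wheel. -/
def wheelTriangle (j : Fin n) : Set (Fin n ⊕ Fin n) := {.inl j, .inr j, .inr (j + 1)}

lemma wheelSig_inter_wheelTriangle_nonempty (c : Fin n → Bool) (j : Fin n) :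
    (wheelSig c ∩ wheelTriangle j).Nonempty := by
  cases h1 : c j
  · cases h2 : c (j + 1)
    · exact ⟨.inl j, h1.trans h2.symm, .inl rfl⟩
    · exact ⟨.inr (j + 1), h2, .inr (.inr rfl)⟩
  · exact ⟨.inr j, h1, .inr (.inl rfl)⟩

lemma ncard_wheelSig_inter_wheelTriangle {c : Fin n → Bool} {j : Fin n}
    (h : ¬ (c j = true ∧ c (j + 1) = true)) : (wheelSig c ∩ wheelTriangle j).ncard = 1 := by
  rw [Set.ncard_eq_one]
  cases h1 : c j
  · cases h2 : c (j + 1)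
    · refine ⟨.inl j, ?_⟩
      ext (i | i) <;> simp only [wheelSig, wheelTriangle, Set.mem_inter_iff, Set.mem_ofPred_eq,
        Sum.elim_inl, Sum.elim_inr, Set.mem_insert_iff, Set.mem_singleton_iff, Sum.inl.injEq,
        Sum.inr.injEq, reduceCtorEq, or_false, false_or, iff_false]
      · exact ⟨fun h => h.2, by rintro rfl; exact ⟨h1.trans h2.symm, rfl⟩⟩
      · rintro ⟨h3, rfl | rfl⟩
        · simp [h1] at h3
        · simp [h2] at h3
    · refine ⟨.inr (j + 1), ?_⟩
      ext (i | i) <;> simp only [wheelSig, wheelTriangle, Set.mem_inter_iff, Set.mem_ofPred_eq,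
        Sum.elim_inl, Sum.elim_inr, Set.mem_insert_iff, Set.mem_singleton_iff, Sum.inl.injEq,
        Sum.inr.injEq, reduceCtorEq, or_false, false_or, iff_false]
      · rintro ⟨h3, rfl⟩
        simp [h1, h2] at h3
      · constructor
        · rintro ⟨h3, rfl | rfl⟩
          · simp [h1] at h3
          · rfl
        · rintro rfl
          exact ⟨h2, .inr rfl⟩
  · have h2 : c (j + 1) = false := by simpa [h1] using h
    refine ⟨.inr j, ?_⟩
    ext (i | i) <;> simp only [wheelSig, wheelTriangle, Set.mem_inter_iff, Set.mem_ofPred_eq,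
        Sum.elim_inl, Sum.elim_inr, Set.mem_insert_iff, Set.mem_singleton_iff, Sum.inl.injEq,
        Sum.inr.injEq, reduceCtorEq, or_false, false_or, iff_false]
    · rintro ⟨h3, rfl⟩
      simp [h1, h2] at h3
    · constructor
      · rintro ⟨h3, rfl | rfl⟩
        · rfl
        · simp [h2] at h3
      · rintro rfl
        exact ⟨h1, .inl rfl⟩

lemma exists_isDecomposable_of_presents_wheelSig {G : SignedGraph α β} {κ : Fin n ⊕ Fin n → β}
    (h : G.Presents κ wheelSig) (hn : ∀ j : Fin n, j + 1 ≠ j) {i j : Fin n}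
    (hij : Disjoint (wheelTriangle i) (wheelTriangle j)) :
    ∃ H : SignedGraph α β, H.IsSubgraph G ∧ H.IsCritical 2 ∧ H.IsDecomposable := by
  have hpos : ∀ (c : Fin n → Bool) (l : Fin n), 1 ≤ (wheelSig c ∩ wheelTriangle l).ncard :=
    fun c l => (Set.ncard_pos (Set.toFinite _)).2 (wheelSig_inter_wheelTriangle_nonempty c l)
  have hunion : ∀ c : Fin n → Bool, (wheelSig c ∩ (wheelTriangle i ∪ wheelTriangle j)).ncard =
      (wheelSig c ∩ wheelTriangle i).ncard + (wheelSig c ∩ wheelTriangle j).ncard := fun c => by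
    rw [Set.inter_union_distrib_left,
      Set.ncard_union_eq (hij.mono Set.inter_subset_right Set.inter_subset_right)]
  have hex : ∀ e : Fin n ⊕ Fin n, ∃ c, e ∈ wheelSig c ∧
      ∀ l, (wheelSig c ∩ wheelTriangle l).ncard = 1 := by
    rintro (l | p)
    · exact ⟨fun _ => false, rfl, fun l => ncard_wheelSig_inter_wheelTriangle (by simp)⟩
    · refine ⟨fun l => decide (l = p), by simp [wheelSig], fun l =>
        ncard_wheelSig_inter_wheelTriangle ?_⟩
      simp only [decide_eq_true_eq]
      rintro ⟨rfl, h1⟩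
      exact hn _ h1
  have hcrit : ∀ l, (G.keep (κ '' wheelTriangle l)).IsCritical 1 := fun l =>
    (h.isCritical_keep_iff _ _).2 ⟨le_rfl, fun c => hpos c l,
      (hex (.inl l)).imp fun c h => h.2 l, fun e _ => (hex e).imp fun c h => ⟨h.1, h.2 l⟩⟩
  have hcrit2 : (G.keep (κ '' (wheelTriangle i ∪ wheelTriangle j))).IsCritical 2 := by
    refine (h.isCritical_keep_iff _ _).2 ⟨by norm_num, fun c => ?_,
      (hex (.inl i)).imp fun c h => ?_, fun e _ => (hex e).imp fun c h => ⟨h.1, ?_⟩⟩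
    · have := hpos c i
      have := hpos c j
      rw [hunion]; omega
    · rw [hunion, h.2, h.2]
    · rw [hunion, h.2, h.2]
  refine ⟨_, G.isSubgraph_keep _, hcrit2, isDecomposable_of_isSubgraph hcrit2
    (keep_mono (Set.image_mono Set.subset_union_left)) (hcrit i)
    (keep_mono (Set.image_mono Set.subset_union_right)) (hcrit j) ?_ rfl⟩
  rw [edgeSet_keep, edgeSet_keep]
  exact ((Set.disjoint_image_iff h.injective).2 hij).mono Set.inter_subset_right
    Set.inter_subset_right

lemma switchIso_negOddWheel_mem {t : ℕ} (ht : 2 ≤ t) {G : SignedGraph α β}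
    (hG : SwitchIso (negOddWheel t) G) : G ∈ classS α β (t + 1) \ classSStar α β (t + 1) := by
  obtain ⟨κ, h⟩ := (presents_negOddWheel (by omega : 1 ≤ t)).switchIso hG
  have hc := isCritical_of_presents_wheelSig (by omega) h
  refine ⟨⟨hc, fun m h1 h2 => exists_not_isDecomposable h (odd_two_mul_add_one t) h1 (by omega)⟩,
    fun hS => ?_⟩
  have hv : ∀ (j : Fin (2 * t + 1)), j.val < 2 * t → (j + 1).val = j.val + 1 := fun j hj =>
    Fin.val_add_one_of_lt (by rw [Fin.lt_def]; exact hj)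
  have hn : ∀ j : Fin (2 * t + 1), j + 1 ≠ j := fun j hj => by
    have h4 : (1 : Fin (2 * t + 1)) = 0 := by simpa using hj
    rw [Fin.ext_iff, Fin.val_one', Fin.val_zero, Nat.mod_eq_of_lt (by omega)] at h4
    omega
  have hdisj : Disjoint (wheelTriangle (⟨0, by omega⟩ : Fin (2 * t + 1)))
      (wheelTriangle ⟨2, by omega⟩) := by
    have h0 := hv ⟨0, by omega⟩ (by simp; omega)
    have h2 := hv ⟨2, by omega⟩ (by simp; omega)
    rw [Set.disjoint_left]
    simp only [wheelTriangle]
    rintro (l | l) h3 h4 <;>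
      simp only [Set.mem_insert_iff, Set.mem_singleton_iff, Sum.inl.injEq, Sum.inr.injEq,
        reduceCtorEq, or_false, false_or, Fin.ext_iff, h0, h2] at h3 h4 <;> omega
  obtain ⟨H, hHG, hH, hd⟩ := exists_isDecomposable_of_presents_wheelSig h hn hdisj
  exact hS.2 2 (by norm_num) (by omega) H hHG hH hd

end

/-- A subcubic signed graph has no two edge-disjoint negative circuits if it has a drawing in which,
of any two disjoint edges, the number of crossings is odd if and only if both are negative. That two
closed walks cross an even number of times is expressed through `A` and `B`. -/
lemma not_splits_of_crossing {G : SignedGraph α β} (hloop : ∀ e x, ¬ G.IsLink e x x)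
    (p : β → α → Fin 3) (hp : ∀ e f x, G.Inc e x → G.Inc f x → p e x = p f x → e = f)
    (A B : β → α → ZMod 2)
    (h : ∀ e f a b c d, G.IsLink e a b → G.IsLink f c d → a ≠ c → a ≠ d → b ≠ c → b ≠ d →
      A f a + A f b + (B e c + B e d) = ind G.neg e * ind G.neg f) : ¬ G.Splits := by
  rintro ⟨X, hX⟩
  obtain ⟨C, hC⟩ := exists_isNegativeCircuit (G := G.keep X) fun U => by
    rw [sig_keep]; exact (hX U).1
  obtain ⟨D, hD⟩ := exists_isNegativeCircuit (G := G.keep Xᶜ) fun U => by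
    rw [sig_keep, ← Set.sdiff_eq]; exact (hX U).2
  have hCX : C ⊆ X := fun e he => ((G.edgeSet_keep X).le (hC.1.subset he)).2
  have hDX : D ⊆ Xᶜ := fun e he => ((G.edgeSet_keep Xᶜ).le (hD.1.subset he)).2
  have hC' := (G.isSubgraph_keep X).isNegativeCircuit hC
  have hD' := (G.isSubgraph_keep Xᶜ).isNegativeCircuit hD
  obtain ⟨⟨m, v, e, -, he, hev, rfl⟩, hCo⟩ := hC'
  obtain ⟨⟨n, w, f, -, hf, hfw, rfl⟩, hDo⟩ := hD'
  have hef : ∀ i j, e i ≠ f j := fun i j hij => hDX ⟨j, rfl⟩ (hij ▸ hCX ⟨i, rfl⟩)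
  have hsucc : ∀ {l : ℕ} {u : Fin (l + 1) → α} {g : Fin (l + 1) → β},
      (∀ i, G.IsLink (g i) (u i) (u (i + 1))) → ∀ i : Fin (l + 1), i ≠ i - 1 := by
    intro l u g hgu i hi
    have h1 : i + 1 = i := by
      nth_rw 1 [hi]; exact sub_add_cancel i 1
    have := hgu i
    rw [h1] at this
    exact hloop _ _ this
  have hprev : ∀ {l : ℕ} {u : Fin (l + 1) → α} {g : Fin (l + 1) → β},
      (∀ i, G.IsLink (g i) (u i) (u (i + 1))) → ∀ i, G.Inc (g (i - 1)) (u i) := by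
    intro l u g hgu i
    have := hgu (i - 1)
    rw [sub_add_cancel] at this
    exact this.symm.inc_left
  have hvw : ∀ i j, v i ≠ w j := by
    intro i j hij
    have h1 := (hev i).inc_left
    have h2 := hprev hev i
    have h3 := (hfw j).inc_left
    have h4 := hprev hfw j
    rw [← hij] at h3 h4
    have key : ∀ a b c d : Fin 3, a ≠ b → a ≠ c → a ≠ d → b ≠ c → b ≠ d → c ≠ d → False := by
      intro a b c d
      simp only [ne_eq, Fin.ext_iff]
      omega
    exact key _ _ _ _ (fun h => hsucc hev i (he (hp _ _ _ h1 h2 h)))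
      (fun h => hef _ _ (hp _ _ _ h1 h3 h)) (fun h => hef _ _ (hp _ _ _ h1 h4 h))
      (fun h => hef _ _ (hp _ _ _ h2 h3 h)) (fun h => hef _ _ (hp _ _ _ h2 h4 h))
      (fun h => hsucc hfw j (hf (hp _ _ _ h3 h4 h)))
  have hsum : ∑ i, ∑ j, ind G.neg (e i) * ind G.neg (f j) = 1 := by
    rw [← Finset.sum_mul_sum, ← ncard_range_inter he, ← ncard_range_inter hf,
      (odd_iff_cast _).1 hCo, (odd_iff_cast _).1 hDo, one_mul]
  have hzero : ∑ i, ∑ j, ind G.neg (e i) * ind G.neg (f j) = 0 := by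
    have h1 : ∀ i j, ind G.neg (e i) * ind G.neg (f j) = (A (f j) (v i) + A (f j) (v (i + 1))) +
        (B (e i) (w j) + B (e i) (w (j + 1))) := fun i j =>
      (h _ _ _ _ _ _ (hev i) (hfw j) (hvw _ _) (hvw _ _) (hvw _ _) (hvw _ _)).symm
    simp only [h1, Finset.sum_add_distrib (f := fun j => A _ _ + A _ _)]
    rw [Finset.sum_add_distrib, Finset.sum_comm]
    have h2 : ∀ j, ∑ i, (A (f j) (v i) + A (f j) (v (i + 1))) = 0 := fun j =>
      sum_add_shift m fun i => A (f j) (v i)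
    have h3 : ∀ i, ∑ j, (B (e i) (w j) + B (e i) (w (j + 1))) = 0 := fun i =>
      sum_add_shift n fun j => B (e i) (w j)
    simp only [h2, h3, Finset.sum_const_zero, add_zero]
  rw [hzero] at hsum
  exact zero_ne_one hsum

/-! ### Walls on the Möbius band -/

/-- The lower end of the vertical edge with upper end `x`. The vertices `(i, q)` of a row `i` are
numbered from left to right if `i` is even, and from right to left if `i` is odd. -/
def wallDown (k : ℕ) (x : ℕ × ℕ) : ℕ × ℕ :=
  if x.1 % 2 = 0 then (x.1 + 1, 4 * k - x.2)
  else if x.1 + 1 < 2 * k then (x.1 + 1, 4 * k - 2 - x.2) else (0, x.2)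

/-- The edge `(false, x)` is the horizontal edge with first end `x`, and `(true, x)` the vertical
edge with upper end `x`; this is its other end. -/
def wallEnd (k : ℕ) : Bool × ℕ × ℕ → ℕ × ℕ
  | (true, x) => wallDown k x
  | (false, x) => (x.1, x.2 + 1)

/-- The edges of the wall with `2 * k` rows and `2 * k` columns. -/
def wallEdges (k : ℕ) : Set (Bool × ℕ × ℕ) :=
  {e | e.2.1 < 2 * k ∧ e.2.2 < 4 * k ∧
    ((e.1 = true ∧ (e.2.1 + e.2.2) % 2 = 1) ∨ (e.1 = false ∧ e.2.2 + 1 < 4 * k))}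

/-- The order of the vertices along a curve that traverses the rows one by one. -/
def wallPos (k : ℕ) (x : ℕ × ℕ) : ℕ := 4 * k * x.1 + x.2

lemma wallPos_lt_iff {k : ℕ} {x y : ℕ × ℕ} (hx : x.2 < 4 * k) (hy : y.2 < 4 * k) :
    wallPos k x < wallPos k y ↔ x.1 < y.1 ∨ x.1 = y.1 ∧ x.2 < y.2 := by
  unfold wallPos
  rcases lt_trichotomy x.1 y.1 with h | h | h
  · have : 4 * k * (x.1 + 1) ≤ 4 * k * y.1 := Nat.mul_le_mul_left _ h
    rw [mul_add, mul_one] at this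
    exact iff_of_true (by omega) (Or.inl h)
  · rw [h]; simp
  · have : 4 * k * (y.1 + 1) ≤ 4 * k * x.1 := Nat.mul_le_mul_left _ h
    rw [mul_add, mul_one] at this
    exact iff_of_false (by omega) (by omega)

lemma wallPos_eq_iff {k : ℕ} {x y : ℕ × ℕ} (hx : x.2 < 4 * k) (hy : y.2 < 4 * k) :
    wallPos k x = wallPos k y ↔ x = y := by
  have h1 := wallPos_lt_iff hx hy
  have h2 := wallPos_lt_iff hy hx
  rw [Prod.ext_iff]
  omega

lemma wallEnd_mem {k : ℕ} {e : Bool × ℕ × ℕ} (he : e ∈ wallEdges k) :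
    (wallEnd k e).1 < 2 * k ∧ (wallEnd k e).2 < 4 * k := by
  obtain ⟨_ | _, i, q⟩ := e <;>
    simp only [wallEdges, Set.mem_ofPred_eq, reduceCtorEq, true_and, false_and, or_false,
      false_or] at he <;> simp only [wallEnd, wallDown]
  · omega
  · split_ifs <;> simp only <;> omega

lemma wallEnd_ne {k : ℕ} {e : Bool × ℕ × ℕ} (he : e ∈ wallEdges k) : e.2 ≠ wallEnd k e := by
  obtain ⟨_ | _, i, q⟩ := e <;>
    simp only [wallEdges, Set.mem_ofPred_eq, reduceCtorEq, true_and, false_and, or_false,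
      false_or] at he <;> simp only [wallEnd, wallDown, ne_eq, Prod.ext_iff]
  · omega
  · split_ifs <;> simp only <;> omega

/-- A hexagonal wall, closed up to a Möbius band by negative edges from the last row to the first
row. -/
def wall (k : ℕ) : SignedGraph (ℕ × ℕ) (Bool × ℕ × ℕ) where
  vertexSet := {x | x.1 < 2 * k ∧ x.2 < 4 * k}
  IsLink e x y := e ∈ wallEdges k ∧
    ((x = e.2 ∧ y = wallEnd k e) ∨ (x = wallEnd k e ∧ y = e.2))
  edgeSet := wallEdges k
  isLink_symm := fun e _ => ⟨fun x y h => ⟨h.1, h.2.symm.imp And.symm And.symm⟩⟩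
  eq_or_eq_of_isLink_of_isLink := by
    rintro e x y v w ⟨-, ⟨rfl, rfl⟩ | ⟨rfl, rfl⟩⟩ ⟨-, ⟨rfl, rfl⟩ | ⟨rfl, rfl⟩⟩ <;> simp
  edge_mem_iff_exists_isLink := fun e =>
    ⟨fun h => ⟨_, _, h, Or.inl ⟨rfl, rfl⟩⟩, fun ⟨_, _, h, _⟩ => h⟩
  left_mem_of_isLink := by
    rintro e x y ⟨h, ⟨rfl, rfl⟩ | ⟨rfl, rfl⟩⟩
    · exact ⟨h.1, h.2.1⟩
    · exact wallEnd_mem h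
  neg := {e | e ∈ wallEdges k ∧ e.1 = true ∧ e.2.1 + 1 = 2 * k}
  neg_subset := fun e he => he.1
  finite_vertexSet := ((Set.finite_Iio (2 * k)).prod (Set.finite_Iio (4 * k))).subset
    fun x hx => ⟨hx.1, hx.2⟩
  finite_edgeSet := ((Set.finite_univ (α := Bool)).prod
    ((Set.finite_Iio (2 * k)).prod (Set.finite_Iio (4 * k)))).subset
    fun x hx => ⟨trivial, hx.1, hx.2.1⟩

/-- `v` lies strictly between `a` and `b`. -/
def Between (a b v : ℕ) : Prop := (a < v ∧ v < b) ∨ (b < v ∧ v < a)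

lemma between_comm_iff {a b c d : ℕ} (h1 : a ≠ c) (h2 : a ≠ d) (h3 : b ≠ c) (h4 : b ≠ d) :
    (Between c d a ↔ Between c d b) ↔ (Between a b c ↔ Between a b d) := by
  unfold Between
  omega

lemma not_between_wallEnd_false {k : ℕ} {i q : ℕ} (v : ℕ) :
    ¬ Between (wallPos k (i, q)) (wallPos k (wallEnd k (false, i, q))) v := by
  simp only [Between, wallEnd, wallPos]
  omega

/-- Vertical edges that are drawn on the same side cross if and only if both are negative. -/
lemma between_wallDown_iff {k : ℕ} {x y : ℕ × ℕ} (hx : (true, x) ∈ wallEdges k)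
    (hy : (true, y) ∈ wallEdges k) (hxy : x ≠ y) (hpar : x.1 % 2 = y.1 % 2) :
    (Between (wallPos k y) (wallPos k (wallDown k y)) (wallPos k x) ↔
      Between (wallPos k y) (wallPos k (wallDown k y)) (wallPos k (wallDown k x))) ↔
      ¬ (x.1 + 1 = 2 * k ∧ y.1 + 1 = 2 * k) := by
  have hx' := wallEnd_mem hx
  have hy' := wallEnd_mem hy
  simp only [wallEnd] at hx' hy'
  have hx2 := hx.2.1
  have hy2 := hy.2.1
  simp only [Between]
  rw [wallPos_lt_iff hy2 hx2, wallPos_lt_iff hx2 hy'.2, wallPos_lt_iff hy'.2 hx2,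
    wallPos_lt_iff hx2 hy2, wallPos_lt_iff hy2 hx'.2, wallPos_lt_iff hx'.2 hy'.2,
    wallPos_lt_iff hy'.2 hx'.2, wallPos_lt_iff hx'.2 hy2]
  obtain ⟨i, q⟩ := x
  obtain ⟨j, r⟩ := y
  simp only [wallEdges, Set.mem_ofPred_eq, reduceCtorEq, true_and, false_and, or_false] at hx hy
  simp only [ne_eq, Prod.mk.injEq] at hxy hpar
  clear hx' hy' hx2 hy2
  simp only [wallDown]
  by_cases hi : i % 2 = 0
  · rw [if_pos hi, if_pos (hpar ▸ hi)]
    refine (iff_true_right (by omega)).2 ?_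
    dsimp only
    rcases lt_trichotomy i j with hij | rfl | hij
    · exact iff_of_false (by omega) (by omega)
    · rcases lt_or_gt_of_ne (fun h => hxy ⟨rfl, h⟩ : q ≠ r) with hqr | hqr
      · exact iff_of_false (by omega) (by omega)
      · exact iff_of_true (by omega) (by omega)
    · exact iff_of_false (by omega) (by omega)
  · rw [if_neg hi, if_neg (hpar ▸ hi)]
    by_cases hi' : i + 1 < 2 * k
    · refine (iff_true_right (by omega)).2 ?_
      rw [if_pos hi']
      by_cases hj' : j + 1 < 2 * k
      · rw [if_pos hj']
        dsimp only
        rcases lt_trichotomy i j with hij | rfl | hij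
        · exact iff_of_false (by omega) (by omega)
        · rcases lt_or_gt_of_ne (fun h => hxy ⟨rfl, h⟩ : q ≠ r) with hqr | hqr
          · exact iff_of_false (by omega) (by omega)
          · exact iff_of_true (by omega) (by omega)
        · exact iff_of_false (by omega) (by omega)
      · rw [if_neg hj']
        dsimp only
        exact iff_of_true (by omega) (by omega)
    · rw [if_neg hi']
      by_cases hj' : j + 1 < 2 * k
      · refine (iff_true_right (by omega)).2 ?_
        rw [if_pos hj']
        dsimp only
        exact iff_of_false (by omega) (by omega)
      · refine (iff_false_right (by omega)).2 ?_
        rw [if_neg hj']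
        dsimp only
        obtain rfl : i = j := by omega
        rcases lt_or_gt_of_ne (fun h => hxy ⟨rfl, h⟩ : q ≠ r) with hqr | hqr
        · exact fun h => absurd (h.1 (by omega)) (by omega)
        · exact fun h => absurd (h.2 (by omega)) (by omega)

lemma eq_of_wallDown_eq {k : ℕ} {x y : ℕ × ℕ} (hx : (true, x) ∈ wallEdges k)
    (hy : (true, y) ∈ wallEdges k) (h : wallDown k x = wallDown k y) : x = y := by
  obtain ⟨i, q⟩ := x
  obtain ⟨j, r⟩ := y
  simp only [wallEdges, Set.mem_ofPred_eq, reduceCtorEq, true_and, false_and, or_false] at hx hy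
  simp only [wallDown] at h
  rw [Prod.mk.injEq]
  split_ifs at h <;> rw [Prod.mk.injEq] at h <;> omega

lemma ne_wallDown {k : ℕ} {x y : ℕ × ℕ} (hx : (true, x) ∈ wallEdges k)
    (hy : (true, y) ∈ wallEdges k) : x ≠ wallDown k y := by
  obtain ⟨i, q⟩ := x
  obtain ⟨j, r⟩ := y
  simp only [wallEdges, Set.mem_ofPred_eq, reduceCtorEq, true_and, false_and, or_false] at hx hy
  simp only [wallDown]
  split_ifs <;> rw [ne_eq, Prod.mk.injEq] <;> omega

lemma ite_mul_ite {p q r s : Prop} [Decidable p] [Decidable q] [Decidable r] [Decidable s]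
    (h : (p ↔ q) ↔ ¬ (r ∧ s)) : (if r then 1 else 0 : ZMod 2) * (if s then 1 else 0) =
      (if p then 1 else 0) + (if q then 1 else 0) := by
  by_cases hp : p <;> by_cases hq : q <;> by_cases hr : r <;> by_cases hs : s <;>
    simp only [hp, hq, hr, hs, if_true, if_false] <;> first | decide | (exfalso; tauto)

lemma not_splits_wall (k : ℕ) : ¬ (wall k).Splits := by
  classical
  let btw : Bool × ℕ × ℕ → ℕ × ℕ → ZMod 2 := fun e v =>
    if Between (wallPos k e.2) (wallPos k (wallEnd k e)) (wallPos k v) then 1 else 0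
  let page : Bool × ℕ × ℕ → ZMod 2 := fun e => if e.2.1 % 2 = 0 then 0 else 1
  refine not_splits_of_crossing ?_ (fun e x => if e.1 = true then 2 else if x = e.2 then 1 else 0)
    ?_ (fun f v => (1 + page f) * btw f v) (fun e v => page e * btw e v) ?_
  · rintro e x ⟨he, ⟨h1, h2⟩ | ⟨h1, h2⟩⟩
    · exact wallEnd_ne he (h1.symm.trans h2)
    · exact wallEnd_ne he (h2.symm.trans h1)
  · have hinc : ∀ e x, (wall k).Inc e x → e ∈ wallEdges k ∧ (x = e.2 ∨ x = wallEnd k e) := by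
      rintro e x ⟨y, he, h | h⟩
      · exact ⟨he, Or.inl h.1⟩
      · exact ⟨he, Or.inr h.1⟩
    intro e f x he' hf' hp
    obtain ⟨he, hex⟩ := hinc e x he'
    obtain ⟨hf, hfx⟩ := hinc f x hf'
    clear he' hf'
    obtain ⟨_ | _, y⟩ := e <;> obtain ⟨_ | _, z⟩ := f
    · simp only [wallEnd, Bool.false_eq_true, if_false] at hp hex hfx
      by_cases h1 : x = y
      · by_cases h2 : x = z
        · rw [← h1, ← h2]
        · rw [if_pos h1, if_neg h2] at hp
          exact absurd hp (by decide)
      · by_cases h2 : x = z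
        · rw [if_neg h1, if_pos h2] at hp
          exact absurd hp (by decide)
        · have h3 := (hex.resolve_left h1).symm.trans (hfx.resolve_left h2)
          rw [Prod.mk.injEq, Nat.succ_inj] at h3
          rw [Prod.ext h3.1 h3.2]
    · simp only [Bool.false_eq_true, if_false, if_true] at hp
      split_ifs at hp <;> exact absurd hp (by decide)
    · simp only [Bool.false_eq_true, if_false, if_true] at hp
      split_ifs at hp <;> exact absurd hp (by decide)
    · simp only [wallEnd] at hex hfx
      rcases hex with rfl | rfl <;> rcases hfx with h | h
      · rw [h]
      · exact absurd h (ne_wallDown he hf)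
      · exact absurd h.symm (ne_wallDown hf he)
      · rw [eq_of_wallDown_eq he hf h]
  · have main : ∀ e ∈ wallEdges k, ∀ f ∈ wallEdges k, e.2 ≠ f.2 → e.2 ≠ wallEnd k f →
        wallEnd k e ≠ f.2 → wallEnd k e ≠ wallEnd k f →
        (1 + page f) * btw f e.2 + (1 + page f) * btw f (wallEnd k e) +
          (page e * btw e f.2 + page e * btw e (wallEnd k f)) =
          ind (wall k).neg e * ind (wall k).neg f := by
      intro e he f hf h1 h2 h3 h4
      have he' := wallEnd_mem he
      have hf' := wallEnd_mem hf
      have hsymm : btw f e.2 + btw f (wallEnd k e) = btw e f.2 + btw e (wallEnd k f) := by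
        have := between_comm_iff (mt (wallPos_eq_iff he.2.1 hf.2.1).1 h1)
          (mt (wallPos_eq_iff he.2.1 hf'.2).1 h2) (mt (wallPos_eq_iff he'.2 hf.2.1).1 h3)
          (mt (wallPos_eq_iff he'.2 hf'.2).1 h4)
        simp only [btw]
        split_ifs <;> first | rfl | (exfalso; tauto)
      have hind : ind (wall k).neg e * ind (wall k).neg f = (1 + page f + page e) *
          (btw f e.2 + btw f (wallEnd k e)) := by
        obtain ⟨_ | _, x⟩ := e
        · have h5 : btw f x + btw f (wallEnd k (false, x)) = 0 := by
            rw [hsymm]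
            simp only [btw]
            rw [if_neg (not_between_wallEnd_false _), if_neg (not_between_wallEnd_false _), add_zero]
          have h6 : ind (wall k).neg (false, x) = 0 := if_neg fun h => by simpa using h.2.1
          rw [h5, h6, mul_zero, zero_mul]
        obtain ⟨_ | _, y⟩ := f
        · have h5 : btw (false, y) x + btw (false, y) (wallEnd k (true, x)) = 0 := by
            simp only [btw]
            rw [if_neg (not_between_wallEnd_false _), if_neg (not_between_wallEnd_false _), add_zero]
          have h6 : ind (wall k).neg (false, y) = 0 := if_neg fun h => by simpa using h.2.1
          rw [h5, h6, mul_zero, mul_zero]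
        by_cases hpar : x.1 % 2 = y.1 % 2
        · have h5 := between_wallDown_iff he hf h1 hpar
          have h6 : 1 + page (true, y) + page (true, x) = 1 := by
            simp only [page, hpar]
            split_ifs <;> decide
          have h7 : ind (wall k).neg (true, x) = if x.1 + 1 = 2 * k then 1 else 0 :=
            if_congr ⟨fun h => h.2.2, fun h => ⟨he, rfl, h⟩⟩ rfl rfl
          have h8 : ind (wall k).neg (true, y) = if y.1 + 1 = 2 * k then 1 else 0 :=
            if_congr ⟨fun h => h.2.2, fun h => ⟨hf, rfl, h⟩⟩ rfl rfl
          rw [h6, h7, h8, one_mul]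
          exact ite_mul_ite h5
        · have h6 : 1 + page (true, y) + page (true, x) = 0 := by
            simp only [page]
            split_ifs <;> first | decide | (exfalso; omega)
          have h7 : ¬ ((true, x) ∈ (wall k).neg ∧ (true, y) ∈ (wall k).neg) := fun h => by
            have h8 : x.1 + 1 = 2 * k := h.1.2.2
            have h9 : y.1 + 1 = 2 * k := h.2.2.2
            omega
          rw [h6, zero_mul]
          unfold ind
          split_ifs <;> first | (exfalso; tauto) | simp
      rw [← mul_add, ← mul_add, ← hsymm, hind]
      ring
    rintro e f a b c d ⟨he, ⟨rfl, rfl⟩ | ⟨rfl, rfl⟩⟩ ⟨hf, ⟨rfl, rfl⟩ | ⟨rfl, rfl⟩⟩ h1 h2 h3 h4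
    · exact main e he f hf h1 h2 h3 h4
    · rw [← main e he f hf h2 h1 h4 h3]; ring
    · rw [← main e he f hf h3 h4 h1 h2]; ring
    · rw [← main e he f hf h4 h3 h2 h1]; ring

lemma le_ncard_of_surjOn {γ : Type*} {S : Set γ} (hS : S.Finite) (g : γ → ℕ) {k : ℕ}
    (h : ∀ i < k, ∃ e ∈ S, g e = i) : k ≤ S.ncard := by
  calc k = (Set.Iio k).ncard := by rw [Set.ncard_eq_toFinset_card', Set.toFinset_Iio, Nat.card_Iio]
    _ ≤ (g '' S).ncard := Set.ncard_le_ncard (fun i hi => h i hi) (hS.image g)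
    _ ≤ S.ncard := Set.ncard_image_le hS

/-- The number of the column of a vertex of a wall. -/
def wallCol (k : ℕ) (x : ℕ × ℕ) : ℕ := (if x.1 % 2 = 0 then x.2 else 4 * k - 1 - x.2) / 2

lemma le_ncard_sig_wall (k : ℕ) (U : Set (ℕ × ℕ)) : k ≤ ((wall k).sig U).ncard := by
  by_contra hlt
  have hlink : ∀ e ∈ wallEdges k, (wall k).IsLink e e.2 (wallEnd k e) := fun e he =>
    ⟨he, Or.inl ⟨rfl, rfl⟩⟩
  have hpos : ∀ e ∈ wallEdges k, e ∉ (wall k).sig U → ¬ (e.1 = true ∧ e.2.1 + 1 = 2 * k) →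
      (e.2 ∈ U ↔ wallEnd k e ∈ U) := by
    intro e he hs hn
    have h1 : e ∉ (wall k).neg := fun h => hn h.2
    rw [mem_sig (hlink e he)] at hs
    tauto
  obtain ⟨i, hi, hrow⟩ : ∃ i < 2 * k, ∀ q, (false, i, q) ∉ (wall k).sig U := by
    by_contra! hcon
    have := le_ncard_of_surjOn ((wall k).finite_sig U) (fun e => e.2.1) (k := 2 * k)
      fun i hi => (hcon i hi).imp' (fun q => (false, i, q)) fun q hq => ⟨hq, rfl⟩
    omega
  obtain ⟨j, hj, hcol⟩ : ∃ j < k, ∀ e, (wallCol k e.2 = j ∨ wallCol k e.2 = 2 * k - 1 - j) →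
      e ∉ (wall k).sig U := by
    by_contra! hcon
    refine hlt (le_ncard_of_surjOn ((wall k).finite_sig U)
      (fun e => min (wallCol k e.2) (2 * k - 1 - wallCol k e.2)) fun j hj => ?_)
    obtain ⟨e, h1, h2⟩ := hcon j hj
    exact ⟨e, h2, by omega⟩
  let vtx : ℕ → ℕ → ℕ × ℕ := fun i p => (i, if i % 2 = 0 then p else 4 * k - 1 - p)
  have hrow' : ∀ q, q < 4 * k → ((i, q) ∈ U ↔ (i, 0) ∈ U) := by
    intro q
    induction q with
    | zero => exact fun _ => Iff.rfl
    | succ q ih =>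
      intro hq
      rw [← ih (by omega)]
      exact (hpos (false, i, q) ⟨hi, Nat.lt_of_succ_lt hq, Or.inr ⟨rfl, hq⟩⟩ (hrow q)
        (by simp)).symm
  have hvtx : ∀ l p, p < 4 * k → wallCol k (vtx l p) = p / 2 := by
    intro l p hp
    simp only [vtx, wallCol]
    split_ifs
    · rfl
    · congr 1; omega
  have hgo : ∀ c < 2 * k, (c = j ∨ c = 2 * k - 1 - j) → ∀ l < 2 * k,
      (vtx l (2 * c) ∈ U ↔ vtx 0 (2 * c) ∈ U) ∧ (vtx l (2 * c + 1) ∈ U ↔ vtx 0 (2 * c) ∈ U) := by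
    intro c hc hcj l
    have hin : ∀ l < 2 * k, (vtx l (2 * c) ∈ U ↔ vtx l (2 * c + 1) ∈ U) := by
      intro l hl
      by_cases hpar : l % 2 = 0
      · have := hpos (false, vtx l (2 * c))
          ⟨hl, by simp only [vtx, if_pos hpar]; omega,
            Or.inr ⟨rfl, by simp only [vtx, if_pos hpar]; omega⟩⟩
          (hcol _ (by rw [hvtx _ _ (by omega)]; omega)) (by simp)
        simpa only [wallEnd, vtx, if_pos hpar] using this
      · have := hpos (false, vtx l (2 * c + 1))
          ⟨hl, by simp only [vtx, if_neg hpar]; omega,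
            Or.inr ⟨rfl, by simp only [vtx, if_neg hpar]; omega⟩⟩
          (hcol _ (by rw [hvtx _ _ (by omega)]; omega)) (by simp)
        have h1 : wallEnd k (false, vtx l (2 * c + 1)) = vtx l (2 * c) := by
          simp only [wallEnd, vtx, if_neg hpar, Prod.mk.injEq, true_and]; omega
        rw [h1] at this
        exact this.symm
    induction l with
    | zero => exact fun hl => ⟨Iff.rfl, (hin 0 hl).symm⟩
    | succ l ih =>
      intro hl
      suffices h : vtx (l + 1) (2 * c) ∈ U ↔ vtx 0 (2 * c) ∈ U from
        ⟨h, (hin _ hl).symm.trans h⟩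
      rw [← (ih (by omega)).2]
      have h1 : wallEnd k (true, vtx l (2 * c + 1)) = vtx (l + 1) (2 * c) := by
        simp only [wallEnd, wallDown, vtx]
        split_ifs <;> rw [Prod.mk.injEq] <;> omega
      rw [← h1]
      refine (hpos (true, vtx l (2 * c + 1)) ⟨?_, ?_, Or.inl ⟨rfl, ?_⟩⟩
        (hcol _ (by rw [hvtx _ _ (by omega)]; omega)) ?_).symm
      · simp only [vtx]; omega
      · simp only [vtx]; split_ifs <;> omega
      · simp only [vtx]; split_ifs <;> omega
      · simp only [vtx]; omega
  have hcross : ∀ p < 4 * k, (vtx i p ∈ U ↔ (i, 0) ∈ U) := fun p hp =>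
    hrow' _ (by split_ifs <;> omega)
  have h1 := hgo j (by omega) (Or.inl rfl)
  have h2 := hgo (2 * k - 1 - j) (by omega) (Or.inr rfl)
  have h3 : vtx (2 * k - 1) (2 * j + 1) ∈ U ↔ vtx 0 (2 * (2 * k - 1 - j)) ∈ U := by
    rw [(h1 (2 * k - 1) (by omega)).2, ← (h1 i hi).1, hcross _ (by omega), ← (h2 i hi).1,
      hcross _ (by omega)]
  have hneg : (true, vtx (2 * k - 1) (2 * j + 1)) ∈ wallEdges k := by
    refine ⟨?_, ?_, Or.inl ⟨rfl, ?_⟩⟩ <;> simp only [vtx]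
    · omega
    · split_ifs <;> omega
    · split_ifs <;> omega
  have hend : wallEnd k (true, vtx (2 * k - 1) (2 * j + 1)) = vtx 0 (2 * (2 * k - 1 - j)) := by
    simp only [wallEnd, wallDown, vtx]
    split_ifs <;> rw [Prod.mk.injEq] <;> omega
  have h4 := hcol (true, vtx (2 * k - 1) (2 * j + 1)) (by rw [hvtx _ _ (by omega)]; omega)
  rw [mem_sig (hlink _ hneg), hend] at h4
  have h5 : (true, vtx (2 * k - 1) (2 * j + 1)) ∈ (wall k).neg :=
    ⟨hneg, rfl, by simp only [vtx]; omega⟩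
  exact h4 (iff_of_true h5 h3)

lemma Splits.of_isSubgraph {H G : SignedGraph α β} (h : H.IsSubgraph G) (hs : H.Splits) :
    G.Splits := by
  obtain ⟨X, hX⟩ := hs
  refine ⟨X ∩ H.edgeSet, fun U => ?_⟩
  obtain ⟨⟨e, he, heX⟩, f, hf, hfX⟩ := hX U
  rw [h.sig_eq] at he hf
  exact ⟨⟨e, he.1, heX, he.2⟩, f, hf.1, fun hf' => hfX hf'.1⟩

lemma classSStar_nonempty (α β : Type*) [Infinite α] [Infinite β] {k : ℕ} (hk : 1 ≤ k) :
    (classSStar α β k).Nonempty := by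
  obtain ⟨G, hG⟩ := exists_switchIso α β (wall k)
  obtain ⟨κ, hP⟩ := (wall k).presents_self.switchIso hG
  obtain ⟨L, -, hL⟩ := G.exists_isCritical_keep hk subset_rfl fun U => by
    obtain ⟨V, hV⟩ := hP.exists_fr U
    rw [Set.inter_eq_left.2 (G.sig_subset U), hV, Set.ncard_image_of_injective _ hP.injective,
      Set.ncard_preimage_of_injective_subset_range Subtype.val_injective]
    · exact le_ncard_sig_wall k V
    · rw [Subtype.range_coe]
      exact (wall k).sig_subset V
  exact ⟨_, mem_classS_of_not_splits hL fun hs => not_splits_wall k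
    (hG.splits_iff.1 (hs.of_isSubgraph (G.isSubgraph_keep L)))⟩

end SignedGraph

theorem mainTheorem7 (α β : Type*) [Infinite α] [Infinite β] :
    (SignedGraph.classS α β 1 = SignedGraph.classSStar α β 1 ∧
      {G ∈ SignedGraph.classS α β 1 | G.NoIsolatedVertex} =
        {G | G.IsSubdivisionOf SignedGraph.negC1}) ∧
    (SignedGraph.classS α β 2 = SignedGraph.classSStar α β 2 ∧
      {G ∈ SignedGraph.classS α β 2 | G.NoIsolatedVertex} =
        {G | G.IsSubdivisionOf SignedGraph.negK4}) ∧
    (∀ k : ℕ, 3 ≤ k →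
      (SignedGraph.classSStar α β k).Nonempty ∧
      SignedGraph.classSStar α β k ⊂ SignedGraph.classS α β k) ∧
    (∀ t : ℕ, 2 ≤ t → ∀ G : SignedGraph α β, (SignedGraph.negOddWheel t).SwitchIso G →
      G ∈ SignedGraph.classS α β (t + 1) \ SignedGraph.classSStar α β (t + 1)) ∧
    (⋃ k ≥ 1, SignedGraph.classSStar α β k) ⊂ (⋃ k ≥ 1, SignedGraph.classS α β k) := by
  have hwheel : ∀ k : ℕ, 3 ≤ k →
      ∃ G, G ∈ SignedGraph.classS α β k \ SignedGraph.classSStar α β k := fun k hk => by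
    obtain ⟨t, rfl⟩ : ∃ t, k = t + 1 := ⟨k - 1, by omega⟩
    obtain ⟨G, hG⟩ := SignedGraph.exists_switchIso α β (SignedGraph.negOddWheel t)
    exact ⟨G, SignedGraph.switchIso_negOddWheel_mem (by omega) hG⟩
  refine ⟨⟨?_, ?_⟩, ⟨SignedGraph.classS_two_eq, ?_⟩, fun k hk => ⟨?_, ?_⟩,
    fun t ht G hG => SignedGraph.switchIso_negOddWheel_mem ht hG, ?_⟩
  · ext G
    rw [SignedGraph.mem_classS_one, SignedGraph.mem_classSStar_one]
  · ext G
    change G ∈ SignedGraph.classS α β 1 ∧ _ ↔ G.IsSubdivisionOf _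
    rw [SignedGraph.mem_classS_one, SignedGraph.isSubdivisionOf_negC1_iff]
    exact ⟨fun h => ⟨h.1, SignedGraph.not_splits_of_isCritical_one h.1, h.2⟩,
      fun h => ⟨h.1, h.2.2⟩⟩
  · ext G
    change G ∈ SignedGraph.classS α β 2 ∧ _ ↔ G.IsSubdivisionOf _
    rw [SignedGraph.mem_classS_two, SignedGraph.isSubdivisionOf_negK4_iff]
    exact and_assoc
  · exact SignedGraph.classSStar_nonempty α β (by omega)
  · obtain ⟨G, hG, hG'⟩ := hwheel k hk
    exact ⟨SignedGraph.classSStar_subset_classS k, fun h => hG' (h hG)⟩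
  · refine ⟨Set.iUnion₂_mono fun k _ => SignedGraph.classSStar_subset_classS k, fun h => ?_⟩
    obtain ⟨G, hG, hG'⟩ := hwheel 3 le_rfl
    have h1 := h (Set.mem_iUnion₂.2 ⟨3, by norm_num, hG⟩)
    obtain ⟨k, -, hk⟩ := Set.mem_iUnion₂.1 h1
    rw [hG.1.eq hk.1] at hG'
    exact hG' hk
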